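/- Conventions. A triangulation $\Gamma$ of a closed surface $M$ (connected, not necessarily orientable) is a finite simple connected graph embedded in $M$ whose faces are closed triangles and which has no vertex of degree $2$; equivalently, a finite simplicial complex whose geometric realization is homeomorphic to $M$. It is spherical if $M=\mathbb S^2$. A zigzag is a cyclic sequence of edges $e_i=x_ix_{i+1}$ such that, for every $i$, the distinct vertices $x_i,x_{i+1},x_{i+2}$ form a face and $x_{i+3}\ne x_i$. $\Gamma$ is $z$-knotted if it has precisely one zigzag up to reversing. A $z$-orientation $\tau$ is a set of zigzags containing exactly one of $Z,Z^{-1}$ for every zigzag $Z$. An edge is of type I if the zigzags of $\tau$ pass through it in both directions, and of type II if they pass through it in one direction only (which directs the edge). $(\Gamma,\tau)$ is $z$-homogeneous if every zigzag of $\tau$ is a cyclic sequence of triples of edges, the first edge of each triple being of type II and the other two of type I. A special pair $P$ in a $z$-homogeneous $(\Gamma,\tau)$ consists of two edges of type II forming a directed path $v_1\to v_2\to v_3$. Cutting $\Gamma$ along $P$ doubles both edges and the vertex $v_2$ and creates a $4$-gonal face $F_P$ whose boundary consists of the directed paths $v_1\to v_2^{\pm}\to v_3$. For special pairs $P$ in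 $(\Gamma,\tau)$ and $P'$ in $(\Gamma',\tau')$ such that the endpoints of at least one of $P,P'$ are not joined by an edge, a homeomorphism $g:\partial F_P\to\partial F_{P'}$ is special if it sends vertices to vertices and directed edges to directed edges. The connected sum $\Gamma\#_g\Gamma'$ is obtained by removing the interiors of $F_P$ and $F_{P'}$ and gluing their boundaries by $g$; it is taken with the $z$-orientation for which every edge keeps the type, and every edge of type II the direction, that it has in $(\Gamma,\tau)$ or $(\Gamma',\tau')$. Theorem. Let $(\Gamma,\tau)$ be a $z$-homogeneous triangulation of a closed surface $M$. Then there are $n\ge 0$, spherical $z$-homogeneous triangulations $(\Gamma_1,\tau_1),\dots,(\Gamma_n,\tau_n)$, and for each $i\in\{1,\dots,n\}$ a special pair $P_i$ in $\Gamma^{(i-1)}$ whose two edges come from edges of $\Gamma$, a special pair $P_i'$ in $\Gamma_i$, the endpoints of at least one of $P_i,P_i'$ being not joined by an edge, and a special homeomorphism $g_i:\partial F_{P_i}\to\partial F_{P'_i}$, where $\Gamma^{(0)}=\Gamma$ and $\Gamma^{(i)}=\Gamma^{(i-1)}\#_{g_i}\Gamma_i$, such that $$\Gamma^{(n)}=(((\Gamma\#_{g_1}\Gamma_1)\#_{g_2}\Gamma_2)\dots)\#_{g_n}\Gamma_n$$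 is a $z$-homogeneous triangulation of $M$ which is $z$-knotted. (An edge of $\Gamma^{(i)}$ comes from an edge of $\Gamma$ if it is an edge, or one of the two copies of an edge, of $\Gamma^{(i-1)}$ that comes from an edge of $\Gamma$; for $i=0$ these are all edges.) -/

import Mathlib

/-!
Triangulated closed surfaces are modelled by finite abstract simplicial complexes, given by their
set of triangles ("faces"), together with a homeomorphism from the geometric realization to the
surface. The embedded graph is the 1-skeleton.
-/

universe u v

namespace ZTri

/-! ### Triangulations of surfaces -/

/-- Two distinct vertices are adjacent if some face contains both of them. -/
def Adj {V : Type u} (K : Set (Finset V)) (x y : V) : Prop :=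
  x ≠ y ∧ ∃ F ∈ K, x ∈ F ∧ y ∈ F

/-- The embedded graph: the 1-skeleton of the complex with set of triangles `K`. -/
def graph {V : Type u} (K : Set (Finset V)) : SimpleGraph V where
  Adj := Adj K
  symm := ⟨fun _ _ h => ⟨h.1.symm, h.2.elim fun F hF => ⟨F, hF.1, hF.2.2, hF.2.1⟩⟩⟩
  loopless := ⟨fun _ h => h.1 rfl⟩

/-- `a, b, c` are the three distinct vertices of a face. -/
def IsTriangle {V : Type u} (K : Set (Finset V)) (a b c : V) : Prop :=
  a ≠ b ∧ b ≠ c ∧ a ≠ c ∧ ∃ F ∈ K, a ∈ F ∧ b ∈ F ∧ c ∈ F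

/-- The link of the vertex `x`: its vertices are the neighbours of `x`, and two of them are joined
if they form a face together with `x`. -/
def link {V : Type u} (K : Set (Finset V)) (x : V) : SimpleGraph {y : V // Adj K x y} where
  Adj y z := IsTriangle K x y z
  symm := ⟨fun _ _ h => ⟨h.2.2.1, h.2.1.symm, h.1,
    h.2.2.2.elim fun F hF => ⟨F, hF.1, hF.2.1, hF.2.2.2, hF.2.2.1⟩⟩⟩
  loopless := ⟨fun _ h => h.2.1 rfl⟩

/-- `K` is the set of triangles of a finite connected simplicial complex which is a closed surface:
it is purely 2-dimensional, every edge is in precisely two faces, and the link of every vertex is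
connected (hence it is a cycle). -/
structure IsClosedSurface {V : Type u} (K : Set (Finset V)) : Prop where
  finite : Finite V
  card_eq : ∀ F ∈ K, F.card = 3
  exists_face : ∀ x : V, ∃ F ∈ K, x ∈ F
  two_faces : ∀ x y : V, Adj K x y → {F | F ∈ K ∧ x ∈ F ∧ y ∈ F}.ncard = 2
  link_connected : ∀ x : V, (link K x).Connected
  connected : (graph K).Connected

/-- The geometric realization, in barycentric coordinates, as a subspace of `V → ℝ`. -/
def Realization {V : Type u} (K : Set (Finset V)) : Type u :=
  {f : V → ℝ // (∀ x, 0 ≤ f x) ∧ ∃ F ∈ K, (∀ x, x ∉ F → f x = 0) ∧ ∑ x ∈ F, f x = 1}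

instance {V : Type u} (K : Set (Finset V)) : TopologicalSpace (Realization K) :=
  instTopologicalSpaceSubtype

/-- `K` is a triangulation of the topological space `M`. -/
def Triangulates {V : Type u} (K : Set (Finset V)) (M : Type v) [TopologicalSpace M] : Prop :=
  Nonempty (Realization K ≃ₜ M)

/-! ### Zigzags and z-orientations -/

/-- A zigzag, written as its bi-infinite sequence of vertices: its edges are `e i = Z i Z (i + 1)`.
Consecutive edges `e i`, `e (i + 1)` lie in a common face, the faces containing `e i, e (i + 1)` and
`e (i + 1), e (i + 2)` are distinct, and `e i`, `e (i + 2)` have no common vertex. -/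
def IsZigzag {V : Type u} (K : Set (Finset V)) (Z : ℤ → V) : Prop :=
  ∀ i, IsTriangle K (Z i) (Z (i + 1)) (Z (i + 2)) ∧ Z (i + 3) ≠ Z i

/-- The reversed zigzag. -/
def reverse {V : Type u} (Z : ℤ → V) : ℤ → V := fun i => Z (-i)

/-- The two sequences are the same cyclic sequence, i.e. they differ by a shift. -/
def SameCyclic {V : Type u} (Z Z' : ℤ → V) : Prop := ∃ k : ℤ, ∀ i, Z' i = Z (i + k)

/-- There is precisely one zigzag up to reversing. -/
def IsZKnotted {V : Type u} (K : Set (Finset V)) : Prop :=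
  ∃ Z, IsZigzag K Z ∧ ∀ Z', IsZigzag K Z' → SameCyclic Z Z' ∨ SameCyclic (reverse Z) Z'

/-- A z-orientation: a collection of zigzags (regarded as cyclic sequences, that is, the collection
is closed under shifts) containing precisely one of `Z` and its reverse, for every zigzag `Z`. -/
structure IsZOrientation {V : Type u} (K : Set (Finset V)) (τ : Set (ℤ → V)) : Prop where
  isZigzag : ∀ Z ∈ τ, IsZigzag K Z
  shift : ∀ Z ∈ τ, ∀ Z', SameCyclic Z Z' → Z' ∈ τ
  orient : ∀ Z, IsZigzag K Z → Xor (Z ∈ τ) (reverse Z ∈ τ)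

/-- Some zigzag of `τ` passes through the edge `xy` in the direction from `x` to `y`. -/
def Passes {V : Type u} (τ : Set (ℤ → V)) (x y : V) : Prop :=
  ∃ Z ∈ τ, ∃ i, Z i = x ∧ Z (i + 1) = y

/-- The edge `xy` is of type I: the zigzags of `τ` pass through it in different directions. -/
def TypeI {V : Type u} (K : Set (Finset V)) (τ : Set (ℤ → V)) (x y : V) : Prop :=
  Adj K x y ∧ Passes τ x y ∧ Passes τ y x

/-- The edge `xy` is of type II with induced direction from `x` to `y`: the zigzags of `τ` pass
through it in this direction only. -/
def TypeII {V : Type u} (K : Set (Finset V)) (τ : Set (ℤ → V)) (x y : V) : Prop :=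
  Adj K x y ∧ Passes τ x y ∧ ¬ Passes τ y x

/-- A zigzag is homogeneous if it is a cyclic sequence of triples of edges, in each of which the
first edge is of type II and the two others are of type I. -/
def IsHomogeneous {V : Type u} (K : Set (Finset V)) (τ : Set (ℤ → V)) (Z : ℤ → V) : Prop :=
  ∃ r : ℤ, ∀ k : ℤ, TypeII K τ (Z (r + 3 * k)) (Z (r + 3 * k + 1)) ∧
    TypeI K τ (Z (r + 3 * k + 1)) (Z (r + 3 * k + 2)) ∧
    TypeI K τ (Z (r + 3 * k + 2)) (Z (r + 3 * k + 3))

/-- `(K, τ)` is a z-homogeneous triangulation of a closed surface. -/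
structure IsZHomogeneous {V : Type u} (K : Set (Finset V)) (τ : Set (ℤ → V)) : Prop where
  surface : IsClosedSurface K
  orientation : IsZOrientation K τ
  homogeneous : ∀ Z ∈ τ, IsHomogeneous K τ Z

/-- `(K, τ)` is a spherical z-homogeneous triangulation. -/
def IsSphericalZHomogeneous {V : Type u} (K : Set (Finset V)) (τ : Set (ℤ → V)) : Prop :=
  IsZHomogeneous K τ ∧ Triangulates K (Metric.sphere (0 : EuclideanSpace ℝ (Fin 3)) 1)

/-! ### Special pairs and cutting -/

/-- A special pair: a directed path `v₁ → v₂ → v₃` of two edges of type II. The two sides of the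
path at `v₂` are labelled: faces at `v₂` which are neighbours across an edge not in the path are on
the same side, the two faces at an edge of the path are on different sides. Only the values of
`side` on the faces containing `v₂` matter. -/
structure SpecialPair {V : Type u} (K : Set (Finset V)) (τ : Set (ℤ → V)) where
  v₁ : V
  v₂ : V
  v₃ : V
  typeII₁ : TypeII K τ v₁ v₂
  typeII₂ : TypeII K τ v₂ v₃
  side : Finset V → Bool
  side_eq : ∀ F ∈ K, ∀ G ∈ K, ∀ x, x ≠ v₁ → x ≠ v₂ → x ≠ v₃ →
    v₂ ∈ F → x ∈ F → v₂ ∈ G → x ∈ G → side F = side G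
  side_ne₁ : ∀ F ∈ K, ∀ G ∈ K, F ≠ G → v₁ ∈ F → v₂ ∈ F → v₁ ∈ G → v₂ ∈ G → side F ≠ side G
  side_ne₂ : ∀ F ∈ K, ∀ G ∈ K, F ≠ G → v₂ ∈ F → v₃ ∈ F → v₂ ∈ G → v₃ ∈ G → side F ≠ side G

/-- The vertices of the 4-gonal face which appears when the surface is cut along a special pair:
`v₁`, the two copies of `v₂`, and `v₃`. -/
inductive QuadVertex : Type
  | first
  | mid (δ : Bool)
  | last

/-- The directed edges of the 4-gonal face. -/
inductive QuadEdge : QuadVertex → QuadVertex → Prop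
  | in_mid (δ : Bool) : QuadEdge .first (.mid δ)
  | out_mid (δ : Bool) : QuadEdge (.mid δ) .last

/-- A special homeomorphism between the boundaries of two 4-gonal faces (up to isotopy fixing the
vertices): vertices go to vertices and directed edges to directed edges. -/
structure SpecialHomeo where
  toEquiv : QuadVertex ≃ QuadVertex
  map_edge : ∀ p q, QuadEdge p q → QuadEdge (toEquiv p) (toEquiv q)

section Cut

variable {V : Type u} {K : Set (Finset V)} {τ : Set (ℤ → V)} (P : SpecialPair K τ)

/-- The vertices after cutting along `P`: the vertex `v₂` is split in two. -/
abbrev CutVertex : Type u := {x : V // x ≠ P.v₂} ⊕ Bool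

/-- The copy of the vertex `x` of the face `F` after cutting along `P`. -/
noncomputable def cut (F : Finset V) (x : V) : CutVertex P :=
  open Classical in if h : x = P.v₂ then Sum.inr (P.side F) else Sum.inl ⟨x, h⟩

/-- The vertices of the 4-gonal face among the vertices after cutting. -/
def quad : QuadVertex → CutVertex P
  | .first => Sum.inl ⟨P.v₁, P.typeII₁.1.1⟩
  | .mid δ => Sum.inr δ
  | .last => Sum.inl ⟨P.v₃, P.typeII₂.1.1.symm⟩

end Cut

/-! ### Connected sums -/

section Sum

variable {V : Type u} {K : Set (Finset V)} {τ : Set (ℤ → V)}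
  {V' : Type v} {K' : Set (Finset V')} {τ' : Set (ℤ → V')}
  (P : SpecialPair K τ) (P' : SpecialPair K' τ') (g : SpecialHomeo)

/-- The vertices of the connected sum: both surfaces are cut, and the boundaries of the 4-gonal
faces are glued by `g`. -/
abbrev SumVertex : Type (max u v) :=
  Quot fun a b : CutVertex P ⊕ CutVertex P' =>
    ∃ q, a = Sum.inl (quad P q) ∧ b = Sum.inr (quad P' (g.toEquiv q))

/-- The vertex of the connected sum given by the vertex `x` of the face `F` of `K`. -/
noncomputable def inLeft (F : Finset V) (x : V) : SumVertex P P' g :=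
  Quot.mk _ (Sum.inl (cut P F x))

/-- The vertex of the connected sum given by the vertex `x` of the face `F` of `K'`. -/
noncomputable def inRight (F : Finset V') (x : V') : SumVertex P P' g :=
  Quot.mk _ (Sum.inr (cut P' F x))

/-- The faces of the connected sum are the faces of `K` and of `K'`. -/
def sumFaces : Set (Finset (SumVertex P P' g)) :=
  {F | (∃ A ∈ K, (F : Set (SumVertex P P' g)) = inLeft P P' g A '' (A : Set V)) ∨
    ∃ A ∈ K', (F : Set (SumVertex P P' g)) = inRight P P' g A '' (A : Set V')}

/-- At least one of the pairs has endpoints which are not joined by an edge. -/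
def NoShortcut : Prop := ¬ Adj K P.v₁ P.v₃ ∨ ¬ Adj K' P'.v₁ P'.v₃

/-- `σ` is a z-orientation of the connected sum for which every edge has the same type (and the same
direction, if it is of type II) as in `(K, τ)` or `(K', τ')`. -/
structure IsSumOrientation (σ : Set (ℤ → SumVertex P P' g)) : Prop where
  orientation : IsZOrientation (sumFaces P P' g) σ
  left_I : ∀ A ∈ K, ∀ x ∈ A, ∀ y ∈ A, TypeI K τ x y →
    TypeI (sumFaces P P' g) σ (inLeft P P' g A x) (inLeft P P' g A y)
  left_II : ∀ A ∈ K, ∀ x ∈ A, ∀ y ∈ A, TypeII K τ x y →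
    TypeII (sumFaces P P' g) σ (inLeft P P' g A x) (inLeft P P' g A y)
  right_I : ∀ A ∈ K', ∀ x ∈ A, ∀ y ∈ A, TypeI K' τ' x y →
    TypeI (sumFaces P P' g) σ (inRight P P' g A x) (inRight P P' g A y)
  right_II : ∀ A ∈ K', ∀ x ∈ A, ∀ y ∈ A, TypeII K' τ' x y →
    TypeII (sumFaces P P' g) σ (inRight P P' g A x) (inRight P P' g A y)

/-- If `D` is a set of directed edges of `K`, the corresponding edges of the connected sum (edges of
the special pair have two copies each before gluing, and both are taken). -/
def liftEdges (D : V → V → Prop) (a b : SumVertex P P' g) : Prop :=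
  ∃ A ∈ K, ∃ x ∈ A, ∃ y ∈ A, D x y ∧ a = inLeft P P' g A x ∧ b = inLeft P P' g A y

end Sum

/-- `IteratedSum K τ n L σ D`: the z-oriented complex `(L, σ)` is an iterated connected sum
`(((Γ # Γ₁) # Γ₂) ...) # Γₙ` of `Γ = (K, τ)` with `n` spherical z-homogeneous triangulations
`Γ₁, ..., Γₙ`, where at each step the special pair used on the left consists of edges that come from
edges of `Γ`; `D` is the set of directed edges of type II of `(L, σ)` that come from edges of
`Γ`. -/
inductive IteratedSum {V : Type u} (K : Set (Finset V)) (τ : Set (ℤ → V)) :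
    ℕ → ∀ {W : Type u}, Set (Finset W) → Set (ℤ → W) → (W → W → Prop) → Prop
  | zero : IteratedSum K τ 0 K τ (TypeII K τ)
  | succ {n : ℕ} {W : Type u} {L : Set (Finset W)} {σ : Set (ℤ → W)} {D : W → W → Prop}
      {V' : Type} {K' : Set (Finset V')} {τ' : Set (ℤ → V')}
      (previous : IteratedSum K τ n L σ D)
      (spherical : IsSphericalZHomogeneous K' τ')
      (P : SpecialPair L σ) (P' : SpecialPair K' τ')
      (from₁ : D P.v₁ P.v₂) (from₂ : D P.v₂ P.v₃)
      (g : SpecialHomeo)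
      (noShortcut : NoShortcut P P')
      {ρ : Set (ℤ → SumVertex P P' g)}
      (orientation : IsSumOrientation P P' g ρ) :
      IteratedSum K τ (n + 1) (sumFaces P P' g) ρ (liftEdges P P' g D)

end ZTri

/-!
The theorem is a merging argument: connected sums with bipyramids are used to join zigzags which
meet at a special pair, until a single zigzag is left.

**Flag systems.** In a z-homogeneous triangulation every face has exactly one edge of type II, and
the edges of type II of the faces around the third vertex (the centre) of a face form a directed
cycle. So the triangulation amounts to a set of flags `f`, one for each face, with two
permutations: `rot` turns `f` to the next face around its centre, and the involution `opp` crosses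
the directed edge of `f` (`FlagSystem`, `IsZHomogeneous.flagSystem`). The zigzags of the
z-orientation are the cycles of `zig = opp ∘ rot ∘ rot`; in particular the triangulation is
z-knotted if `zig` has a single cycle (`FlagSystem.isZKnotted`). Conversely, a finite flag system
which is connected, and connected around each vertex, comes from a z-homogeneous closed surface
(`FlagSystem.isClosedSurface`, `FlagSystem.isZHomogeneous`).

**Bipyramids.** Only bipyramids over polygons with `m + 4` vertices are ever glued in. They are
spheres because they arise from the octahedron by subdivisions of edges (`bipyramid_isSpherical`).
The special pair is always the path `src f₀ → tgt f₀ → tgt (rot f₀)` of two consecutive flags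
around a centre. The flags of the connected sum are the flags of both summands, with the same
`rot`, and with `opp` changed at four flags of each summand (`FlagSystem.glueFlags`,
`FlagSystem.glueFlags_isConnected`, `FlagSystem.isSumOrientation`). That the surface does not
change is again seen from subdivisions of edges: the connected sum with a bipyramid is a repeated
edge subdivision (`realization_bipyramidSum`, `FlagSystem.triangulates_glueFaces`).

**Detours.** The zigzags which pass through the special pair visit four marked flags: `f₀`,
`rot f₀`, `opp f₀` and `opp (rot f₀)`, numbered `0, 1, 2, 3`. The order in which they do so is a
permutation `τ` of the marks (`IsReturn`). In the connected sum a zigzag which used to go to the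
mark `i` runs through the bipyramid instead and comes out at the mark `β i`, where `β` is the
shift by `3`, `2`, `1` for polygons with `5`, `6`, `7` vertices. Two successive sums at the same
place give the further permutations `0 ↔ 3, 1 ↔ 2` and `0 → 2 → 1 → 3 → 0`
(`FlagSystem.isDetour_glueTwice_one`, `FlagSystem.isDetour_glueTwice_two`). If `β ∘ τ` is a single
cycle, then all the zigzags through the marks are merged into one, and no zigzag is split. A check
of the `24` permutations `τ` (`exists_detour`) shows that one of the five detours does this,
unless `0` and `3` are already on a common zigzag, and so are `1` and `2`.

**Conclusion.** As long as some pair of consecutive flags of the original triangulation violates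
this crosswise condition, one or two sums enlarge the set of pairs of original flags which are on
a common zigzag (`BipyramidSum.IsCovered.linked_ssubset`), and this set is bounded. Suppose that
the condition holds everywhere. Applied to `rot f`, its first half says that `rot f` and
`opp (rot (rot f)) = zig f` are on one zigzag, so `f` and `rot f` are; the second half then says
the same of `f` and `opp f`. As every flag is reached by `rot` and `opp`, there is only one zigzag
(`BipyramidSum.IsCovered.sameCycle`). It matters here that each special pair consists of copies of
edges of the original triangulation, and that `opp` is only changed at marks, whose zigzags have
been merged.
-/

universe w

namespace ZTri

/-! ### Flag systems -/

/-- The combinatorial content of a z-homogeneous triangulation. A flag is a face with vertices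
`src f`, `tgt f`, `ctr f`, where `src f → tgt f` is its directed edge of type II and `ctr f` is the
third vertex. The permutation `rot` turns a face around its centre to the next one, `opp` exchanges
the two faces at an edge of type II. -/
structure FlagSystem {V : Type u} (K : Set (Finset V)) (X : Type w) where
  src : X → V
  tgt : X → V
  ctr : X → V
  rot : Equiv.Perm X
  opp : X → X
  mem_iff : ∀ F : Finset V, F ∈ K ↔ ∃ f, (F : Set V) = {src f, tgt f, ctr f}
  src_rot : ∀ f, src (rot f) = tgt f
  ctr_rot : ∀ f, ctr (rot f) = ctr f
  src_opp : ∀ f, src (opp f) = src f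
  tgt_opp : ∀ f, tgt (opp f) = tgt f
  opp_opp : ∀ f, opp (opp f) = f
  ctr_opp_ne : ∀ f, ctr (opp f) ≠ ctr f
  ctr_ne_src : ∀ f g, ctr f ≠ src g
  asymm : ∀ f g, src f = tgt g → tgt f ≠ src g
  eq_or_eq_opp : ∀ f g, src g = src f → tgt g = tgt f → g = f ∨ g = opp f
  eq_of_src_ctr : ∀ f g, src g = src f → ctr g = ctr f → g = f
  exists_flag : ∀ x, ∃ f, x = src f ∨ x = ctr f

/-- The connectedness conditions which make a flag system a connected surface without pinched
vertices. -/
structure FlagSystem.IsConnected {V : Type u} {K : Set (Finset V)} {X : Type w}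
    (p : FlagSystem K X) : Prop where
  /-- The flags with a given centre form a single cycle. -/
  ctr_conn : ∀ f g, p.ctr f = p.ctr g → Relation.EqvGen (fun a b => b = p.rot a) f g
  /-- The flags around a vertex which is not a centre form a single cycle. -/
  src_conn : ∀ f g, p.src f = p.src g →
    Relation.EqvGen (fun a b => b = p.opp a ∨ b = p.rot (p.opp (p.rot.symm a))) f g
  /-- The surface is connected. -/
  conn : ∀ f g, Relation.EqvGen (fun a b => b = p.rot a ∨ b = p.opp a) f g

theorem eqvGen_map {A : Type*} {B : Type*} {r : A → A → Prop} {s : B → B → Prop} (j : A → B)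
    (h : ∀ a b, r a b → Relation.EqvGen s (j a) (j b)) {a b : A} (hab : Relation.EqvGen r a b) :
    Relation.EqvGen s (j a) (j b) := by
  induction hab with
  | rel x y hxy => exact h x y hxy
  | refl x => exact .refl _
  | symm x y _ ih => exact .symm _ _ ih
  | trans x y z _ _ ih₁ ih₂ => exact .trans _ _ _ ih₁ ih₂

section Triangle

variable {V : Type u} {K : Set (Finset V)} {a b c : V}

theorem Adj.symm {x y : V} (h : Adj K x y) : Adj K y x :=
  ⟨h.1.symm, h.2.elim fun F hF => ⟨F, hF.1, hF.2.2, hF.2.1⟩⟩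

theorem IsTriangle.rotate (h : IsTriangle K a b c) : IsTriangle K b c a :=
  ⟨h.2.1, h.2.2.1.symm, h.1.symm, h.2.2.2.elim fun F hF => ⟨F, hF.1, hF.2.2.1, hF.2.2.2, hF.2.1⟩⟩

theorem IsTriangle.swap (h : IsTriangle K a b c) : IsTriangle K b a c :=
  ⟨h.1.symm, h.2.2.1, h.2.1, h.2.2.2.elim fun F hF => ⟨F, hF.1, hF.2.2.1, hF.2.1, hF.2.2.2⟩⟩

theorem IsTriangle.adj (h : IsTriangle K a b c) : Adj K a b :=
  ⟨h.1, h.2.2.2.elim fun F hF => ⟨F, hF.1, hF.2.1, hF.2.2.1⟩⟩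

theorem TypeI.symm {τ : Set (ℤ → V)} {x y : V} (h : TypeI K τ x y) : TypeI K τ y x :=
  ⟨h.1.symm, h.2.2, h.2.1⟩

theorem IsZigzag.reverse {Z : ℤ → V} (hZ : IsZigzag K Z) : IsZigzag K (ZTri.reverse Z) := by
  intro i
  have h := hZ (-i - 2)
  have h' := hZ (-i - 3)
  rw [show -i - 2 + 1 = -(i + 1) by ring, show -i - 2 + 2 = -i by ring,
    show -i - 2 = -(i + 2) by ring] at h
  rw [show -i - 3 + 3 = -i by ring, show -i - 3 = -(i + 3) by ring] at h'
  exact ⟨h.1.swap.rotate.rotate, h'.2.symm⟩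

theorem exists_finset_coe {V : Type u} (a b c : V) : ∃ F : Finset V, (F : Set V) = {a, b, c} := by
  classical
  exact ⟨{a, b, c}, by simp⟩

end Triangle

namespace FlagSystem

section Basic

variable {V : Type u} {K : Set (Finset V)} {X : Type w} (p : FlagSystem K X)

/-- The edge directed from `x` to `y` is the directed edge of some flag. -/
def Directed (x y : V) : Prop := ∃ f, p.src f = x ∧ p.tgt f = y

theorem ctr_ne_tgt (f g : X) : p.ctr f ≠ p.tgt g := by
  rw [← p.src_rot]; exact p.ctr_ne_src _ _

theorem src_ne_tgt (f : X) : p.src f ≠ p.tgt f := fun h => p.asymm f f h h.symm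

theorem opp_ne (f : X) : p.opp f ≠ f := fun h => p.ctr_opp_ne f (by rw [h])

theorem eq_of_tgt_ctr (f g : X) (h : p.tgt g = p.tgt f) (hc : p.ctr g = p.ctr f) : g = f := by
  apply p.rot.injective
  apply p.eq_of_src_ctr <;> simp only [p.src_rot, p.ctr_rot, h, hc]

theorem tgt_rot_symm (f : X) : p.tgt (p.rot.symm f) = p.src f := by
  rw [← p.src_rot, Equiv.apply_symm_apply]

theorem ctr_rot_symm (f : X) : p.ctr (p.rot.symm f) = p.ctr f := by
  rw [← p.ctr_rot, Equiv.apply_symm_apply]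

theorem isTriangle (f : X) : IsTriangle K (p.src f) (p.tgt f) (p.ctr f) := by
  obtain ⟨F, hF⟩ := exists_finset_coe (p.src f) (p.tgt f) (p.ctr f)
  have h : ∀ x, x ∈ F ↔ x = p.src f ∨ x = p.tgt f ∨ x = p.ctr f := fun x => by
    rw [← Finset.mem_coe, hF]; rfl
  exact ⟨p.src_ne_tgt f, (p.ctr_ne_tgt f f).symm, (p.ctr_ne_src f f).symm, F,
    (p.mem_iff F).2 ⟨f, hF⟩, (h _).2 (.inl rfl), (h _).2 (.inr (.inl rfl)),
    (h _).2 (.inr (.inr rfl))⟩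

theorem exists_of_isTriangle {a b c : V} (h : IsTriangle K a b c) : ∃ f,
    (a = p.src f ∧ b = p.tgt f ∧ c = p.ctr f) ∨ (a = p.tgt f ∧ b = p.src f ∧ c = p.ctr f) ∨
    (a = p.src f ∧ b = p.ctr f ∧ c = p.tgt f) ∨ (a = p.tgt f ∧ b = p.ctr f ∧ c = p.src f) ∨
    (a = p.ctr f ∧ b = p.src f ∧ c = p.tgt f) ∨ (a = p.ctr f ∧ b = p.tgt f ∧ c = p.src f) := by
  obtain ⟨hab, hbc, hac, F, hF, ha, hb, hc⟩ := h
  obtain ⟨f, hf⟩ := (p.mem_iff F).1 hF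
  have h : ∀ x, x ∈ F → x = p.src f ∨ x = p.tgt f ∨ x = p.ctr f := fun x hx => by
    rw [← Finset.mem_coe, hf] at hx; exact hx
  refine ⟨f, ?_⟩
  rcases h a ha with ha | ha | ha <;> rcases h b hb with hb | hb | hb <;>
    rcases h c hc with hc | hc | hc <;>
    first
      | exact absurd (ha.trans hb.symm) hab
      | exact absurd (hb.trans hc.symm) hbc
      | exact absurd (ha.trans hc.symm) hac
      | simp [ha, hb, hc]

theorem exists_of_adj {a b : V} (h : Adj K a b) : ∃ f,
    (a = p.src f ∧ b = p.tgt f) ∨ (a = p.tgt f ∧ b = p.src f) ∨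
    (a = p.src f ∧ b = p.ctr f) ∨ (a = p.tgt f ∧ b = p.ctr f) ∨
    (a = p.ctr f ∧ b = p.src f) ∨ (a = p.ctr f ∧ b = p.tgt f) := by
  obtain ⟨hab, F, hF, ha, hb⟩ := h
  obtain ⟨f, hf⟩ := (p.mem_iff F).1 hF
  have h : ∀ x, x ∈ F → x = p.src f ∨ x = p.tgt f ∨ x = p.ctr f := fun x hx => by
    rw [← Finset.mem_coe, hf] at hx; exact hx
  refine ⟨f, ?_⟩
  rcases h a ha with ha | ha | ha <;> rcases h b hb with hb | hb | hb <;>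
    first
      | exact absurd (ha.trans hb.symm) hab
      | simp [ha, hb]

/-- A triangle at the edge from the target to the centre of `f` is `f` or the next one. -/
theorem third_of_tgt_ctr (f : X) {z : V} (h : IsTriangle K (p.tgt f) (p.ctr f) z) :
    z = p.src f ∨ z = p.tgt (p.rot f) := by
  obtain ⟨g, hg⟩ := p.exists_of_isTriangle h
  rcases hg with ⟨h1, h2, h3⟩ | ⟨h1, h2, h3⟩ | ⟨h1, h2, h3⟩ | ⟨h1, h2, h3⟩ | ⟨h1, h2, h3⟩ |
    ⟨h1, h2, h3⟩
  · exact absurd h2 (p.ctr_ne_tgt _ _)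
  · exact absurd h2 (p.ctr_ne_src _ _)
  · rw [p.eq_of_src_ctr (p.rot f) g (by rw [p.src_rot, h1]) (by rw [p.ctr_rot, h2])] at h3
    exact .inr h3
  · rw [p.eq_of_tgt_ctr f g h1.symm h2.symm] at h3
    exact .inl h3
  · exact absurd h1.symm (p.ctr_ne_tgt _ _)
  · exact absurd h1.symm (p.ctr_ne_tgt _ _)

theorem third_of_src_ctr (f : X) {z : V} (h : IsTriangle K (p.src f) (p.ctr f) z) :
    z = p.tgt f ∨ z = p.src (p.rot.symm f) := by
  rw [← p.tgt_rot_symm, ← p.ctr_rot_symm] at h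
  rcases p.third_of_tgt_ctr _ h with h | h
  · exact .inr h
  · exact .inl (by rw [h, Equiv.apply_symm_apply])

theorem third_of_src_tgt (f : X) {z : V} (h : IsTriangle K (p.src f) (p.tgt f) z) :
    z = p.ctr f ∨ z = p.ctr (p.opp f) := by
  obtain ⟨g, hg⟩ := p.exists_of_isTriangle h
  rcases hg with ⟨h1, h2, h3⟩ | ⟨h1, h2, h3⟩ | ⟨h1, h2, h3⟩ | ⟨h1, h2, h3⟩ | ⟨h1, h2, h3⟩ |
    ⟨h1, h2, h3⟩
  · rcases p.eq_or_eq_opp f g h1.symm h2.symm with rfl | rfl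
    · exact .inl h3
    · exact .inr h3
  · exact absurd h2 (p.asymm _ _ h1)
  · exact absurd h2.symm (p.ctr_ne_tgt _ _)
  · exact absurd h2.symm (p.ctr_ne_tgt _ _)
  · exact absurd h1.symm (p.ctr_ne_src _ _)
  · exact absurd h1.symm (p.ctr_ne_src _ _)

end Basic

/-! ### Zigzags of a flag system -/

section Zigzag

variable {V : Type u} {K : Set (Finset V)} {X : Type w} (p : FlagSystem K X)

/-- The permutation of flags given by three steps along a zigzag: a zigzag which passes through
the directed edge of `f` and then through the centre of `f` meets the next directed edge
at `rot (rot f)` and enters the face on the other side of it. -/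
def zig : Equiv.Perm X :=
  (p.rot.trans p.rot).trans (Function.Involutive.toPerm p.opp p.opp_opp)

theorem zig_apply (f : X) : p.zig f = p.opp (p.rot (p.rot f)) := rfl

theorem src_zig (f : X) : p.src (p.zig f) = p.tgt (p.rot f) := by
  rw [zig_apply, p.src_opp, p.src_rot]

theorem tgt_zig (f : X) : p.tgt (p.zig f) = p.tgt (p.rot (p.rot f)) := by
  rw [zig_apply, p.tgt_opp]

/-- The zigzag which passes through `src f`, `tgt f`, `ctr f` at the positions `0, 1, 2`. -/
def zigzag (f : X) (i : ℤ) : V :=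
  if i % 3 = 0 then p.src ((p.zig ^ (i / 3)) f)
  else if i % 3 = 1 then p.tgt ((p.zig ^ (i / 3)) f)
  else p.ctr ((p.zig ^ (i / 3)) f)

theorem zigzag_mul (f : X) (k : ℤ) : p.zigzag f (3 * k) = p.src ((p.zig ^ k) f) := by
  have h1 : (3 * k) % 3 = 0 := by omega
  have h2 : (3 * k) / 3 = k := by omega
  simp [zigzag, h1, h2]

theorem zigzag_mul_add_one (f : X) (k : ℤ) :
    p.zigzag f (3 * k + 1) = p.tgt ((p.zig ^ k) f) := by
  have h1 : (3 * k + 1) % 3 = 1 := by omega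
  have h2 : (3 * k + 1) / 3 = k := by omega
  simp [zigzag, h1, h2]

theorem zigzag_mul_add_two (f : X) (k : ℤ) :
    p.zigzag f (3 * k + 2) = p.ctr ((p.zig ^ k) f) := by
  have h1 : (3 * k + 2) % 3 = 2 := by omega
  have h2 : (3 * k + 2) / 3 = k := by omega
  simp [zigzag, h1, h2]

theorem zig_zpow_add_one (f : X) (k : ℤ) : (p.zig ^ (k + 1)) f = p.zig ((p.zig ^ k) f) := by
  rw [add_comm, zpow_add, zpow_one, Equiv.Perm.mul_apply]

theorem zigzag_mul_add_three (f : X) (k : ℤ) :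
    p.zigzag f (3 * k + 3) = p.tgt (p.rot ((p.zig ^ k) f)) := by
  rw [show 3 * k + 3 = 3 * (k + 1) by ring, zigzag_mul, zig_zpow_add_one, src_zig]

theorem zigzag_mul_add_four (f : X) (k : ℤ) :
    p.zigzag f (3 * k + 4) = p.tgt (p.rot (p.rot ((p.zig ^ k) f))) := by
  rw [show 3 * k + 4 = 3 * (k + 1) + 1 by ring, zigzag_mul_add_one, zig_zpow_add_one, tgt_zig]

theorem zigzag_mul_add_five (f : X) (k : ℤ) :
    p.zigzag f (3 * k + 5) = p.ctr (p.opp (p.rot (p.rot ((p.zig ^ k) f)))) := by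
  rw [show 3 * k + 5 = 3 * (k + 1) + 2 by ring, zigzag_mul_add_two, zig_zpow_add_one, zig_apply]

theorem exists_eq_mul (i : ℤ) : ∃ k : ℤ, i = 3 * k ∨ i = 3 * k + 1 ∨ i = 3 * k + 2 :=
  ⟨i / 3, by omega⟩

theorem isZigzag_zigzag (f : X) : IsZigzag K (p.zigzag f) := by
  intro i
  obtain ⟨k, rfl | rfl | rfl⟩ := exists_eq_mul i
  · rw [zigzag_mul, zigzag_mul_add_one, zigzag_mul_add_two, zigzag_mul_add_three]
    generalize (p.zig ^ k) f = g
    refine ⟨p.isTriangle g, ?_⟩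
    intro h
    exact p.asymm g (p.rot g) h.symm (p.src_rot g).symm
  · rw [show 3 * k + 1 + 1 = 3 * k + 2 by ring, show 3 * k + 1 + 2 = 3 * k + 3 by ring,
      show 3 * k + 1 + 3 = 3 * k + 4 by ring, zigzag_mul_add_one, zigzag_mul_add_two,
      zigzag_mul_add_three, zigzag_mul_add_four]
    generalize (p.zig ^ k) f = g
    have h := p.isTriangle (p.rot g)
    rw [p.src_rot, p.ctr_rot] at h
    refine ⟨h.swap.rotate, ?_⟩
    intro h
    exact p.asymm (p.rot g) (p.rot (p.rot g)) (by rw [h, p.src_rot]) (p.src_rot _).symm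
  · rw [show 3 * k + 2 + 1 = 3 * k + 3 by ring, show 3 * k + 2 + 2 = 3 * k + 4 by ring,
      show 3 * k + 2 + 3 = 3 * k + 5 by ring, zigzag_mul_add_two,
      zigzag_mul_add_three, zigzag_mul_add_four, zigzag_mul_add_five]
    generalize (p.zig ^ k) f = g
    have h := p.isTriangle (p.rot (p.rot g))
    rw [p.src_rot, p.ctr_rot, p.ctr_rot] at h
    refine ⟨h.rotate.rotate, ?_⟩
    rw [← p.ctr_rot g, ← p.ctr_rot (p.rot g)]
    exact p.ctr_opp_ne _

theorem zigzag_shift (f : X) (k i : ℤ) :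
    p.zigzag ((p.zig ^ k) f) i = p.zigzag f (i + 3 * k) := by
  obtain ⟨l, rfl | rfl | rfl⟩ := exists_eq_mul i
  · rw [← mul_add, zigzag_mul, zigzag_mul, zpow_add, Equiv.Perm.mul_apply]
  · rw [show 3 * l + 1 + 3 * k = 3 * (l + k) + 1 by ring, zigzag_mul_add_one, zigzag_mul_add_one,
      zpow_add, Equiv.Perm.mul_apply]
  · rw [show 3 * l + 2 + 3 * k = 3 * (l + k) + 2 by ring, zigzag_mul_add_two, zigzag_mul_add_two,
      zpow_add, Equiv.Perm.mul_apply]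

/-- The zigzags of the flag system, up to shifts. -/
def zigzags : Set (ℤ → V) := {Z | ∃ f, SameCyclic (p.zigzag f) Z}

/-- The zigzag passes at the position `i` through the vertices of the flag `f`. -/
def At (Z : ℤ → V) (i : ℤ) (f : X) : Prop :=
  Z i = p.src f ∧ Z (i + 1) = p.tgt f ∧ Z (i + 2) = p.ctr f

variable {p}

theorem At.succ {Z : ℤ → V} {i : ℤ} {f : X} (hZ : IsZigzag K Z) (h : p.At Z i f) :
    p.At Z (i + 3) (p.zig f) := by
  obtain ⟨h0, h1, h2⟩ := h
  have h3 : Z (i + 3) = p.tgt (p.rot f) := by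
    have := (hZ (i + 1)).1
    rw [show i + 1 + 1 = i + 2 by ring, show i + 1 + 2 = i + 3 by ring, h1, h2] at this
    exact (p.third_of_tgt_ctr f this).resolve_left (h0 ▸ (hZ i).2)
  have h4 : Z (i + 4) = p.tgt (p.rot (p.rot f)) := by
    have := (hZ (i + 2)).1
    rw [show i + 2 + 1 = i + 3 by ring, show i + 2 + 2 = i + 4 by ring, h2, h3,
      ← p.ctr_rot] at this
    refine (p.third_of_tgt_ctr (p.rot f) this.swap).resolve_left ?_
    rw [p.src_rot, ← h1]
    have := (hZ (i + 1)).2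
    rwa [show i + 1 + 3 = i + 4 by ring] at this
  have h5 : Z (i + 5) = p.ctr (p.zig f) := by
    have := (hZ (i + 3)).1
    rw [show i + 3 + 1 = i + 4 by ring, show i + 3 + 2 = i + 5 by ring, h3, h4,
      ← p.src_rot] at this
    refine (p.third_of_src_tgt _ this).resolve_left ?_
    rw [p.ctr_rot, p.ctr_rot, ← h2]
    have := (hZ (i + 2)).2
    rwa [show i + 2 + 3 = i + 5 by ring] at this
  refine ⟨by rw [h3, src_zig], ?_, ?_⟩
  · rw [show i + 3 + 1 = i + 4 by ring, h4, tgt_zig]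
  · rw [show i + 3 + 2 = i + 5 by ring, h5]

theorem At.pred {Z : ℤ → V} {i : ℤ} {f : X} (hZ : IsZigzag K Z) (h : p.At Z i f) :
    p.At Z (i - 3) (p.zig.symm f) := by
  obtain ⟨h0, h1, h2⟩ := h
  obtain ⟨g, rfl⟩ := p.zig.surjective f
  rw [Equiv.symm_apply_apply]
  rw [src_zig] at h0
  rw [tgt_zig] at h1
  rw [zig_apply] at h2
  have h3 : Z (i - 1) = p.ctr g := by
    have := (hZ (i - 1)).1
    rw [show i - 1 + 1 = i by ring, show i - 1 + 2 = i + 1 by ring, h0, h1, ← p.src_rot] at this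
    rcases p.third_of_src_tgt _ this.rotate with h | h
    · rw [h, p.ctr_rot, p.ctr_rot]
    · have h' := (hZ (i - 1)).2
      rw [show i - 1 + 3 = i + 2 by ring, h, h2] at h'
      exact absurd rfl h'
  have h4 : Z (i - 2) = p.tgt g := by
    have := (hZ (i - 2)).1
    rw [show i - 2 + 1 = i - 1 by ring, show i - 2 + 2 = i by ring, h0, h3, ← p.ctr_rot,
      ← p.ctr_rot, ← p.src_rot] at this
    rcases p.third_of_src_ctr _ this.rotate.swap with h | h
    · have h' := (hZ (i - 2)).2
      rw [show i - 2 + 3 = i + 1 by ring, h, h1] at h'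
      exact absurd rfl h'
    · rw [h, Equiv.symm_apply_apply, p.src_rot]
  have h5 : Z (i - 3) = p.src g := by
    have := (hZ (i - 3)).1
    rw [show i - 3 + 1 = i - 2 by ring, show i - 3 + 2 = i - 1 by ring, h4, h3, ← p.ctr_rot,
      ← p.src_rot] at this
    rcases p.third_of_src_ctr _ this.rotate with h | h
    · have h' := (hZ (i - 3)).2
      rw [show i - 3 + 3 = i by ring, h, h0] at h'
      exact absurd rfl h'
    · rw [h, Equiv.symm_apply_apply]
  refine ⟨h5, ?_, ?_⟩
  · rw [show i - 3 + 1 = i - 2 by ring, h4]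
  · rw [show i - 3 + 2 = i - 1 by ring, h3]

theorem At.zpow {Z : ℤ → V} {i : ℤ} {f : X} (hZ : IsZigzag K Z) (h : p.At Z i f) (k : ℤ) :
    p.At Z (i + 3 * k) ((p.zig ^ k) f) := by
  induction k with
  | zero => simpa using h
  | succ k ih =>
    have := ih.succ hZ
    rw [← zig_zpow_add_one, add_assoc, ← mul_add_one] at this
    exact this
  | pred k ih =>
    have := ih.pred hZ
    rw [← Equiv.Perm.inv_def, ← Equiv.Perm.mul_apply, ← zpow_neg_one, ← zpow_add] at this
    convert this using 2
    · ring
    · ring_nf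

theorem At.sameCyclic {Z : ℤ → V} {i : ℤ} {f : X} (hZ : IsZigzag K Z) (h : p.At Z i f) :
    SameCyclic (p.zigzag f) Z := by
  refine ⟨-i, fun j => ?_⟩
  obtain ⟨k, hk⟩ := exists_eq_mul (j + -i)
  obtain ⟨h0, h1, h2⟩ := h.zpow hZ k
  rcases hk with hk | hk | hk
  · rw [hk, zigzag_mul, ← h0]; congr 1; omega
  · rw [hk, zigzag_mul_add_one, ← h1]; congr 1; omega
  · rw [hk, zigzag_mul_add_two, ← h2]; congr 1; omega

variable (p)

theorem exists_at_of_directed {Z : ℤ → V} (hZ : IsZigzag K Z) (i : ℤ)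
    (h : p.Directed (Z i) (Z (i + 1))) : ∃ f, p.At Z i f := by
  obtain ⟨f, h0, h1⟩ := h
  have := (hZ i).1
  rw [← h0, ← h1] at this
  rcases p.third_of_src_tgt f this with h2 | h2
  · exact ⟨f, h0.symm, h1.symm, h2⟩
  · exact ⟨p.opp f, by rw [p.src_opp, h0], by rw [p.tgt_opp, h1], h2⟩

/-- Every zigzag or its reverse passes through the vertices of some flag. -/
theorem exists_at {Z : ℤ → V} (hZ : IsZigzag K Z) :
    (∃ i f, p.At Z i f) ∨ ∃ i f, p.At (reverse Z) i f := by
  have hf : ∀ i, p.Directed (Z i) (Z (i + 1)) → (∃ i f, p.At Z i f) ∨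
      ∃ i f, p.At (reverse Z) i f := fun i h =>
    .inl ⟨i, p.exists_at_of_directed hZ i h⟩
  have hr : ∀ i, p.Directed (Z (i + 1)) (Z i) → (∃ i f, p.At Z i f) ∨
      ∃ i f, p.At (reverse Z) i f := fun i h => by
    refine .inr ⟨-(i + 1), p.exists_at_of_directed (hZ.reverse) _ ?_⟩
    have h1 : - -(i + 1) = i + 1 := by ring
    have h2 : - (-(i + 1) + 1) = i := by ring
    simpa only [reverse, h1, h2] using h
  obtain ⟨f, h⟩ := p.exists_of_isTriangle (hZ 0).1
  have h' := (hZ 1).1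
  norm_num at h h'
  have h3 : Z 3 ≠ Z 0 := by simpa using (hZ 0).2
  rcases h with ⟨h0, h1, h2⟩ | ⟨h0, h1, h2⟩ | ⟨h0, h1, h2⟩ | ⟨h0, h1, h2⟩ | ⟨h0, h1, h2⟩ |
    ⟨h0, h1, h2⟩
  · exact hf 0 ⟨f, by simpa using h0.symm, by simpa using h1.symm⟩
  · exact hr 0 ⟨f, by simpa using h1.symm, by simpa using h0.symm⟩
  · refine hf 2 ⟨p.rot f, by rw [p.src_rot, h2], ?_⟩
    rw [h1, h2] at h'
    norm_num
    exact ((p.third_of_tgt_ctr f h'.swap).resolve_left (h0 ▸ h3)).symm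
  · refine hr 2 ⟨p.rot.symm f, ?_, by rw [p.tgt_rot_symm, h2]⟩
    rw [h1, h2] at h'
    norm_num
    exact ((p.third_of_src_ctr f h'.swap).resolve_left (h0 ▸ h3)).symm
  · exact hf 1 ⟨f, by simpa using h1.symm, by simpa using h2.symm⟩
  · exact hr 1 ⟨f, by simpa using h2.symm, by simpa using h1.symm⟩

theorem not_directed_zigzag (f : X) (i : ℤ) :
    ¬ p.Directed (p.zigzag f (i + 1)) (p.zigzag f i) := by
  rintro ⟨g, h1, h2⟩
  obtain ⟨k, rfl | rfl | rfl⟩ := exists_eq_mul i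
  · rw [zigzag_mul_add_one] at h1
    rw [zigzag_mul] at h2
    exact p.asymm _ _ h1 h2
  · rw [show 3 * k + 1 + 1 = 3 * k + 2 by ring, zigzag_mul_add_two] at h1
    exact p.ctr_ne_src _ _ h1.symm
  · rw [zigzag_mul_add_two] at h2
    exact p.ctr_ne_tgt _ _ h2.symm

theorem mem_zigzags_iff {Z : ℤ → V} (hZ : IsZigzag K Z) :
    Z ∈ p.zigzags ↔ ∃ i f, p.At Z i f := by
  constructor
  · rintro ⟨f, k, hk⟩
    refine ⟨-k, f, ?_, ?_, ?_⟩
    · simpa [hk] using p.zigzag_mul f 0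
    · simpa [hk, add_assoc, add_comm] using p.zigzag_mul_add_one f 0
    · simpa [hk, add_assoc, add_comm] using p.zigzag_mul_add_two f 0
  · rintro ⟨i, f, h⟩
    exact ⟨f, h.sameCyclic hZ⟩

theorem isZOrientation : IsZOrientation K p.zigzags where
  isZigzag := by
    rintro Z ⟨f, k, hk⟩ i
    have := p.isZigzag_zigzag f (i + k)
    simp only [hk]
    convert this using 2 <;> congr 1 <;> ring_nf
  shift := by
    rintro Z ⟨f, k, hk⟩ Z' ⟨l, hl⟩
    exact ⟨f, k + l, fun i => by rw [hl, hk]; congr 1; ring⟩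
  orient := by
    intro Z hZ
    rw [xor_iff_or_and_not_and, p.mem_zigzags_iff hZ, p.mem_zigzags_iff (hZ.reverse)]
    refine ⟨p.exists_at hZ, ?_⟩
    rintro ⟨⟨i, f, h⟩, j, g, h0, h1, -⟩
    obtain ⟨k, hk⟩ := h.sameCyclic hZ
    refine p.not_directed_zigzag f (-j - 1 + k) ⟨g, ?_, ?_⟩
    · rw [← h0, reverse, hk]; congr 1; ring
    · rw [← h1, reverse, hk]; congr 1; ring

theorem zigzag_mem (f : X) : p.zigzag f ∈ p.zigzags := ⟨f, 0, fun i => by simp⟩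

theorem passes_src_tgt (f : X) : Passes p.zigzags (p.src f) (p.tgt f) :=
  ⟨_, p.zigzag_mem f, 0, p.zigzag_mul f 0, p.zigzag_mul_add_one f 0⟩

theorem passes_tgt_ctr (f : X) : Passes p.zigzags (p.tgt f) (p.ctr f) :=
  ⟨_, p.zigzag_mem f, 1, p.zigzag_mul_add_one f 0, p.zigzag_mul_add_two f 0⟩

theorem passes_ctr_tgt (f : X) : Passes p.zigzags (p.ctr f) (p.tgt f) := by
  refine ⟨_, p.zigzag_mem (p.rot.symm f), 2, ?_, ?_⟩
  · rw [← p.ctr_rot_symm]; exact p.zigzag_mul_add_two _ 0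
  · rw [show (2 + 1 : ℤ) = 3 * 0 + 3 by norm_num, p.zigzag_mul_add_three]
    simp

theorem passes_src_ctr (f : X) : Passes p.zigzags (p.src f) (p.ctr f) := by
  rw [← p.tgt_rot_symm, ← p.ctr_rot_symm]; exact p.passes_tgt_ctr _

theorem passes_ctr_src (f : X) : Passes p.zigzags (p.ctr f) (p.src f) := by
  rw [← p.tgt_rot_symm, ← p.ctr_rot_symm]; exact p.passes_ctr_tgt _

theorem not_passes (f : X) : ¬ Passes p.zigzags (p.tgt f) (p.src f) := by
  rintro ⟨Z, ⟨g, k, hk⟩, i, h1, h2⟩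
  refine p.not_directed_zigzag g (i + k) ⟨f, ?_, ?_⟩
  · rw [← h2, hk]; congr 1; ring
  · rw [← h1, hk]

theorem adj_src_tgt (f : X) : Adj K (p.src f) (p.tgt f) := (p.isTriangle f).adj

theorem adj_tgt_ctr (f : X) : Adj K (p.tgt f) (p.ctr f) := (p.isTriangle f).rotate.adj

theorem adj_ctr_src (f : X) : Adj K (p.ctr f) (p.src f) := (p.isTriangle f).rotate.rotate.adj

theorem typeII (f : X) : TypeII K p.zigzags (p.src f) (p.tgt f) :=
  ⟨p.adj_src_tgt f, p.passes_src_tgt f, p.not_passes f⟩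

theorem typeI_tgt_ctr (f : X) : TypeI K p.zigzags (p.tgt f) (p.ctr f) :=
  ⟨p.adj_tgt_ctr f, p.passes_tgt_ctr f, p.passes_ctr_tgt f⟩

theorem typeI_ctr_src (f : X) : TypeI K p.zigzags (p.ctr f) (p.src f) :=
  ⟨p.adj_ctr_src f, p.passes_ctr_src f, p.passes_src_ctr f⟩

theorem typeII_iff (x y : V) : TypeII K p.zigzags x y ↔ p.Directed x y := by
  constructor
  · rintro ⟨h1, h2, h3⟩
    obtain ⟨f, h⟩ := p.exists_of_adj h1
    rcases h with ⟨rfl, rfl⟩ | ⟨rfl, rfl⟩ | ⟨rfl, rfl⟩ | ⟨rfl, rfl⟩ | ⟨rfl, rfl⟩ | ⟨rfl, rfl⟩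
    · exact ⟨f, rfl, rfl⟩
    · exact absurd h2 (p.not_passes f)
    · exact absurd (p.passes_ctr_src f) h3
    · exact absurd (p.passes_ctr_tgt f) h3
    · exact absurd (p.passes_src_ctr f) h3
    · exact absurd (p.passes_tgt_ctr f) h3
  · rintro ⟨f, rfl, rfl⟩
    exact p.typeII f

theorem isHomogeneous {Z : ℤ → V} (hZ : Z ∈ p.zigzags) : IsHomogeneous K p.zigzags Z := by
  obtain ⟨f, k, hk⟩ := hZ
  refine ⟨-k, fun l => ?_⟩
  simp only [hk]
  rw [show -k + 3 * l + k = 3 * l by ring, show -k + 3 * l + 1 + k = 3 * l + 1 by ring,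
    show -k + 3 * l + 2 + k = 3 * l + 2 by ring, show -k + 3 * l + 3 + k = 3 * (l + 1) by ring,
    zigzag_mul, zigzag_mul_add_one, zigzag_mul_add_two, zigzag_mul, zig_zpow_add_one, src_zig]
  generalize (p.zig ^ l) f = g
  refine ⟨p.typeII g, p.typeI_tgt_ctr g, ?_⟩
  rw [← p.ctr_rot]
  exact TypeI.symm (p.typeI_tgt_ctr _)

/-- If three steps along zigzags move every flag to every other one, then there is only one
zigzag. -/
theorem isZKnotted [Nonempty X] (h : ∀ f g, p.zig.SameCycle f g) : IsZKnotted K := by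
  obtain ⟨f⟩ := ‹Nonempty X›
  refine ⟨p.zigzag f, p.isZigzag_zigzag f, fun Z hZ => ?_⟩
  have key : ∀ Z', IsZigzag K Z' → (∃ i g, p.At Z' i g) → SameCyclic (p.zigzag f) Z' := by
    rintro Z' hZ' ⟨i, g, hg⟩
    obtain ⟨k, hk⟩ := hg.sameCyclic hZ'
    obtain ⟨m, rfl⟩ := h f g
    exact ⟨k + 3 * m, fun j => by rw [hk, zigzag_shift, add_assoc]⟩
  rcases p.exists_at hZ with h | h
  · exact .inl (key Z hZ h)
  · obtain ⟨k, hk⟩ := key _ (hZ.reverse) h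
    refine .inr ⟨-k, fun i => ?_⟩
    have := hk (-i)
    simp only [reverse, neg_neg] at this ⊢
    rw [this]; congr 1; ring

end Zigzag

end FlagSystem

namespace FlagSystem

/-! ### A flag system gives a closed surface -/

section Surface

variable {V : Type u} {K : Set (Finset V)} {X : Type w} (p : FlagSystem K X)

theorem exists_face_coe (f : X) : ∃ F ∈ K, (F : Set V) = {p.src f, p.tgt f, p.ctr f} := by
  obtain ⟨F, hF⟩ := exists_finset_coe (p.src f) (p.tgt f) (p.ctr f)
  exact ⟨F, (p.mem_iff F).2 ⟨f, hF⟩, hF⟩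

/-- The face of a flag. -/
noncomputable def face (f : X) : Finset V := (p.exists_face_coe f).choose

theorem face_mem (f : X) : p.face f ∈ K := (p.exists_face_coe f).choose_spec.1

theorem coe_face (f : X) : (p.face f : Set V) = {p.src f, p.tgt f, p.ctr f} :=
  (p.exists_face_coe f).choose_spec.2

theorem mem_face {f : X} {x : V} : x ∈ p.face f ↔ x = p.src f ∨ x = p.tgt f ∨ x = p.ctr f := by
  rw [← Finset.mem_coe, coe_face]; rfl

theorem src_mem_face (f : X) : p.src f ∈ p.face f := p.mem_face.2 (.inl rfl)

theorem tgt_mem_face (f : X) : p.tgt f ∈ p.face f := p.mem_face.2 (.inr (.inl rfl))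

theorem ctr_mem_face (f : X) : p.ctr f ∈ p.face f := p.mem_face.2 (.inr (.inr rfl))

theorem exists_face_eq {F : Finset V} (hF : F ∈ K) : ∃ f, F = p.face f := by
  obtain ⟨f, hf⟩ := (p.mem_iff F).1 hF
  exact ⟨f, Finset.coe_injective (by rw [hf, coe_face])⟩

theorem ctr_eq_of_mem_face {f g : X} (h : p.ctr g ∈ p.face f) : p.ctr g = p.ctr f := by
  rcases p.mem_face.1 h with h | h | h
  · exact absurd h (p.ctr_ne_src _ _)
  · exact absurd h (p.ctr_ne_tgt _ _)
  · exact h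

theorem src_mem_face_iff {f g : X} :
    p.src g ∈ p.face f ↔ p.src g = p.src f ∨ p.src g = p.tgt f := by
  rw [mem_face]
  have := (p.ctr_ne_src f g).symm
  tauto

theorem tgt_mem_face_iff {f g : X} :
    p.tgt g ∈ p.face f ↔ p.tgt g = p.src f ∨ p.tgt g = p.tgt f := by
  rw [← p.src_rot, src_mem_face_iff]

theorem face_injective : Function.Injective p.face := by
  intro f g h
  have hc : p.ctr f = p.ctr g := p.ctr_eq_of_mem_face (h ▸ p.ctr_mem_face f)
  rcases p.src_mem_face_iff.1 (h ▸ p.src_mem_face f) with hs | hs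
  · exact p.eq_of_src_ctr _ _ hs hc
  · rcases p.tgt_mem_face_iff.1 (h ▸ p.tgt_mem_face f) with ht | ht
    · exact absurd ht (p.asymm _ _ hs)
    · exact p.eq_of_tgt_ctr _ _ ht hc

/-- The faces which contain a directed edge. -/
theorem eq_of_src_tgt_mem {f : X} {F : Finset V} (hF : F ∈ K) (hs : p.src f ∈ F)
    (ht : p.tgt f ∈ F) : F = p.face f ∨ F = p.face (p.opp f) := by
  obtain ⟨g, rfl⟩ := p.exists_face_eq hF
  have : g = f ∨ g = p.opp f := by
    rcases p.src_mem_face_iff.1 hs with hs | hs <;> rcases p.tgt_mem_face_iff.1 ht with ht | ht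
    · exact absurd (hs.trans ht.symm) (p.src_ne_tgt f)
    · exact p.eq_or_eq_opp f g hs.symm ht.symm
    · exact absurd ht (p.asymm _ _ hs)
    · exact absurd (hs.trans ht.symm) (p.src_ne_tgt f)
  exact this.imp (congrArg _) (congrArg _)

/-- The faces which contain the edge from the target to the centre of a flag. -/
theorem eq_of_tgt_ctr_mem {f : X} {F : Finset V} (hF : F ∈ K) (ht : p.tgt f ∈ F)
    (hc : p.ctr f ∈ F) : F = p.face f ∨ F = p.face (p.rot f) := by
  obtain ⟨g, rfl⟩ := p.exists_face_eq hF
  have hc := p.ctr_eq_of_mem_face hc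
  rcases p.tgt_mem_face_iff.1 ht with ht | ht
  · exact .inr (congrArg _ (p.eq_of_src_ctr _ _ (by rw [p.src_rot, ht]) (by rw [p.ctr_rot, hc])))
  · exact .inl (congrArg _ (p.eq_of_tgt_ctr _ _ ht.symm hc.symm))

theorem rot_ne (f : X) : p.rot f ≠ f := fun h => p.src_ne_tgt f (by rw [← p.src_rot, h])

theorem two_faces (p : FlagSystem K X) {x y : V} (h : Adj K x y) :
    {F | F ∈ K ∧ x ∈ F ∧ y ∈ F}.ncard = 2 := by
  have h1 : ∀ f, {F | F ∈ K ∧ p.src f ∈ F ∧ p.tgt f ∈ F}.ncard = 2 := fun f => by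
    have : {F | F ∈ K ∧ p.src f ∈ F ∧ p.tgt f ∈ F} = {p.face f, p.face (p.opp f)} := by
      ext F
      constructor
      · rintro ⟨hF, hs, ht⟩
        exact p.eq_of_src_tgt_mem hF hs ht
      · rintro (rfl | rfl)
        · exact ⟨p.face_mem _, p.src_mem_face _, p.tgt_mem_face _⟩
        · refine ⟨p.face_mem _, ?_, ?_⟩
          · rw [← p.src_opp]; exact p.src_mem_face _
          · rw [← p.tgt_opp]; exact p.tgt_mem_face _
    rw [this, Set.ncard_pair fun h => p.opp_ne f (p.face_injective h).symm]
  have h2 : ∀ f, {F | F ∈ K ∧ p.tgt f ∈ F ∧ p.ctr f ∈ F}.ncard = 2 := fun f => by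
    have : {F | F ∈ K ∧ p.tgt f ∈ F ∧ p.ctr f ∈ F} = {p.face f, p.face (p.rot f)} := by
      ext F
      constructor
      · rintro ⟨hF, hs, ht⟩
        exact p.eq_of_tgt_ctr_mem hF hs ht
      · rintro (rfl | rfl)
        · exact ⟨p.face_mem _, p.tgt_mem_face _, p.ctr_mem_face _⟩
        · refine ⟨p.face_mem _, ?_, ?_⟩
          · rw [← p.src_rot]; exact p.src_mem_face _
          · rw [← p.ctr_rot]; exact p.ctr_mem_face _
    rw [this, Set.ncard_pair fun h => p.rot_ne f (p.face_injective h).symm]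
  have h3 : ∀ f, {F | F ∈ K ∧ p.src f ∈ F ∧ p.ctr f ∈ F}.ncard = 2 := fun f => by
    rw [← p.tgt_rot_symm, ← p.ctr_rot_symm]; exact h2 _
  have hc : ∀ a b : V, {F | F ∈ K ∧ a ∈ F ∧ b ∈ F} = {F | F ∈ K ∧ b ∈ F ∧ a ∈ F} := fun a b => by
    ext F; simp only [Set.mem_ofPred_eq]; tauto
  obtain ⟨f, h⟩ := p.exists_of_adj h
  rcases h with ⟨rfl, rfl⟩ | ⟨rfl, rfl⟩ | ⟨rfl, rfl⟩ | ⟨rfl, rfl⟩ | ⟨rfl, rfl⟩ | ⟨rfl, rfl⟩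
  · exact h1 f
  · rw [hc]; exact h1 f
  · exact h3 f
  · exact h2 f
  · rw [hc]; exact h3 f
  · rw [hc]; exact h2 f

theorem eqvGen_le {A : Type*} {r E : A → A → Prop} (hE : Equivalence E) (h : ∀ a b, r a b → E a b)
    {a b : A} (hab : Relation.EqvGen r a b) : E a b := by
  induction hab with
  | rel a b hab => exact h a b hab
  | refl a => exact hE.refl a
  | symm a b _ ih => exact hE.symm ih
  | trans a b c _ _ ih₁ ih₂ => exact hE.trans ih₁ ih₂

theorem link_connected_of_eqvGen {x y₀ : V} (h₀ : Adj K x y₀)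
    (h : ∀ y z, Adj K x y → Adj K x z → Relation.EqvGen (fun y z => IsTriangle K x y z) y z) :
    (link K x).Connected := by
  have : Nonempty {y : V // Adj K x y} := ⟨⟨_, h₀⟩⟩
  refine ⟨fun y z => ?_⟩
  let E : V → V → Prop := fun y z => (Adj K x y ↔ Adj K x z) ∧
    ∀ (hy : Adj K x y) (hz : Adj K x z), (link K x).Reachable ⟨y, hy⟩ ⟨z, hz⟩
  have hE : Equivalence E :=
    ⟨fun y => ⟨Iff.rfl, fun _ _ => SimpleGraph.Reachable.rfl⟩,
      fun h => ⟨h.1.symm, fun hy hz => (h.2 hz hy).symm⟩,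
      fun h h' => ⟨h.1.trans h'.1, fun hy hz => (h.2 hy (h.1.1 hy)).trans (h'.2 _ hz)⟩⟩
  refine (eqvGen_le hE (fun a b hab => ⟨⟨fun _ => ?_, fun _ => ?_⟩, fun ha hb => ?_⟩)
    (h y.1 z.1 y.2 z.2)).2 y.2 z.2
  · exact hab.rotate.rotate.swap.adj
  · exact hab.adj
  · exact SimpleGraph.Adj.reachable hab

theorem link_ctr_connected (hp : p.IsConnected) (f : X) : (link K (p.ctr f)).Connected := by
  refine link_connected_of_eqvGen (p.adj_ctr_src f) fun y z hy hz => ?_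
  have hex : ∀ y, Adj K (p.ctr f) y → ∃ g, p.ctr g = p.ctr f ∧ y = p.src g := by
    intro y hy
    obtain ⟨g, h⟩ := p.exists_of_adj hy
    rcases h with ⟨h, h'⟩ | ⟨h, h'⟩ | ⟨h, h'⟩ | ⟨h, h'⟩ | ⟨h, h'⟩ | ⟨h, h'⟩
    · exact absurd h (p.ctr_ne_src _ _)
    · exact absurd h (p.ctr_ne_tgt _ _)
    · exact absurd h (p.ctr_ne_src _ _)
    · exact absurd h (p.ctr_ne_tgt _ _)
    · exact ⟨g, h.symm, h'⟩
    · exact ⟨p.rot g, by rw [p.ctr_rot, h], by rw [p.src_rot, ← h']⟩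
  obtain ⟨g, hg, rfl⟩ := hex y hy
  obtain ⟨h, hh, rfl⟩ := hex z hz
  let E : X → X → Prop := fun a b => p.ctr a = p.ctr b ∧
    Relation.EqvGen (fun y z => IsTriangle K (p.ctr a) y z) (p.src a) (p.src b)
  have hE : Equivalence E :=
    ⟨fun a => ⟨rfl, .refl _⟩, fun h => ⟨h.1.symm, h.1 ▸ h.2.symm⟩,
      fun h h' => ⟨h.1.trans h'.1, .trans _ _ _ h.2 (h.1 ▸ h'.2)⟩⟩
  have := eqvGen_le hE (fun a b hab => ?_) (hp.ctr_conn g h (hg.trans hh.symm))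
  · rw [← hg]; exact this.2
  · subst hab
    refine ⟨(p.ctr_rot a).symm, .rel _ _ ?_⟩
    rw [p.src_rot]
    exact (p.isTriangle a).rotate.rotate

theorem link_src_connected (hp : p.IsConnected) (f : X) : (link K (p.src f)).Connected := by
  refine link_connected_of_eqvGen (p.adj_src_tgt f) fun y z hy hz => ?_
  have hr : ∀ a, IsTriangle K (p.src a) (p.ctr a) (p.src (p.rot.symm a)) := fun a => by
    rw [← p.tgt_rot_symm, ← p.ctr_rot_symm]
    exact (p.isTriangle _).rotate
  have hex : ∀ y, Adj K (p.src f) y → ∃ g, p.src g = p.src f ∧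
      Relation.EqvGen (fun y z => IsTriangle K (p.src f) y z) (p.tgt g) y := by
    intro y hy
    obtain ⟨g, h⟩ := p.exists_of_adj hy
    rcases h with ⟨h, h'⟩ | ⟨h, h'⟩ | ⟨h, h'⟩ | ⟨h, h'⟩ | ⟨h, h'⟩ | ⟨h, h'⟩
    · exact ⟨g, h.symm, h' ▸ .refl _⟩
    · refine ⟨p.rot g, by rw [p.src_rot, h], .trans _ (p.ctr (p.rot g)) _ (.rel _ _ ?_)
        (.rel _ _ ?_)⟩
      · rw [h, ← p.src_rot]; exact p.isTriangle _
      · have := hr (p.rot g)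
        rwa [p.src_rot, Equiv.symm_apply_apply, ← h, ← h'] at this
    · refine ⟨g, h.symm, .rel _ _ ?_⟩
      rw [h, h']; exact p.isTriangle g
    · refine ⟨p.rot g, by rw [p.src_rot, h], .rel _ _ ?_⟩
      rw [h, ← p.src_rot, h', ← p.ctr_rot]; exact p.isTriangle _
    · exact absurd h.symm (p.ctr_ne_src _ _)
    · exact absurd h.symm (p.ctr_ne_src _ _)
  obtain ⟨g, hg, hgy⟩ := hex y hy
  obtain ⟨h, hh, hhz⟩ := hex z hz
  let E : X → X → Prop := fun a b => p.src a = p.src b ∧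
    Relation.EqvGen (fun y z => IsTriangle K (p.src a) y z) (p.tgt a) (p.tgt b)
  have hE : Equivalence E :=
    ⟨fun a => ⟨rfl, .refl _⟩, fun h => ⟨h.1.symm, h.1 ▸ h.2.symm⟩,
      fun h h' => ⟨h.1.trans h'.1, .trans _ _ _ h.2 (h.1 ▸ h'.2)⟩⟩
  have := eqvGen_le hE (fun a b hab => ?_) (hp.src_conn g h (hg.trans hh.symm))
  · refine .trans _ _ _ hgy.symm (.trans _ _ _ ?_ hhz)
    rw [← hg]; exact this.2
  · rcases hab with rfl | rfl
    · exact ⟨(p.src_opp a).symm, by rw [p.tgt_opp]; exact .refl _⟩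
    · have hs : p.src a = p.src (p.rot (p.opp (p.rot.symm a))) := by
        rw [p.src_rot, p.tgt_opp, p.tgt_rot_symm]
      have key : ∀ b, Relation.EqvGen (fun y z => IsTriangle K (p.src b) y z) (p.tgt b)
          (p.src (p.rot.symm b)) := fun b =>
        .trans _ _ _ (.rel _ _ (p.isTriangle b)) (.rel _ _ (hr b))
      refine ⟨hs, (key a).trans _ _ _ (.symm _ _ ?_)⟩
      have := key (p.rot (p.opp (p.rot.symm a)))
      rwa [← hs, Equiv.symm_apply_apply, p.src_opp] at this

theorem finite_vertices (p : FlagSystem K X) [Finite X] : Finite V := by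
  refine Finite.of_surjective (Sum.elim p.src p.ctr) fun x => ?_
  obtain ⟨f, rfl | rfl⟩ := p.exists_flag x
  · exact ⟨.inl f, rfl⟩
  · exact ⟨.inr f, rfl⟩

theorem reachable_of_mem_face {f : X} {x y : V} (hx : x ∈ p.face f) (hy : y ∈ p.face f) :
    (graph K).Reachable x y := by
  by_cases h : x = y
  · rw [h]
  · exact SimpleGraph.Adj.reachable ⟨h, _, p.face_mem f, hx, hy⟩

theorem graph_connected {p : FlagSystem K X} (hp : p.IsConnected) [Nonempty X] :
    (graph K).Connected := by
  have hex : ∀ x, ∃ f, x ∈ p.face f := fun x => by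
    obtain ⟨f, rfl | rfl⟩ := p.exists_flag x
    exacts [⟨f, p.src_mem_face f⟩, ⟨f, p.ctr_mem_face f⟩]
  have : Nonempty V := ‹Nonempty X›.map p.src
  refine ⟨fun x y => ?_⟩
  obtain ⟨f, hf⟩ := hex x
  obtain ⟨g, hg⟩ := hex y
  let E : X → X → Prop := fun a b => (graph K).Reachable (p.tgt a) (p.tgt b)
  have hE : Equivalence E := ⟨fun _ => SimpleGraph.Reachable.rfl, fun h => h.symm,
    fun h h' => h.trans h'⟩
  have := eqvGen_le hE (fun a b hab => ?_) (hp.conn f g)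
  · exact (p.reachable_of_mem_face hf (p.tgt_mem_face f)).trans
      (this.trans (p.reachable_of_mem_face (p.tgt_mem_face g) hg))
  · rcases hab with rfl | rfl
    · refine p.reachable_of_mem_face (f := p.rot a) ?_ (p.tgt_mem_face _)
      rw [← p.src_rot]; exact p.src_mem_face _
    · change (graph K).Reachable _ _
      rw [p.tgt_opp]

theorem isClosedSurface {p : FlagSystem K X} (hp : p.IsConnected) [Finite X] [Nonempty X] :
    IsClosedSurface K where
  finite := p.finite_vertices
  card_eq F hF := by
    classical
    obtain ⟨f, hf⟩ := (p.mem_iff F).1 hF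
    rw [← Set.ncard_coe_finset, hf, Set.ncard_eq_three]
    exact ⟨_, _, _, p.src_ne_tgt f, (p.ctr_ne_src f f).symm, (p.ctr_ne_tgt f f).symm, rfl⟩
  exists_face x := by
    obtain ⟨f, rfl | rfl⟩ := p.exists_flag x
    · exact ⟨_, p.face_mem f, p.src_mem_face f⟩
    · exact ⟨_, p.face_mem f, p.ctr_mem_face f⟩
  two_faces _ _ := p.two_faces
  link_connected x := by
    obtain ⟨f, rfl | rfl⟩ := p.exists_flag x
    · exact p.link_src_connected hp f
    · exact p.link_ctr_connected hp f
  connected := graph_connected hp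

theorem isZHomogeneous {p : FlagSystem K X} (hp : p.IsConnected) [Finite X] [Nonempty X] :
    IsZHomogeneous K p.zigzags :=
  ⟨isClosedSurface hp, p.isZOrientation, fun _ => p.isHomogeneous⟩

end Surface

end FlagSystem

/-! ### Zigzags on a closed surface -/

section Surface

variable {V : Type u} {K : Set (Finset V)} (hK : IsClosedSurface K)

include hK

theorem IsClosedSurface.coe_eq {F : Finset V} (hF : F ∈ K) {a b c : V} (hab : a ≠ b) (hbc : b ≠ c)
    (hac : a ≠ c) (ha : a ∈ F) (hb : b ∈ F) (hc : c ∈ F) : (F : Set V) = {a, b, c} := by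
  classical
  have h : ({a, b, c} : Finset V) = F := by
    apply Finset.eq_of_subset_of_card_le
    · intro x hx
      simp only [Finset.mem_insert, Finset.mem_singleton] at hx
      rcases hx with rfl | rfl | rfl <;> assumption
    · rw [hK.card_eq F hF, Finset.card_eq_three.2 ⟨a, b, c, hab, hac, hbc, rfl⟩]
  rw [← h]; simp

/-- The edge `ab` is in precisely two triangles. -/
theorem IsClosedSurface.exists_third {a b c : V} (h : IsTriangle K a b c) :
    ∃ d, IsTriangle K a b d ∧ d ≠ c ∧ ∀ e, IsTriangle K a b e → e = c ∨ e = d := by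
  classical
  obtain ⟨hab, hbc, hac, F, hF, ha, hb, hc⟩ := h
  obtain ⟨F₁, F₂, hne, hs⟩ := Set.ncard_eq_two.1 (hK.two_faces a b ⟨hab, F, hF, ha, hb⟩)
  have hm : ∀ G, (G ∈ K ∧ a ∈ G ∧ b ∈ G) ↔ G = F₁ ∨ G = F₂ := fun G => by
    have : G ∈ {F | F ∈ K ∧ a ∈ F ∧ b ∈ F} ↔ G ∈ ({F₁, F₂} : Set (Finset V)) := by rw [hs]
    simpa only [Set.mem_ofPred_eq, Set.mem_insert_iff, Set.mem_singleton_iff] using this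
  obtain ⟨G, hGF, hG⟩ : ∃ G, G ≠ F ∧ ∀ H, (H ∈ K ∧ a ∈ H ∧ b ∈ H) ↔ H = F ∨ H = G := by
    rcases (hm F).1 ⟨hF, ha, hb⟩ with rfl | rfl
    · exact ⟨F₂, hne.symm, hm⟩
    · exact ⟨F₁, hne, fun H => by rw [hm, or_comm]⟩
  obtain ⟨hGK, haG, hbG⟩ := (hG G).2 (.inr rfl)
  have hcard : 2 < G.card := by rw [hK.card_eq G hGK]; norm_num
  obtain ⟨d, hd, hdn⟩ : ∃ d ∈ G, d ∉ ({a, b} : Finset V) :=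
    Finset.exists_mem_notMem_of_card_lt_card (lt_of_le_of_lt Finset.card_le_two hcard)
  simp only [Finset.mem_insert, Finset.mem_singleton, not_or] at hdn
  have hFc := hK.coe_eq hF hab hbc hac ha hb hc
  have hGc := hK.coe_eq hGK hab (Ne.symm hdn.2) (Ne.symm hdn.1) haG hbG hd
  refine ⟨d, ⟨hab, Ne.symm hdn.2, Ne.symm hdn.1, G, hGK, haG, hbG, hd⟩, ?_, ?_⟩
  · rintro rfl
    exact hGF (Finset.coe_injective (hGc.trans hFc.symm))
  · rintro e ⟨-, hbe, hae, H, hH, haH, hbH, heH⟩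
    rcases (hG H).1 ⟨hH, haH, hbH⟩ with rfl | rfl
    · have : e ∈ (H : Set V) := heH
      rw [hFc] at this
      rcases this with h | h | h
      exacts [absurd h.symm hae, absurd h.symm hbe, .inl h]
    · have : e ∈ (H : Set V) := heH
      rw [hGc] at this
      rcases this with h | h | h
      exacts [absurd h.symm hae, absurd h.symm hbe, .inr h]

theorem IsClosedSurface.third_unique {a b c d e : V} (hc : IsTriangle K a b c)
    (hd : IsTriangle K a b d) (hcd : c ≠ d) (he : IsTriangle K a b e) : e = c ∨ e = d := by
  obtain ⟨d', -, -, h'⟩ := hK.exists_third hc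
  rw [(h' d hd).resolve_left hcd.symm]
  exact h' e he

theorem IsClosedSurface.exists_isTriangle_of_mem {F : Finset V} (hF : F ∈ K) {x : V} (hx : x ∈ F) :
    ∃ y ∈ F, ∃ z ∈ F, IsTriangle K x y z := by
  classical
  have hc : (F.erase x).card = 2 := by rw [Finset.card_erase_of_mem hx, hK.card_eq F hF]
  obtain ⟨y, z, hyz, h⟩ := Finset.card_eq_two.1 hc
  have hy : y ∈ F.erase x := by rw [h]; simp
  have hz : z ∈ F.erase x := by rw [h]; simp
  rw [Finset.mem_erase] at hy hz
  exact ⟨y, hy.2, z, hz.2, hy.1.symm, hyz, hz.1.symm, F, hF, hx, hy.2, hz.2⟩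

theorem IsClosedSurface.exists_isTriangle_of_adj {x y : V} (h : Adj K x y) :
    ∃ z, IsTriangle K x y z := by
  obtain ⟨hxy, F, hF, hx, hy⟩ := h
  obtain ⟨a, ha, b, hb, ht⟩ := hK.exists_isTriangle_of_mem hF hx
  by_cases hya : y = a
  · exact ⟨b, hya ▸ ht⟩
  · exact ⟨a, hxy, hya, ht.1, F, hF, hx, hy, ha⟩

theorem IsClosedSurface.exists_zigzag {a b c : V} (h : IsTriangle K a b c) :
    ∃ Z, IsZigzag K Z ∧ Z 0 = a ∧ Z 1 = b ∧ Z 2 = c := by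
  have := hK.finite
  let T := {t : V × V × V // IsTriangle K t.1 t.2.1 t.2.2}
  have hex : ∀ t : T, ∃ d, IsTriangle K t.1.2.1 t.1.2.2 d ∧ d ≠ t.1.1 := fun t => by
    obtain ⟨d, h, hne, -⟩ := hK.exists_third t.2.rotate
    exact ⟨d, h, hne⟩
  choose d hd hne using hex
  let nx : T → T := fun t => ⟨(t.1.2.1, t.1.2.2, d t), hd t⟩
  have hinj : Function.Injective nx := by
    rintro s t hst
    have h1 : s.1.2.1 = t.1.2.1 := congrArg (fun x : T => x.1.1) hst
    have h2 : s.1.2.2 = t.1.2.2 := congrArg (fun x : T => x.1.2.1) hst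
    have h3 : d s = d t := congrArg (fun x : T => x.1.2.2) hst
    have h4 : s.1.1 = t.1.1 := by
      have ht := t.2.rotate
      rw [← h1, ← h2] at ht
      refine ((hK.third_unique (hd s) s.2.rotate (hne s) ht).resolve_left ?_).symm
      rw [h3]; exact (hne t).symm
    exact Subtype.ext (Prod.ext h4 (Prod.ext h1 h2))
  let σ : Equiv.Perm T := Equiv.ofBijective nx (Finite.injective_iff_bijective.1 hinj)
  have hσ : ∀ k : ℤ, ∀ t, (σ ^ (k + 1)) t = nx ((σ ^ k) t) := fun k t => by
    rw [add_comm, zpow_add, zpow_one, Equiv.Perm.mul_apply]; rfl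
  let t₀ : T := ⟨(a, b, c), h⟩
  have h1 : ∀ i : ℤ, ((σ ^ (i + 1)) t₀).1.1 = ((σ ^ i) t₀).1.2.1 := fun i => by rw [hσ]
  have h2 : ∀ i : ℤ, ((σ ^ (i + 1)) t₀).1.2.1 = ((σ ^ i) t₀).1.2.2 := fun i => by rw [hσ]
  have h3 : ∀ i : ℤ, ((σ ^ (i + 1)) t₀).1.2.2 = d ((σ ^ i) t₀) := fun i => by rw [hσ]
  refine ⟨fun i => ((σ ^ i) t₀).1.1, fun i => ⟨?_, ?_⟩, rfl, ?_, ?_⟩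
  · beta_reduce
    rw [show i + 2 = i + 1 + 1 by ring, h1 (i + 1), h1 i, h2 i]
    exact ((σ ^ i) t₀).2
  · beta_reduce
    rw [show i + 3 = i + 1 + 1 + 1 by ring, h1, h2, h3]
    exact hne _
  · exact h1 0
  · exact (h1 1).trans (h2 0)

/-- A zigzag is determined by three consecutive vertices. -/
theorem IsClosedSurface.zigzag_ext {Z Z' : ℤ → V} (hZ : IsZigzag K Z) (hZ' : IsZigzag K Z')
    (i j : ℤ) (h0 : Z i = Z' j) (h1 : Z (i + 1) = Z' (j + 1)) (h2 : Z (i + 2) = Z' (j + 2)) :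
    SameCyclic Z Z' := by
  have key : ∀ k : ℤ, Z (i + k) = Z' (j + k) ∧ Z (i + k + 1) = Z' (j + k + 1) ∧
      Z (i + k + 2) = Z' (j + k + 2) := by
    intro k
    induction k with
    | zero => simp [h0, h1, h2]
    | succ k ih =>
      obtain ⟨h0, h1, h2⟩ := ih
      simp only [← add_assoc] at *
      generalize i + (k : ℤ) = i at *
      generalize j + (k : ℤ) = j at *
      have e : ∀ i : ℤ, i + 1 + 1 = i + 2 := fun i => by ring
      have e' : ∀ i : ℤ, i + 1 + 2 = i + 3 := fun i => by ring
      have a := (hZ i).1.rotate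
      have b := (hZ (i + 1)).1
      have c := (hZ' (j + 1)).1
      simp only [e, e'] at a b c ⊢
      rw [← h1, ← h2] at c
      refine ⟨h1, h2, ((hK.third_unique a b (hZ i).2.symm c).resolve_left ?_).symm⟩
      rw [h0]; exact (hZ' j).2
    | pred k ih =>
      obtain ⟨h0, h1, h2⟩ := ih
      simp only [← add_sub_assoc] at *
      generalize i + -(k : ℤ) = i at *
      generalize j + -(k : ℤ) = j at *
      have e : ∀ i : ℤ, i - 1 + 2 = i + 1 := fun i => by ring
      have e' : ∀ i : ℤ, i - 1 + 3 = i + 2 := fun i => by ring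
      have a := (hZ i).1
      have b := (hZ (i - 1)).1.rotate
      have c := (hZ' (j - 1)).1.rotate
      have d := (hZ (i - 1)).2
      have d' := (hZ' (j - 1)).2
      simp only [e, e', sub_add_cancel] at *
      rw [← h0, ← h1] at c
      refine ⟨((hK.third_unique a b d c).resolve_left ?_).symm, h0, h1⟩
      rw [h2]; exact d'.symm
  refine ⟨i - j, fun k => ?_⟩
  have := (key (k - j)).1
  rw [show j + (k - j) = k by ring] at this
  rw [← this]; congr 1; ring

end Surface

/-! ### The flag system of a z-homogeneous triangulation -/

section Homogeneous

variable {V : Type u} {K : Set (Finset V)} {τ : Set (ℤ → V)}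

/-- The edge `xy` is of type II, in one of the two directions. -/
def IsTypeII (K : Set (Finset V)) (τ : Set (ℤ → V)) (x y : V) : Prop :=
  TypeII K τ x y ∨ TypeII K τ y x

theorem IsTypeII.symm {x y : V} (h : IsTypeII K τ x y) : IsTypeII K τ y x := Or.symm h

theorem TypeI.not_isTypeII {x y : V} (h : TypeI K τ x y) : ¬ IsTypeII K τ x y := by
  rintro (h' | h')
  exacts [h'.2.2 h.2.2, h'.2.2 h.2.1]

variable (hK : IsZHomogeneous K τ)

include hK

namespace IsZHomogeneous

/-- Precisely every third edge of a zigzag is of type II. -/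
theorem exists_pattern {Z : ℤ → V} (hZ : IsZigzag K Z) : ∃ r : ℤ, ∀ i,
    ((3 : ℤ) ∣ i - r → IsTypeII K τ (Z i) (Z (i + 1))) ∧
    (¬ (3 : ℤ) ∣ i - r → TypeI K τ (Z i) (Z (i + 1))) := by
  have key : ∀ Z ∈ τ, ∃ r : ℤ, ∀ i,
      ((3 : ℤ) ∣ i - r → IsTypeII K τ (Z i) (Z (i + 1))) ∧
      (¬ (3 : ℤ) ∣ i - r → TypeI K τ (Z i) (Z (i + 1))) := by
    intro Z hZ
    obtain ⟨r, hr⟩ := hK.homogeneous Z hZ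
    refine ⟨r, fun i => ⟨?_, fun h => ?_⟩⟩
    · rintro ⟨k, hk⟩
      obtain rfl : i = r + 3 * k := by omega
      exact .inl (hr k).1
    · obtain ⟨k, hk | hk⟩ : ∃ k, i = r + 3 * k + 1 ∨ i = r + 3 * k + 2 :=
        ⟨(i - r) / 3, by omega⟩
      · have := (hr k).2.1
        rw [hk, add_assoc _ 1 1]; exact this
      · have := (hr k).2.2
        rw [hk, add_assoc _ 2 1]; exact this
  rcases xor_iff_or_and_not_and _ _ |>.1 (hK.orientation.orient Z hZ) |>.1 with h | h
  · exact key Z h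
  · obtain ⟨r, hr⟩ := key _ h
    refine ⟨-r - 1, fun i => ?_⟩
    have h := hr (-i - 1)
    have e1 : -(-i - 1) = i + 1 := by ring
    have e2 : -(-i - 1 + 1) = i := by ring
    simp only [reverse, e1, e2] at h
    refine ⟨fun hd => (h.1 ?_).symm, fun hd => (h.2 ?_).symm⟩ <;> omega

/-- Four consecutive vertices of a zigzag which passes through a triangle. -/
theorem pattern_of_isTriangle {a b c d : V} (h : IsTriangle K a b c) (h' : IsTriangle K b c d)
    (hd : d ≠ a) :
    (IsTypeII K τ a b ∧ TypeI K τ b c ∧ TypeI K τ c d) ∨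
    (TypeI K τ a b ∧ IsTypeII K τ b c ∧ TypeI K τ c d) ∨
    (TypeI K τ a b ∧ TypeI K τ b c ∧ IsTypeII K τ c d) := by
  obtain ⟨Z, hZ, rfl, rfl, rfl⟩ := hK.surface.exists_zigzag h
  obtain rfl : Z 3 = d := by
    refine (hK.surface.third_unique h.rotate h' hd.symm (hZ 1).1).resolve_left ?_
    exact (hZ 0).2
  obtain ⟨r, hr⟩ := hK.exists_pattern hZ
  have h0 := hr 0
  have h1 := hr 1
  have h2 := hr 2
  norm_num at h0 h1 h2
  rcases (show r % 3 = 0 ∨ r % 3 = 1 ∨ r % 3 = 2 by omega) with h | h | h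
  · exact .inl ⟨h0.1 (by omega), h1.2 (by omega), h2.2 (by omega)⟩
  · exact .inr (.inl ⟨h0.2 (by omega), h1.1 (by omega), h2.2 (by omega)⟩)
  · exact .inr (.inr ⟨h0.2 (by omega), h1.2 (by omega), h2.1 (by omega)⟩)

theorem not_both {a b c : V} (h : IsTriangle K a b c) (h1 : IsTypeII K τ a b)
    (h2 : IsTypeII K τ b c) : False := by
  obtain ⟨d, hd, hne, -⟩ := hK.surface.exists_third h.rotate
  rcases hK.pattern_of_isTriangle h hd hne with ⟨-, h, -⟩ | ⟨h, -, -⟩ | ⟨h, -, -⟩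
  · exact h.not_isTypeII h2
  · exact h.not_isTypeII h1
  · exact h.not_isTypeII h1

/-- Every face has precisely one edge of type II. -/
theorem types_of_isTriangle {a b c : V} (h : IsTriangle K a b c) :
    (IsTypeII K τ a b ∧ TypeI K τ b c ∧ TypeI K τ a c) ∨
    (TypeI K τ a b ∧ IsTypeII K τ b c ∧ TypeI K τ a c) ∨
    (TypeI K τ a b ∧ TypeI K τ b c ∧ IsTypeII K τ a c) := by
  have hor : ∀ {a b c}, IsTriangle K a b c → IsTypeII K τ a b ∨ TypeI K τ a b := by
    intro a b c h
    obtain ⟨d, hd, hne, -⟩ := hK.surface.exists_third h.rotate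
    rcases hK.pattern_of_isTriangle h hd hne with h | h | h
    exacts [.inl h.1, .inr h.1, .inr h.1]
  have hac : IsTriangle K a c b := h.swap.rotate
  have hcb : IsTriangle K c b a := h.swap.rotate.rotate
  rcases hor h with h1 | h1 <;> rcases hor h.rotate with h2 | h2 <;> rcases hor hac with h3 | h3
  · exact (hK.not_both h h1 h2).elim
  · exact (hK.not_both h h1 h2).elim
  · exact (hK.not_both h.swap h1.symm h3).elim
  · exact .inl ⟨h1, h2, h3⟩
  · exact (hK.not_both hac h3 h2.symm).elim
  · exact .inr (.inl ⟨h1, h2, h3⟩)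
  · exact .inr (.inr ⟨h1, h2, h3⟩)
  · -- otherwise the two remaining edges of the neighbouring face are both of type II
    exfalso
    obtain ⟨d, hd, hne, -⟩ := hK.surface.exists_third h.rotate
    have hcd : IsTypeII K τ c d := by
      rcases hK.pattern_of_isTriangle h hd hne with h | h | h
      exacts [(h1.not_isTypeII h.1).elim, (h2.not_isTypeII h.2.1).elim, h.2.2]
    have hbd : IsTypeII K τ b d := by
      rcases hK.pattern_of_isTriangle hac hd.swap hne with h | h | h
      exacts [(h3.not_isTypeII h.1).elim, (h2.symm.not_isTypeII h.2.1).elim, h.2.2]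
    exact hK.not_both hd.rotate hcd hbd.symm

theorem mem_of_typeII {Z : ℤ → V} (hZ : IsZigzag K Z) {i : ℤ}
    (h : TypeII K τ (Z i) (Z (i + 1))) : Z ∈ τ := by
  rcases xor_iff_or_and_not_and _ _ |>.1 (hK.orientation.orient Z hZ) |>.1 with h' | h'
  · exact h'
  · refine absurd ⟨_, h', -(i + 1), ?_, ?_⟩ h.2.2
    · simp [reverse]
    · simp [reverse]

/-- Around the third vertex `c` of a face with directed edge from `x` to `y`, the edges of type II
form a directed path. -/
theorem typeII_next {x y c z : V} (h : IsTriangle K x y c) (hxy : TypeII K τ x y)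
    (h' : IsTriangle K y c z) (hz : z ≠ x) : TypeII K τ y z := by
  have hyc : TypeI K τ y c ∧ TypeI K τ c z := by
    rcases hK.pattern_of_isTriangle h h' hz with h | h | h
    exacts [h.2, (h.1.not_isTypeII (.inl hxy)).elim, (h.1.not_isTypeII (.inl hxy)).elim]
  have hyz : IsTypeII K τ y z := by
    rcases hK.types_of_isTriangle h' with h | h | h
    exacts [(hyc.1.not_isTypeII h.1).elim, (hyc.2.not_isTypeII h.2.1).elim, h.2.2]
  refine hyz.resolve_right fun hzy => ?_
  have hmem : ∀ {a b : V}, TypeII K τ a y → IsTriangle K a y c → IsTriangle K y c b → b ≠ a →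
      ∃ Z ∈ τ, Z 0 = a ∧ Z 1 = y ∧ Z 2 = c := by
    intro a b hay hab hb hne
    obtain ⟨Z, hZ, h0, h1, h2⟩ := hK.surface.exists_zigzag hab
    exact ⟨Z, hK.mem_of_typeII hZ (i := 0) (by rw [h0, zero_add, h1]; exact hay), h0, h1, h2⟩
  -- a zigzag which passes through the edge from `c` to `y` is reverse to one of these two
  obtain ⟨Z, hZ, i, hi, hi'⟩ := hyc.1.2.2
  have hZz := hK.orientation.isZigzag Z hZ
  have hcontra : ∀ Z' ∈ τ, Z' 0 = Z (i + 2) → Z' 1 = y → Z' 2 = c → False := by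
    intro Z' hZ' h0 h1 h2
    have hr := hZz.reverse
    have hs : SameCyclic Z' (reverse Z) := by
      refine hK.surface.zigzag_ext (hK.orientation.isZigzag Z' hZ') hr 0 (-(i + 2)) ?_ ?_ ?_
      · simp [reverse, h0]
      · rw [show -(i + 2) + 1 = -(i + 1) by ring]; simp [reverse, h1, hi']
      · rw [show -(i + 2) + 2 = -i by ring]; simp [reverse, h2, hi]
    exact (xor_iff_or_and_not_and _ _ |>.1 (hK.orientation.orient Z hZz)).2
      ⟨hZ, hK.orientation.shift Z' hZ' _ hs⟩
  have hq := (hZz i).1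
  rw [hi, hi'] at hq
  rcases hK.surface.third_unique h.rotate h' hz.symm hq.swap with hq | hq
  · obtain ⟨Z', hZ', h0, h1, h2⟩ := hmem hxy h h' hz
    exact hcontra Z' hZ' (h0.trans hq.symm) h1 h2
  · obtain ⟨Z', hZ', h0, h1, h2⟩ := hmem hzy h'.rotate.rotate h.rotate hz.symm
    exact hcontra Z' hZ' (h0.trans hq.symm) h1 h2

end IsZHomogeneous

end Homogeneous

namespace IsZHomogeneous

section Flag

variable {V : Type u} {K : Set (Finset V)} {τ : Set (ℤ → V)}

/-- The faces of a z-homogeneous triangulation, written as triples whose first two entries form the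
directed edge of type II. -/
abbrev Flag (K : Set (Finset V)) (τ : Set (ℤ → V)) : Type u :=
  {t : V × V × V // TypeII K τ t.1 t.2.1 ∧ IsTriangle K t.1 t.2.1 t.2.2}

variable (hK : IsZHomogeneous K τ)

include hK

theorem exists_nextVertex (t : Flag K τ) :
    ∃ z, IsTriangle K t.1.2.1 t.1.2.2 z ∧ z ≠ t.1.1 := by
  obtain ⟨d, h, hne, -⟩ := hK.surface.exists_third t.2.2.rotate
  exact ⟨d, h, hne⟩

theorem exists_oppVertex (t : Flag K τ) :
    ∃ d, IsTriangle K t.1.1 t.1.2.1 d ∧ d ≠ t.1.2.2 := by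
  obtain ⟨d, h, hne, -⟩ := hK.surface.exists_third t.2.2
  exact ⟨d, h, hne⟩

/-- The next flag around the third vertex of a flag. -/
noncomputable def next (t : Flag K τ) : Flag K τ :=
  ⟨(t.1.2.1, (hK.exists_nextVertex t).choose, t.1.2.2),
    hK.typeII_next t.2.2 t.2.1 (hK.exists_nextVertex t).choose_spec.1
      (hK.exists_nextVertex t).choose_spec.2,
    (hK.exists_nextVertex t).choose_spec.1.rotate.rotate.swap⟩

/-- The flag on the other side of the directed edge of a flag. -/
noncomputable def other (t : Flag K τ) : Flag K τ :=
  ⟨(t.1.1, t.1.2.1, (hK.exists_oppVertex t).choose), t.2.1,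
    (hK.exists_oppVertex t).choose_spec.1⟩

theorem isTriangle_next (t : Flag K τ) : IsTriangle K t.1.2.1 t.1.2.2 (hK.next t).1.2.1 :=
  (hK.exists_nextVertex t).choose_spec.1

theorem next_ne (t : Flag K τ) : (hK.next t).1.2.1 ≠ t.1.1 :=
  (hK.exists_nextVertex t).choose_spec.2

theorem isTriangle_other (t : Flag K τ) : IsTriangle K t.1.1 t.1.2.1 (hK.other t).1.2.2 :=
  (hK.exists_oppVertex t).choose_spec.1

theorem other_ne (t : Flag K τ) : (hK.other t).1.2.2 ≠ t.1.2.2 :=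
  (hK.exists_oppVertex t).choose_spec.2

omit hK in
theorem flag_ext {s t : Flag K τ} (h1 : s.1.1 = t.1.1) (h2 : s.1.2.1 = t.1.2.1)
    (h3 : s.1.2.2 = t.1.2.2) : s = t :=
  Subtype.ext (Prod.ext h1 (Prod.ext h2 h3))

theorem next_injective : Function.Injective hK.next := by
  intro s t hst
  have h1 : s.1.2.1 = t.1.2.1 := congrArg (fun x : Flag K τ => x.1.1) hst
  have h2 : (hK.next s).1.2.2 = (hK.next t).1.2.2 := congrArg (fun x : Flag K τ => x.1.2.2) hst
  change s.1.2.2 = t.1.2.2 at h2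
  refine flag_ext ?_ h1 h2
  have ht := t.2.2.rotate
  rw [← h1, ← h2] at ht
  refine ((hK.surface.third_unique (hK.isTriangle_next s) s.2.2.rotate (hK.next_ne s)
    ht).resolve_left ?_).symm
  rw [hst]; exact (hK.next_ne t).symm

theorem next_bijective : Function.Bijective hK.next :=
  have := hK.surface.finite
  Finite.injective_iff_bijective.1 hK.next_injective

/-- The analogue of `typeII_next` in the other direction; it holds since `next` is a permutation of
a finite set. -/
theorem typeII_prev {x y c w : V} (h : IsTriangle K x y c) (hxy : TypeII K τ x y)
    (h' : IsTriangle K x c w) (hw : w ≠ y) : TypeII K τ w x := by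
  obtain ⟨s, hs⟩ := hK.next_bijective.2 ⟨(x, y, c), hxy, h⟩
  have h1 : s.1.2.1 = x := congrArg (fun x : Flag K τ => x.1.1) hs
  have h2 : s.1.2.2 = c := congrArg (fun x : Flag K τ => x.1.2.2) hs
  have h3 : (hK.next s).1.2.1 = y := congrArg (fun x : Flag K τ => x.1.2.1) hs
  subst h1 h2 h3
  have := hK.surface.third_unique (hK.isTriangle_next s) s.2.2.rotate (hK.next_ne s) h'
  rw [this.resolve_left hw]
  exact s.2.1

omit hK in
theorem link_induction (hS : IsClosedSurface K) {x y₀ : V} (P : V → Prop) (h₀ : Adj K x y₀)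
    (hP : P y₀) (h : ∀ y z, IsTriangle K x y z → P y → P z) : ∀ y, Adj K x y → P y := by
  intro y hy
  have hr := (hS.link_connected x).preconnected ⟨y₀, h₀⟩ ⟨y, hy⟩
  rw [SimpleGraph.reachable_iff_reflTransGen] at hr
  have key : ∀ z : {y // Adj K x y}, Relation.ReflTransGen (link K x).Adj ⟨y₀, h₀⟩ z → P z.1 := by
    intro z hz
    induction hz with
    | refl => exact hP
    | tail _ hbc ih => exact h _ _ hbc ih
  exact key _ hr

/-- No edge of type II contains the third vertex of a flag. -/
theorem not_typeII_ctr (t : Flag K τ) (y : V) : ¬ IsTypeII K τ t.1.2.2 y := by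
  intro hcy
  have hadj : Adj K t.1.2.2 y := by
    rcases hcy with h | h
    exacts [h.1, h.1.symm]
  have key := link_induction hK.surface (x := t.1.2.2) (y₀ := t.1.1)
    (fun y => ∀ z, IsTriangle K t.1.2.2 y z → IsTypeII K τ y z) t.2.2.rotate.rotate.adj ?_ ?_ y hadj
  · obtain ⟨z, hz⟩ := hK.surface.exists_isTriangle_of_adj hadj
    exact hK.not_both hz hcy (key z hz)
  · intro z hz
    by_cases h : z = t.1.2.1
    · rw [h]; exact .inl t.2.1
    · exact .inr (hK.typeII_prev t.2.2 t.2.1 hz.swap h)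
  · intro y z hyz hy w hw
    by_cases h : w = y
    · rw [h]; exact (hy z hyz).symm
    · rcases hy z hyz with h' | h'
      · exact .inl (hK.typeII_next hyz.rotate h' hw.swap h)
      · exact .inr (hK.typeII_prev hyz.rotate.swap h' hw.swap h)

omit hK in
theorem TypeII.asymm {x y : V} (h : TypeII K τ x y) (h' : TypeII K τ y x) : False := h.2.2 h'.2.1

/-- The flag system of a z-homogeneous triangulation. -/
noncomputable def flagSystem : FlagSystem K (Flag K τ) where
  src t := t.1.1
  tgt t := t.1.2.1
  ctr t := t.1.2.2
  rot := Equiv.ofBijective hK.next hK.next_bijective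
  opp := hK.other
  mem_iff F := by
    constructor
    · intro hF
      obtain ⟨a, ha⟩ : F.Nonempty := by
        rw [← Finset.card_pos, hK.surface.card_eq F hF]; norm_num
      obtain ⟨b, hb, c, hc, ht⟩ := hK.surface.exists_isTriangle_of_mem hF ha
      have key : ∀ {a b c}, IsTriangle K a b c → IsTypeII K τ a b → a ∈ F → b ∈ F → c ∈ F →
          ∃ t : Flag K τ, (F : Set V) = {t.1.1, t.1.2.1, t.1.2.2} := by
        intro a b c ht h ha hb hc
        rcases h with h | h
        · exact ⟨⟨(a, b, c), h, ht⟩, hK.surface.coe_eq hF ht.1 ht.2.1 ht.2.2.1 ha hb hc⟩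
        · exact ⟨⟨(b, a, c), h, ht.swap⟩,
            hK.surface.coe_eq hF ht.1.symm ht.2.2.1 ht.2.1 hb ha hc⟩
      rcases hK.types_of_isTriangle ht with h | h | h
      · exact key ht h.1 ha hb hc
      · exact key ht.rotate h.2.1 hb hc ha
      · exact key ht.swap.rotate h.2.2 ha hc hb
    · rintro ⟨t, ht⟩
      obtain ⟨h1, h2, h3, G, hG, hx, hy, hz⟩ := t.2.2
      have := hK.surface.coe_eq hG h1 h2 h3 hx hy hz
      rwa [Finset.coe_injective (ht.trans this.symm)]
  src_rot _ := rfl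
  ctr_rot _ := rfl
  src_opp _ := rfl
  tgt_opp _ := rfl
  opp_opp t := by
    refine flag_ext rfl rfl ?_
    exact (hK.surface.third_unique (hK.isTriangle_other t) t.2.2 (hK.other_ne t)
      (hK.isTriangle_other (hK.other t))).resolve_left (hK.other_ne (hK.other t))
  ctr_opp_ne := hK.other_ne
  ctr_ne_src s t h := hK.not_typeII_ctr s t.1.2.1 (.inl (by rw [h]; exact t.2.1))
  asymm s t h h' := TypeII.asymm s.2.1 (by rw [h, h']; exact t.2.1)
  eq_or_eq_opp s t hs ht := by
    have := t.2.2
    rw [hs, ht] at this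
    rcases hK.surface.third_unique s.2.2 (hK.isTriangle_other s) (hK.other_ne s).symm this
      with h | h
    · exact .inl (flag_ext hs ht h)
    · exact .inr (flag_ext hs ht h)
  eq_of_src_ctr s t hs hc := by
    by_cases h : t.1.2.1 = s.1.2.1
    · exact flag_ext hs h hc
    · have ht := t.2.2.rotate.rotate.swap
      rw [hs, hc] at ht
      have h2 := t.2.1
      rw [hs] at h2
      exact (TypeII.asymm h2 (hK.typeII_prev s.2.2 s.2.1 ht h)).elim
  exists_flag x := by
    obtain ⟨F, hF, hx⟩ := hK.surface.exists_face x
    obtain ⟨b, -, c, -, ht⟩ := hK.surface.exists_isTriangle_of_mem hF hx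
    have hsrc : ∀ {a b c}, IsTriangle K a b c → IsTypeII K τ a b →
        ∃ t : Flag K τ, a = t.1.1 ∨ a = t.1.2.2 := by
      rintro a b c ht (h | h)
      · exact ⟨⟨(a, b, c), h, ht⟩, .inl rfl⟩
      · exact ⟨hK.next ⟨(b, a, c), h, ht.swap⟩, .inl rfl⟩
    rcases hK.types_of_isTriangle ht with h | h | h
    · exact hsrc ht h.1
    · rcases h.2.1 with h | h
      · exact ⟨⟨(b, c, x), h, ht.rotate⟩, .inr rfl⟩
      · exact ⟨⟨(c, b, x), h, ht.rotate.swap⟩, .inr rfl⟩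
    · exact hsrc ht.swap.rotate h.2.2

theorem typeII_iff_directed (x y : V) : TypeII K τ x y ↔ hK.flagSystem.Directed x y := by
  constructor
  · intro h
    obtain ⟨z, hz⟩ := hK.surface.exists_isTriangle_of_adj h.1
    exact ⟨⟨(x, y, z), h, hz⟩, rfl, rfl⟩
  · rintro ⟨t, rfl, rfl⟩
    exact t.2.1

theorem flagSystem_isConnected : hK.flagSystem.IsConnected := by
  set p := hK.flagSystem with hp
  have hctr : ∀ f g, p.ctr f = p.ctr g → Relation.EqvGen (fun a b => b = p.rot a) f g := by
    intro f g hfg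
    refine link_induction hK.surface (x := p.ctr f) (y₀ := p.src f)
      (fun y => ∀ g, p.ctr g = p.ctr f → p.src g = y → Relation.EqvGen (fun a b => b = p.rot a) f g)
      (p.adj_ctr_src f) ?_ ?_ (p.src g) ?_ g hfg.symm rfl
    · intro g hc hs
      rw [p.eq_of_src_ctr f g hs hc]; exact .refl _
    · rintro y z hyz hy g hc rfl
      rw [← hc] at hyz
      rcases p.third_of_src_ctr g hyz.rotate.rotate with h | h
      · refine .trans _ _ _ (hy (p.rot g) (by rw [p.ctr_rot, hc]) (by rw [p.src_rot, h])) ?_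
        exact .symm _ _ (.rel _ _ rfl)
      · refine .trans _ _ _ (hy (p.rot.symm g) (by rw [p.ctr_rot_symm, hc]) h.symm) ?_
        exact .rel _ _ (Equiv.apply_symm_apply _ _).symm
    · rw [hfg]; exact p.adj_ctr_src g
  -- `R y g`: the vertex `y` is on the directed edge of `g` or of the previous flag, or is
  -- their centre
  let R : V → Flag K τ → Prop := fun y g => y = p.tgt g ∨ y = p.ctr g ∨ y = p.src (p.rot.symm g)
  let r : Flag K τ → Flag K τ → Prop := fun a b => b = p.opp a ∨ b = p.rot (p.opp (p.rot.symm a))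
  have hasym : ∀ g h, p.src h = p.src g → p.tgt g ≠ p.src (p.rot.symm h) := by
    intro g h hs ht
    exact p.asymm g (p.rot.symm h) (by rw [p.tgt_rot_symm, hs]) ht
  have hR : ∀ y g h, R y g → R y h → p.src h = p.src g → Relation.EqvGen r g h := by
    rintro y g h (hg | hg | hg) (hh | hh | hh) hs
    · rcases p.eq_or_eq_opp g h hs (by rw [← hg, hh]) with rfl | rfl
      · exact .refl _
      · exact .rel _ _ (.inl rfl)
    · exact absurd (hh.symm.trans hg) (p.ctr_ne_tgt _ _)
    · exact absurd (hg.symm.trans hh) (hasym _ _ hs)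
    · exact absurd (hg.symm.trans hh) (p.ctr_ne_tgt _ _)
    · rw [p.eq_of_src_ctr g h hs (by rw [← hg, hh])]; exact .refl _
    · exact absurd (hg.symm.trans hh) (p.ctr_ne_src _ _)
    · exact absurd (hh.symm.trans hg) (hasym _ _ hs.symm)
    · exact absurd (hh.symm.trans hg) (p.ctr_ne_src _ _)
    · rcases p.eq_or_eq_opp (p.rot.symm g) (p.rot.symm h) (by rw [← hg, hh])
        (by rw [p.tgt_rot_symm, p.tgt_rot_symm, hs]) with h' | h'
      · rw [p.rot.symm.injective h']; exact .refl _
      · exact .rel _ _ (.inr (by rw [← h', Equiv.apply_symm_apply]))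
  have hsrc : ∀ f g, p.src f = p.src g → Relation.EqvGen r f g := by
    intro f g hfg
    refine link_induction hK.surface (x := p.src f) (y₀ := p.tgt f)
      (fun y => ∀ g, p.src g = p.src f → R y g → Relation.EqvGen r f g)
      (p.adj_src_tgt f) ?_ ?_ (p.tgt g) ?_ g hfg.symm (.inl rfl)
    · exact fun g hs hg => hR _ f g (.inl rfl) hg hs
    · intro y z hyz hy g hs hg
      obtain ⟨h, hh, hhy, hhz⟩ : ∃ h, p.src h = p.src f ∧ R y h ∧ R z h := by
        obtain ⟨k, hk⟩ := p.exists_of_isTriangle hyz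
        rcases hk with ⟨h1, h2, h3⟩ | ⟨h1, h2, h3⟩ | ⟨h1, h2, h3⟩ | ⟨h1, h2, h3⟩ | ⟨h1, h2, h3⟩ |
          ⟨h1, h2, h3⟩
        · exact ⟨k, h1.symm, .inl h2, .inr (.inl h3)⟩
        · refine ⟨p.rot k, by rw [p.src_rot, h1], .inr (.inr ?_), .inr (.inl ?_)⟩
          · rw [Equiv.symm_apply_apply, h2]
          · rw [p.ctr_rot, h3]
        · exact ⟨k, h1.symm, .inr (.inl h2), .inl h3⟩
        · refine ⟨p.rot k, by rw [p.src_rot, h1], .inr (.inl ?_), .inr (.inr ?_)⟩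
          · rw [p.ctr_rot, h2]
          · rw [Equiv.symm_apply_apply, h3]
        · exact absurd h1.symm (p.ctr_ne_src _ _)
        · exact absurd h1.symm (p.ctr_ne_src _ _)
      exact .trans _ _ _ (hy h hh hhy) (hR z h g hhz hg (hs.trans hh.symm))
    · rw [hfg]; exact p.adj_src_tgt g
  refine ⟨hctr, hsrc, fun f g => ?_⟩
  let s : Flag K τ → Flag K τ → Prop := fun a b => b = p.rot a ∨ b = p.opp a
  have hctr' : ∀ {g h}, p.ctr g = p.ctr h → Relation.EqvGen s g h := fun h =>
    eqvGen_map id (fun _ _ h => .rel _ _ (.inl h)) (hctr _ _ h)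
  have hsrc' : ∀ {g h}, p.src g = p.src h → Relation.EqvGen s g h := fun h => by
    refine eqvGen_map id ?_ (hsrc _ _ h)
    rintro a b (rfl | rfl)
    · exact .rel _ _ (.inr rfl)
    · refine .trans _ (p.rot.symm a) _ (.symm _ _ (.rel _ _ (.inl ?_)))
        (.trans _ (p.opp (p.rot.symm a)) _ (.rel _ _ (.inr rfl)) (.rel _ _ (.inl rfl)))
      exact (Equiv.apply_symm_apply _ _).symm
  have hrot : ∀ g, Relation.EqvGen s g (p.rot g) := fun g => .rel _ _ (.inl rfl)
  have hface : ∀ {x g h}, x ∈ p.face g → x ∈ p.face h → Relation.EqvGen s g h := by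
    intro x g h hg hh
    rw [p.mem_face] at hg hh
    rcases hg with hg | hg | hg <;> rcases hh with hh | hh | hh
    · exact hsrc' (hg.symm.trans hh)
    · exact .trans _ _ _ (hsrc' (by rw [p.src_rot, ← hg, hh])) (.symm _ _ (hrot h))
    · exact absurd (hh.symm.trans hg) (p.ctr_ne_src _ _)
    · exact .trans _ _ _ (hrot g) (hsrc' (by rw [p.src_rot, ← hg, hh]))
    · exact .trans _ _ _ (hrot g) (.trans _ _ _ (hsrc' (by rw [p.src_rot, p.src_rot, ← hg, hh]))
        (.symm _ _ (hrot h)))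
    · exact absurd (hh.symm.trans hg) (p.ctr_ne_tgt _ _)
    · exact absurd (hg.symm.trans hh) (p.ctr_ne_src _ _)
    · exact absurd (hg.symm.trans hh) (p.ctr_ne_tgt _ _)
    · exact hctr' (hg.symm.trans hh)
  have hreach := hK.surface.connected.preconnected (p.src f) (p.src g)
  rw [SimpleGraph.reachable_iff_reflTransGen] at hreach
  have key : ∀ y, Relation.ReflTransGen (graph K).Adj (p.src f) y →
      ∀ h, y ∈ p.face h → Relation.EqvGen s f h := by
    intro y hy
    induction hy with
    | refl => exact fun h hh => hface (p.src_mem_face f) hh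
    | tail _ hbc ih =>
      intro h hh
      obtain ⟨-, F, hF, hb, hc⟩ := hbc
      obtain ⟨k, rfl⟩ := p.exists_face_eq hF
      exact .trans _ _ _ (ih k hb) (hface hc hh)
  exact key _ hreach g (p.src_mem_face g)

end Flag

end IsZHomogeneous

/-! ### Bipyramids -/

section Bipyramid

variable (m : ℕ)

/-- The faces of the bipyramid over a polygon with `m + 4` vertices. The vertices of the polygon are
`Sum.inl k`, and the two apices are `Sum.inr s`. -/
def bipyramid : Set (Finset (Fin (m + 4) ⊕ Bool)) :=
  {F | ∃ f : Fin (m + 4) × Bool,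
    (F : Set (Fin (m + 4) ⊕ Bool)) = {Sum.inl f.1, Sum.inl (f.1 + 1), Sum.inr f.2}}

variable {m}

theorem val_add_one (k : Fin (m + 4)) :
    ((k + 1 : Fin (m + 4)) : ℕ) = if (k : ℕ) = m + 3 then 0 else (k : ℕ) + 1 := by
  rw [Fin.val_add_one]
  congr 1
  rw [Fin.ext_iff]; rfl

theorem val_one' : ((1 : Fin (m + 4)) : ℕ) = 1 := rfl

theorem val_two' : ((2 : Fin (m + 4)) : ℕ) = 2 := rfl

variable (m)

/-- The flag system of a bipyramid; the polygon is directed cyclically. -/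
def bipyramidFlags : FlagSystem (bipyramid m) (Fin (m + 4) × Bool) where
  src f := Sum.inl f.1
  tgt f := Sum.inl (f.1 + 1)
  ctr f := Sum.inr f.2
  rot := (Equiv.addRight 1).prodCongr (Equiv.refl Bool)
  opp f := (f.1, !f.2)
  mem_iff _ := Iff.rfl
  src_rot _ := rfl
  ctr_rot _ := rfl
  src_opp _ := rfl
  tgt_opp _ := rfl
  opp_opp f := by simp
  ctr_opp_ne f := by simp
  ctr_ne_src f g := by simp
  asymm f g h h' := by
    simp only [Sum.inl.injEq, Fin.ext_iff, val_add_one] at h h'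
    grind
  eq_or_eq_opp f g hs _ := by
    obtain ⟨k, s⟩ := f
    obtain ⟨l, t⟩ := g
    simp only [Sum.inl.injEq] at hs
    subst hs
    cases s <;> cases t <;> simp
  eq_of_src_ctr f g hs hc := Prod.ext (Sum.inl.inj hs) (Sum.inr.inj hc)
  exists_flag x := by
    rcases x with k | s
    · exact ⟨(k, true), .inl rfl⟩
    · exact ⟨(0, s), .inr rfl⟩

theorem bipyramidFlags_isConnected : (bipyramidFlags m).IsConnected := by
  have hctr : ∀ s (k l : Fin (m + 4)),
      Relation.EqvGen (fun a b => b = (bipyramidFlags m).rot a) (k, s) (l, s) := by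
    intro s
    have h0 : ∀ k : Fin (m + 4),
        Relation.EqvGen (fun a b => b = (bipyramidFlags m).rot a) (0, s) (k, s) := by
      intro k
      induction k using Fin.induction with
      | zero => exact .refl _
      | succ k ih =>
        refine .trans _ _ _ ih (.rel _ _ ?_)
        rw [← Fin.coeSucc_eq_succ]; rfl
    exact fun k l => .trans _ _ _ (.symm _ _ (h0 k)) (h0 l)
  refine ⟨?_, ?_, ?_⟩
  · rintro ⟨k, s⟩ ⟨l, t⟩ h
    obtain rfl : s = t := Sum.inr.inj h
    exact hctr s k l
  · rintro ⟨k, s⟩ ⟨l, t⟩ h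
    obtain rfl : k = l := Sum.inl.inj h
    by_cases hst : s = t
    · rw [hst]; exact .refl _
    · refine .rel _ _ (.inl ?_)
      cases s <;> cases t <;> simp_all [bipyramidFlags]
  · rintro ⟨k, s⟩ ⟨l, t⟩
    have h1 : Relation.EqvGen (fun a b => b = (bipyramidFlags m).rot a ∨
        b = (bipyramidFlags m).opp a) (k, s) (l, s) :=
      eqvGen_map id (fun _ _ h => .rel _ _ (.inl h)) (hctr s k l)
    by_cases hst : s = t
    · rw [← hst]; exact h1
    · refine .trans _ _ _ h1 (.rel _ _ (.inr ?_))
      cases s <;> cases t <;> simp_all [bipyramidFlags]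

theorem inl_mem_bipyramid_face {k j : Fin (m + 4)} {s : Bool} :
    Sum.inl j ∈ (bipyramidFlags m).face (k, s) ↔ j = k ∨ j = k + 1 := by
  rw [FlagSystem.mem_face]
  simp [bipyramidFlags]

theorem inr_mem_bipyramid_face {k : Fin (m + 4)} {s t : Bool} :
    Sum.inr t ∈ (bipyramidFlags m).face (k, s) ↔ t = s := by
  rw [FlagSystem.mem_face]
  simp [bipyramidFlags]

/-- The vertices `0`, `1`, `2` of the polygon form a special pair; its two sides are the two
cones of the bipyramid. -/
noncomputable def bipyramidPair : SpecialPair (bipyramid m) (bipyramidFlags m).zigzags where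
  v₁ := Sum.inl 0
  v₂ := Sum.inl 1
  v₃ := Sum.inl 2
  typeII₁ := (bipyramidFlags m).typeII (0, true)
  typeII₂ := (bipyramidFlags m).typeII (1, true)
  side F := open Classical in decide (Sum.inr true ∈ F)
  side_eq := by
    intro F hF G hG x h1 h2 h3 hF2 hFx hG2 hGx
    obtain ⟨⟨k, s⟩, rfl⟩ := (bipyramidFlags m).exists_face_eq hF
    obtain ⟨⟨l, t⟩, rfl⟩ := (bipyramidFlags m).exists_face_eq hG
    rcases x with j | r
    · rw [inl_mem_bipyramid_face] at hF2 hFx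
      simp only [ne_eq, Sum.inl.injEq, Fin.ext_iff, val_add_one, val_one', val_two', Fin.val_zero]
        at *
      grind
    · rw [inr_mem_bipyramid_face] at hFx hGx
      simp only [inr_mem_bipyramid_face, ← hFx, ← hGx]
  side_ne₁ := by
    intro F hF G hG hne hF1 hF2 hG1 hG2
    obtain ⟨⟨k, s⟩, rfl⟩ := (bipyramidFlags m).exists_face_eq hF
    obtain ⟨⟨l, t⟩, rfl⟩ := (bipyramidFlags m).exists_face_eq hG
    have hkl : k = l := by
      simp only [inl_mem_bipyramid_face, Fin.ext_iff, val_add_one, val_one', Fin.val_zero] at *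
      grind
    have hst : s ≠ t := fun h => hne (by rw [hkl, h])
    simp only [inr_mem_bipyramid_face]
    cases s <;> cases t <;> simp_all
  side_ne₂ := by
    intro F hF G hG hne hF1 hF2 hG1 hG2
    obtain ⟨⟨k, s⟩, rfl⟩ := (bipyramidFlags m).exists_face_eq hF
    obtain ⟨⟨l, t⟩, rfl⟩ := (bipyramidFlags m).exists_face_eq hG
    have hkl : k = l := by
      simp only [inl_mem_bipyramid_face, Fin.ext_iff, val_add_one, val_one', val_two'] at *
      grind
    have hst : s ≠ t := fun h => hne (by rw [hkl, h])
    simp only [inr_mem_bipyramid_face]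
    cases s <;> cases t <;> simp_all

theorem bipyramid_not_adj :
    ¬ Adj (bipyramid m) (bipyramidPair m).v₁ (bipyramidPair m).v₃ := by
  rintro ⟨-, F, hF, h1, h3⟩
  obtain ⟨⟨k, s⟩, rfl⟩ := (bipyramidFlags m).exists_face_eq hF
  simp only [bipyramidPair, inl_mem_bipyramid_face, Fin.ext_iff, val_add_one, val_two',
    Fin.val_zero] at *
  grind

end Bipyramid

/-! ### Subdivision of an edge -/

section Realization

variable {W : Type u}

theorem mem_simplex_iff {F : Finset W} {a b c : W} (hF : (F : Set W) = {a, b, c}) (hab : a ≠ b)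
    (hbc : b ≠ c) (hac : a ≠ c) (f : W → ℝ) :
    ((∀ x, x ∉ F → f x = 0) ∧ ∑ x ∈ F, f x = 1) ↔
      (∀ x, x ≠ a → x ≠ b → x ≠ c → f x = 0) ∧ f a + f b + f c = 1 := by
  classical
  obtain rfl : F = {a, b, c} := Finset.coe_injective (by simpa using hF)
  rw [Finset.sum_insert (by simp [hab, hac]), Finset.sum_pair hbc, add_assoc]
  simp

/-- The point of the subdivided complex with given barycentric coordinates in the original complex,
when the edge `bc` is divided at its midpoint `m`. -/
noncomputable def subdivideFun (b c m : W) (f : W → ℝ) : W → ℝ := open Classical in fun x =>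
  if x = m then 2 * min (f b) (f c) else if x = b ∨ x = c then f x - min (f b) (f c) else f x

/-- The inverse of `subdivideFun`: the midpoint `m` of the edge `bc` is expressed by `b` and `c`. -/
noncomputable def unsubdivideFun (b c m : W) (f : W → ℝ) : W → ℝ := open Classical in fun x =>
  if x = m then 0 else if x = b ∨ x = c then f x + f m / 2 else f x

theorem continuous_subdivideFun (b c m : W) : Continuous (subdivideFun b c m) := by
  refine continuous_pi fun x => ?_
  unfold subdivideFun
  split_ifs <;> fun_prop

theorem continuous_unsubdivideFun (b c m : W) : Continuous (unsubdivideFun b c m) := by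
  refine continuous_pi fun x => ?_
  unfold unsubdivideFun
  split_ifs <;> fun_prop

theorem unsubdivide_subdivide {b c m : W} {f : W → ℝ} (hf : f m = 0) :
    unsubdivideFun b c m (subdivideFun b c m f) = f := by
  funext x
  by_cases hx : x = m
  · simp [unsubdivideFun, hx, hf]
  · by_cases hx' : x = b ∨ x = c <;> simp [unsubdivideFun, subdivideFun, hx, hx']

theorem subdivide_unsubdivide {b c m : W} (hb : b ≠ m) (hc : c ≠ m) {f : W → ℝ}
    (hf : min (f b) (f c) = 0) : subdivideFun b c m (unsubdivideFun b c m f) = f := by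
  have h : min (unsubdivideFun b c m f b) (unsubdivideFun b c m f c) = f m / 2 := by
    simp [unsubdivideFun, hb, hc, min_add_add_right, hf]
  funext x
  by_cases hx : x = m
  · subst hx
    unfold subdivideFun
    rw [if_pos rfl, h]; ring
  · unfold subdivideFun
    rw [if_neg hx, h]
    by_cases hx' : x = b ∨ x = c <;> simp [unsubdivideFun, hx, hx']

theorem subdivideFun_of_min_eq_zero {b c m : W} {f : W → ℝ} (hm : f m = 0)
    (h : min (f b) (f c) = 0) : subdivideFun b c m f = f := by
  funext x
  by_cases hx : x = m <;> simp [subdivideFun, h, hx, hm]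

theorem unsubdivideFun_of_eq_zero {b c m : W} {f : W → ℝ} (hm : f m = 0) :
    unsubdivideFun b c m f = f := by
  funext x
  by_cases hx : x = m <;> simp [unsubdivideFun, hx, hm]

/-- Subdividing an edge `bc`, which is contained in the two faces `bcp` and `bcq`, by a new vertex
`m` does not change the geometric realization up to homeomorphism. -/
theorem realization_subdivide {K K' R : Set (Finset W)} {b c m p q : W} (hbc : b ≠ c) (hbm : b ≠ m)
    (hcm : c ≠ m) (hbp : b ≠ p) (hcp : c ≠ p) (hpm : p ≠ m) (hbq : b ≠ q) (hcq : c ≠ q)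
    (hqm : q ≠ m) (hR : ∀ F ∈ R, b ∈ F → c ∉ F) (hRm : ∀ F ∈ R, m ∉ F)
    (hK : ∀ F, F ∈ K ↔ F ∈ R ∨ (F : Set W) = {b, c, p} ∨ (F : Set W) = {b, c, q})
    (hK' : ∀ F, F ∈ K' ↔ F ∈ R ∨ (F : Set W) = {m, b, p} ∨ (F : Set W) = {m, c, p} ∨
      (F : Set W) = {m, b, q} ∨ (F : Set W) = {m, c, q}) :
    Nonempty (Realization K ≃ₜ Realization K') := by
  -- the points of both realizations in terms of their coordinates
  have hfaces : ∀ (f : W → ℝ) (hf : ∀ x, 0 ≤ f x) (p : W), b ≠ p → c ≠ p → p ≠ m →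
      ((∃ F : Finset W, (F : Set W) = {b, c, p} ∧ (∀ x, x ∉ F → f x = 0) ∧ ∑ x ∈ F, f x = 1) →
      f m = 0 ∧ ∃ F : Finset W, ((F : Set W) = {m, b, p} ∨ (F : Set W) = {m, c, p}) ∧
        (∀ x, x ∉ F → subdivideFun b c m f x = 0) ∧ ∑ x ∈ F, subdivideFun b c m f x = 1) ∧
      ((∃ F : Finset W, ((F : Set W) = {m, b, p} ∨ (F : Set W) = {m, c, p}) ∧
        (∀ x, x ∉ F → f x = 0) ∧ ∑ x ∈ F, f x = 1) → min (f b) (f c) = 0 ∧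
        ∃ F : Finset W, (F : Set W) = {b, c, p} ∧ (∀ x, x ∉ F → unsubdivideFun b c m f x = 0) ∧
          ∑ x ∈ F, unsubdivideFun b c m f x = 1) := by
    intro f hf p hbp hcp hpm
    constructor
    · rintro ⟨F, hF, h⟩
      rw [mem_simplex_iff hF hbc hcp hbp] at h
      have hfm : f m = 0 := h.1 m hbm.symm hcm.symm hpm.symm
      refine ⟨hfm, ?_⟩
      rcases le_total (f b) (f c) with hle | hle
      · obtain ⟨G, hG⟩ := exists_finset_coe m c p
        refine ⟨G, .inr hG, (mem_simplex_iff hG hcm.symm hcp hpm.symm _).2 ⟨?_, ?_⟩⟩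
        · intro x hxm hxc hxp
          by_cases hxb : x = b
          · simp [subdivideFun, hxb, hbm, hle]
          · simp [subdivideFun, hxm, hxb, hxc, h.1 x hxb hxc hxp]
        · simp [subdivideFun, hcm, hpm, hbp.symm, hcp.symm, hle]
          linarith [h.2]
      · obtain ⟨G, hG⟩ := exists_finset_coe m b p
        refine ⟨G, .inl hG, (mem_simplex_iff hG hbm.symm hbp hpm.symm _).2 ⟨?_, ?_⟩⟩
        · intro x hxm hxb hxp
          by_cases hxc : x = c
          · simp [subdivideFun, hxc, hcm, hle]
          · simp [subdivideFun, hxm, hxb, hxc, h.1 x hxb hxc hxp]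
        · simp [subdivideFun, hbm, hpm, hbp.symm, hcp.symm, hle]
          linarith [h.2]
    · rintro ⟨F, hF | hF, h⟩
      · rw [mem_simplex_iff hF hbm.symm hbp hpm.symm] at h
        have hfc : f c = 0 := h.1 c hcm hbc.symm hcp
        refine ⟨by rw [hfc]; exact min_eq_right (hf b), ?_⟩
        obtain ⟨G, hG⟩ := exists_finset_coe b c p
        refine ⟨G, hG, (mem_simplex_iff hG hbc hcp hbp _).2 ⟨?_, ?_⟩⟩
        · intro x hxb hxc hxp
          by_cases hxm : x = m
          · simp [unsubdivideFun, hxm]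
          · simp [unsubdivideFun, hxm, hxb, hxc, h.1 x hxm hxb hxp]
        · simp [unsubdivideFun, hbm, hcm, hpm, hbp.symm, hcp.symm, hfc]
          linarith [h.2]
      · rw [mem_simplex_iff hF hcm.symm hcp hpm.symm] at h
        have hfb : f b = 0 := h.1 b hbm hbc hbp
        refine ⟨by rw [hfb]; exact min_eq_left (hf c), ?_⟩
        obtain ⟨G, hG⟩ := exists_finset_coe b c p
        refine ⟨G, hG, (mem_simplex_iff hG hbc hcp hbp _).2 ⟨?_, ?_⟩⟩
        · intro x hxb hxc hxp
          by_cases hxm : x = m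
          · simp [unsubdivideFun, hxm]
          · simp [unsubdivideFun, hxm, hxb, hxc, h.1 x hxm hxc hxp]
        · simp [unsubdivideFun, hbm, hcm, hpm, hbp.symm, hcp.symm, hfb]
          linarith [h.2]
  have hRest : ∀ (f : W → ℝ) (hf : ∀ x, 0 ≤ f x), ∀ F ∈ R, (∀ x, x ∉ F → f x = 0) →
      f m = 0 ∧ min (f b) (f c) = 0 := by
    intro f hf F hF h
    refine ⟨h m (hRm F hF), ?_⟩
    by_cases hb : b ∈ F
    · rw [h c (hR F hF hb)]; exact min_eq_right (hf b)
    · rw [h b hb]; exact min_eq_left (hf c)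
  have hto : ∀ f : Realization K, f.1 m = 0 ∧
      ∃ F ∈ K', (∀ x, x ∉ F → subdivideFun b c m f.1 x = 0) ∧
      ∑ x ∈ F, subdivideFun b c m f.1 x = 1 := by
    rintro ⟨f, hf, F, hF, h⟩
    rcases (hK F).1 hF with hF | hF | hF
    · obtain ⟨h0, h1⟩ := hRest f hf F hF h.1
      refine ⟨h0, F, (hK' F).2 (.inl hF), ?_⟩
      simpa only [subdivideFun_of_min_eq_zero h0 h1] using h
    · obtain ⟨h0, G, hG, h'⟩ := (hfaces f hf p hbp hcp hpm).1 ⟨F, hF, h⟩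
      exact ⟨h0, G, (hK' G).2 (by tauto), h'⟩
    · obtain ⟨h0, G, hG, h'⟩ := (hfaces f hf q hbq hcq hqm).1 ⟨F, hF, h⟩
      exact ⟨h0, G, (hK' G).2 (by tauto), h'⟩
  have hinv : ∀ f : Realization K', min (f.1 b) (f.1 c) = 0 ∧ ∃ F ∈ K,
      (∀ x, x ∉ F → unsubdivideFun b c m f.1 x = 0) ∧ ∑ x ∈ F, unsubdivideFun b c m f.1 x = 1 := by
    rintro ⟨f, hf, F, hF, h⟩
    have hcase : F ∈ R ∨ ((F : Set W) = {m, b, p} ∨ (F : Set W) = {m, c, p}) ∨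
      ((F : Set W) = {m, b, q} ∨ (F : Set W) = {m, c, q}) := by
      have := (hK' F).1 hF
      tauto
    rcases hcase with hF | hF | hF
    · obtain ⟨h0, h1⟩ := hRest f hf F hF h.1
      refine ⟨h1, F, (hK F).2 (.inl hF), ?_⟩
      simpa only [unsubdivideFun_of_eq_zero h0] using h
    · obtain ⟨h0, G, hG, h'⟩ := (hfaces f hf p hbp hcp hpm).2 ⟨F, hF, h⟩
      exact ⟨h0, G, (hK G).2 (by tauto), h'⟩
    · obtain ⟨h0, G, hG, h'⟩ := (hfaces f hf q hbq hcq hqm).2 ⟨F, hF, h⟩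
      exact ⟨h0, G, (hK G).2 (by tauto), h'⟩
  have hnn : ∀ f : W → ℝ, (∀ x, 0 ≤ f x) → ∀ x, 0 ≤ subdivideFun b c m f x := by
    intro f hf x
    unfold subdivideFun
    split_ifs with h1 h2
    · exact mul_nonneg zero_le_two (le_min (hf b) (hf c))
    · rcases h2 with rfl | rfl
      · exact sub_nonneg.2 (min_le_left _ _)
      · exact sub_nonneg.2 (min_le_right _ _)
    · exact hf x
  have hnn' : ∀ f : W → ℝ, (∀ x, 0 ≤ f x) → ∀ x, 0 ≤ unsubdivideFun b c m f x := by
    intro f hf x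
    unfold unsubdivideFun
    have := hf x
    have := hf m
    split_ifs <;> linarith
  exact ⟨{
    toFun := fun f => ⟨subdivideFun b c m f.1, hnn _ f.2.1, (hto f).2⟩
    invFun := fun f => ⟨unsubdivideFun b c m f.1, hnn' _ f.2.1, (hinv f).2⟩
    left_inv := fun f => Subtype.ext (unsubdivide_subdivide (hto f).1)
    right_inv := fun f => Subtype.ext (subdivide_unsubdivide hbm hcm (hinv f).1)
    continuous_toFun := ((continuous_subdivideFun b c m).comp continuous_subtype_val).subtype_mk _
    continuous_invFun :=
      ((continuous_unsubdivideFun b c m).comp continuous_subtype_val).subtype_mk _ }⟩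

/-- The geometric realization only depends on the complex up to renaming vertices; vertices which
are not contained in any face do not matter. -/
theorem realization_map {A : Type v} {W : Type w} {L : Set (Finset A)} {L' : Set (Finset W)}
    (e : A → W) (he : Function.Injective e)
    (h : ∀ F : Finset W, F ∈ L' ↔ ∃ G ∈ L, (F : Set W) = e '' (G : Set A)) :
    Nonempty (Realization L ≃ₜ Realization L') := by
  classical
  have hsum : ∀ (F : Finset W) (G : Finset A), (F : Set W) = e '' (G : Set A) → ∀ f : W → ℝ,
      ∑ x ∈ F, f x = ∑ x ∈ G, f (e x) := by
    intro F G hFG f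
    obtain rfl : F = G.map ⟨e, he⟩ := Finset.coe_injective (by simpa using hFG)
    rw [Finset.sum_map]; rfl
  have hmem : ∀ (F : Finset W) (G : Finset A), (F : Set W) = e '' (G : Set A) → ∀ x,
      e x ∈ F ↔ x ∈ G := by
    intro F G hFG x
    rw [← Finset.mem_coe, hFG, he.mem_set_image, Finset.mem_coe]
  let ext : (A → ℝ) → W → ℝ := fun f => Function.extend e f 0
  have hext : ∀ f x, ext f (e x) = f x := fun f x => he.extend_apply _ _ _
  have hext' : ∀ f (w : W), (∀ x, e x ≠ w) → ext f w = 0 := fun f w hw =>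
    Function.extend_apply' _ _ _ fun ⟨x, hx⟩ => hw x hx
  have hcont : Continuous ext := by
    refine continuous_pi fun w => ?_
    by_cases hw : ∃ x, e x = w
    · obtain ⟨x, rfl⟩ := hw
      simp only [hext]; fun_prop
    · push Not at hw
      simp only [fun f => hext' f w hw]; fun_prop
  have hzero : ∀ f : Realization L', ∀ w, (∀ x, e x ≠ w) → f.1 w = 0 := by
    rintro ⟨f, hf, F, hF, h0, -⟩ w hw
    obtain ⟨G, -, hG⟩ := (h F).1 hF
    refine h0 w fun hwF => ?_
    rw [← Finset.mem_coe, hG] at hwF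
    obtain ⟨x, -, hx⟩ := hwF
    exact hw x hx
  refine ⟨{
    toFun := fun f => ⟨ext f.1, fun w => ?_, ?_⟩
    invFun := fun f => ⟨fun x => f.1 (e x), fun x => f.2.1 _, ?_⟩
    left_inv := fun f => Subtype.ext (funext fun x => hext _ _)
    right_inv := fun f => Subtype.ext (funext fun w => ?_)
    continuous_toFun := (hcont.comp continuous_subtype_val).subtype_mk _
    continuous_invFun := by
      refine Continuous.subtype_mk (continuous_pi fun x => ?_) _
      exact (continuous_apply (e x)).comp continuous_subtype_val }⟩
  · by_cases hw : ∃ x, e x = w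
    · obtain ⟨x, rfl⟩ := hw
      rw [hext]; exact f.2.1 x
    · push Not at hw
      rw [hext' _ w hw]
  · obtain ⟨f, hf, G, hG, h0, h1⟩ := f
    refine ⟨G.map ⟨e, he⟩, (h _).2 ⟨G, hG, by simp⟩, fun w hw => ?_, ?_⟩
    · by_cases hw' : ∃ x, e x = w
      · obtain ⟨x, rfl⟩ := hw'
        rw [hext]
        exact h0 x fun hx => hw ((hmem _ G (by simp) x).2 hx)
      · push Not at hw'
        exact hext' _ w hw'
    · rw [hsum _ G (by simp)]
      simpa only [hext] using h1
  · obtain ⟨f, hf, F, hF, h0, h1⟩ := f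
    obtain ⟨G, hG, hFG⟩ := (h F).1 hF
    refine ⟨G, hG, fun x hx => h0 _ fun hx' => hx ((hmem F G hFG x).1 hx'), ?_⟩
    rw [← hsum F G hFG, h1]
  · by_cases hw : ∃ x, e x = w
    · obtain ⟨x, rfl⟩ := hw
      exact hext _ _
    · push Not at hw
      exact (hext' _ w hw).trans (hzero f w hw).symm

end Realization

/-! ### Bipyramids are spheres -/

section Sphere

/-- The vertex of the octahedron `bipyramid 0` on the coordinate axis `i`, in positive or negative
direction. The polygon is in the plane of the first two axes. -/
noncomputable def octahedronFun (x : EuclideanSpace ℝ (Fin 3)) : Fin 4 ⊕ Bool → ℝ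
  | .inl 0 => (|x 0| + x 0) / 2
  | .inl 1 => (|x 1| + x 1) / 2
  | .inl 2 => (|x 0| - x 0) / 2
  | .inl 3 => (|x 1| - x 1) / 2
  | .inr true => (|x 2| + x 2) / 2
  | .inr false => (|x 2| - x 2) / 2

/-- The point of the octahedron with given barycentric coordinates. -/
noncomputable def octahedronPoint (f : Fin 4 ⊕ Bool → ℝ) : EuclideanSpace ℝ (Fin 3) :=
  !₂[f (.inl 0) - f (.inl 2), f (.inl 1) - f (.inl 3), f (.inr true) - f (.inr false)]

theorem continuous_octahedronFun : Continuous octahedronFun := by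
  refine continuous_pi fun x => ?_
  rcases x with k | s
  · fin_cases k <;> simp only [octahedronFun] <;> fun_prop
  · cases s <;> simp only [octahedronFun] <;> fun_prop

theorem continuous_octahedronPoint : Continuous octahedronPoint := by
  unfold octahedronPoint
  refine (PiLp.continuous_toLp 2 _).comp (continuous_pi fun i => ?_)
  fin_cases i <;> simp <;> fun_prop

theorem octahedronPoint_octahedronFun (x : EuclideanSpace ℝ (Fin 3)) :
    octahedronPoint (octahedronFun x) = x := by
  ext i
  fin_cases i <;> simp [octahedronPoint, octahedronFun] <;> ring

/-- The points of the octahedron have absolute values of the coordinates with sum `1`, and are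
determined by their coordinates. -/
theorem octahedron_spec (f : Realization (bipyramid 0)) :
    |octahedronPoint f.1 0| + |octahedronPoint f.1 1| + |octahedronPoint f.1 2| = 1 ∧
      octahedronFun (octahedronPoint f.1) = f.1 := by
  obtain ⟨f, hf, F, ⟨⟨k, s⟩, hF⟩, h⟩ := f
  rw [mem_simplex_iff hF (by simp) (by simp) (by simp)] at h
  obtain ⟨h0, h1⟩ := h
  have a0 := hf (.inl 0)
  have a1 := hf (.inl 1)
  have a2 := hf (.inl 2)
  have a3 := hf (.inl 3)
  have a4 := hf (.inr true)
  have a5 := hf (.inr false)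
  have key : (f (.inl 0) = 0 ∨ f (.inl 2) = 0) ∧ (f (.inl 1) = 0 ∨ f (.inl 3) = 0) ∧
      (f (.inr true) = 0 ∨ f (.inr false) = 0) ∧
      f (.inl 0) + f (.inl 1) + f (.inl 2) + f (.inl 3) + f (.inr true) + f (.inr false) = 1 := by
    have b0 := h0 (.inl 0)
    have b1 := h0 (.inl 1)
    have b2 := h0 (.inl 2)
    have b3 := h0 (.inl 3)
    have b4 := h0 (.inr true)
    have b5 := h0 (.inr false)
    fin_cases k <;> cases s <;> simp at b0 b1 b2 b3 b4 b5 h1 <;>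
      simp [*] <;> linarith
  obtain ⟨k1, k2, k3, k4⟩ := key
  have habs : ∀ a b : ℝ, 0 ≤ a → 0 ≤ b → (a = 0 ∨ b = 0) → |a - b| = a + b := by
    rintro a b ha hb (rfl | rfl)
    · simp [abs_of_nonneg hb]
    · simp [abs_of_nonneg ha]
  have c1 := habs _ _ a0 a2 k1
  have c2 := habs _ _ a1 a3 k2
  have c3 := habs _ _ a4 a5 k3
  constructor
  · simp [octahedronPoint, c1, c2, c3]; linarith
  · funext x
    rcases x with k | s
    · fin_cases k <;> simp [octahedronFun, octahedronPoint, c1, c2]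
    · cases s <;> simp [octahedronFun, octahedronPoint, c3]

theorem octahedronFun_mem (x : EuclideanSpace ℝ (Fin 3)) (hx : |x 0| + |x 1| + |x 2| = 1) :
    (∀ v, 0 ≤ octahedronFun x v) ∧ ∃ F ∈ bipyramid 0, (∀ v, v ∉ F → octahedronFun x v = 0) ∧
      ∑ v ∈ F, octahedronFun x v = 1 := by
  have e0 := neg_abs_le (x 0)
  have e1 := neg_abs_le (x 1)
  have e2 := neg_abs_le (x 2)
  have f0 := le_abs_self (x 0)
  have f1 := le_abs_self (x 1)
  have f2 := le_abs_self (x 2)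
  constructor
  · rintro (k | s)
    · fin_cases k <;> simp only [octahedronFun] <;> linarith
    · cases s <;> simp only [octahedronFun] <;> linarith
  · have key : ∀ (k : Fin 4) (s : Bool), (∀ v, v ≠ Sum.inl k → v ≠ Sum.inl (k + 1) → v ≠ Sum.inr s →
        octahedronFun x v = 0) → octahedronFun x (.inl k) + octahedronFun x (.inl (k + 1)) +
        octahedronFun x (.inr s) = 1 → ∃ F ∈ bipyramid 0, (∀ v, v ∉ F → octahedronFun x v = 0) ∧
        ∑ v ∈ F, octahedronFun x v = 1 := by
      intro k s h h'
      obtain ⟨F, hF⟩ := exists_finset_coe (Sum.inl k : Fin 4 ⊕ Bool) (.inl (k + 1)) (.inr s)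
      exact ⟨F, ⟨(k, s), hF⟩, (mem_simplex_iff hF (by simp) (by simp) (by simp) _).2
        ⟨h, h'⟩⟩
    have hall : ∀ P : Fin 4 ⊕ Bool → Prop, P (.inl 0) → P (.inl 1) → P (.inl 2) → P (.inl 3) →
        P (.inr true) → P (.inr false) → ∀ v, P v := by
      rintro P p0 p1 p2 p3 p4 p5 (k | s)
      · fin_cases k <;> assumption
      · cases s <;> assumption
    rcases le_total 0 (x 0) with h0 | h0 <;> rcases le_total 0 (x 1) with h1 | h1 <;>
      rcases le_total 0 (x 2) with h2 | h2 <;>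
      simp only [abs_of_nonneg, abs_of_nonpos, h0, h1, h2] at hx
    · refine key 0 true (hall _ ?_ ?_ ?_ ?_ ?_ ?_) ?_ <;>
        simp [octahedronFun, abs_of_nonneg, h0, h1, h2]
      linarith
    · refine key 0 false (hall _ ?_ ?_ ?_ ?_ ?_ ?_) ?_ <;>
        simp [octahedronFun, abs_of_nonneg, abs_of_nonpos, h0, h1, h2]
      linarith
    · refine key 3 true (hall _ ?_ ?_ ?_ ?_ ?_ ?_) ?_ <;>
        simp [octahedronFun, abs_of_nonneg, abs_of_nonpos, h0, h1, h2]
      linarith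
    · refine key 3 false (hall _ ?_ ?_ ?_ ?_ ?_ ?_) ?_ <;>
        simp [octahedronFun, abs_of_nonneg, abs_of_nonpos, h0, h1, h2]
      linarith
    · refine key 1 true (hall _ ?_ ?_ ?_ ?_ ?_ ?_) ?_ <;>
        simp [octahedronFun, abs_of_nonneg, abs_of_nonpos, h0, h1, h2]
      linarith
    · refine key 1 false (hall _ ?_ ?_ ?_ ?_ ?_ ?_) ?_ <;>
        simp [octahedronFun, abs_of_nonneg, abs_of_nonpos, h0, h1, h2]
      linarith
    · refine key 2 true (hall _ ?_ ?_ ?_ ?_ ?_ ?_) ?_ <;>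
        simp [octahedronFun, abs_of_nonneg, abs_of_nonpos, h0, h1, h2]
      linarith
    · refine key 2 false (hall _ ?_ ?_ ?_ ?_ ?_ ?_) ?_ <;>
        simp [octahedronFun, abs_of_nonpos, h0, h1, h2]
      linarith

theorem octahedron_triangulates :
    Triangulates (bipyramid 0) (Metric.sphere (0 : EuclideanSpace ℝ (Fin 3)) 1) := by
  let N : EuclideanSpace ℝ (Fin 3) → ℝ := fun x => |x 0| + |x 1| + |x 2|
  have hN : Continuous N := by fun_prop
  have hN0 : ∀ x, 0 ≤ N x := fun x => by positivity
  have hNsmul : ∀ (t : ℝ) x, 0 ≤ t → N (t • x) = t * N x := fun t x ht => by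
    simp only [N, PiLp.smul_apply, smul_eq_mul, abs_mul, abs_of_nonneg ht]; ring
  have hNne : ∀ x : Metric.sphere (0 : EuclideanSpace ℝ (Fin 3)) 1, N x.1 ≠ 0 := by
    rintro ⟨x, hx⟩ h
    have hx0 : x = 0 := by
      have h0 : |x 0| = 0 ∧ |x 1| = 0 ∧ |x 2| = 0 := by
        have := abs_nonneg (x 0)
        have := abs_nonneg (x 1)
        have := abs_nonneg (x 2)
        simp only [N] at h
        refine ⟨?_, ?_, ?_⟩ <;> linarith
      simp only [abs_eq_zero] at h0
      ext i
      fin_cases i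
      exacts [h0.1, h0.2.1, h0.2.2]
    simp [hx0] at hx
  have hne : ∀ f : Realization (bipyramid 0), ‖octahedronPoint f.1‖ ≠ 0 := by
    intro f h
    have := (octahedron_spec f).1
    rw [norm_eq_zero] at h
    simp [h] at this
  refine ⟨{
    toFun := fun f => ⟨‖octahedronPoint f.1‖⁻¹ • octahedronPoint f.1, ?_⟩
    invFun := fun x => ⟨octahedronFun ((N x.1)⁻¹ • x.1), octahedronFun_mem _ ?_⟩
    left_inv := fun f => Subtype.ext ?_
    right_inv := fun x => Subtype.ext ?_
    continuous_toFun := ?_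
    continuous_invFun := ?_ }⟩
  · rw [mem_sphere_zero_iff_norm, norm_smul, norm_inv, norm_norm, inv_mul_cancel₀ (hne f)]
  · have := hNsmul (N x.1)⁻¹ x.1 (inv_nonneg.2 (hN0 _))
    rw [inv_mul_cancel₀ (hNne x)] at this
    exact this
  · have hs := octahedron_spec f
    have h1 : N (octahedronPoint f.1) = 1 := hs.1
    simp only [hNsmul _ _ (inv_nonneg.2 (norm_nonneg _)), h1, mul_one, inv_inv, smul_smul,
      mul_inv_cancel₀ (hne f), one_smul]
    exact hs.2
  · have hx : ‖x.1‖ = 1 := by simp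
    simp only [octahedronPoint_octahedronFun, norm_smul, norm_inv, Real.norm_eq_abs,
      abs_of_nonneg (hN0 _), hx, mul_one, inv_inv, smul_smul, mul_inv_cancel₀ (hNne x), one_smul]
  · have hc : Continuous fun f : Realization (bipyramid 0) => octahedronPoint f.1 :=
      continuous_octahedronPoint.comp continuous_subtype_val
    exact ((hc.norm.inv₀ hne).smul hc).subtype_mk _
  · have hc : Continuous
        fun x : Metric.sphere (0 : EuclideanSpace ℝ (Fin 3)) 1 => (N x.1)⁻¹ • x.1 :=
      ((hN.comp continuous_subtype_val).inv₀ hNne).smul continuous_subtype_val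
    exact (continuous_octahedronFun.comp hc).subtype_mk _

/-- The bipyramid over a polygon with `n` vertices, with the vertices of the polygon in `ℕ`. -/
def natBipyramid (n : ℕ) : Set (Finset (ℕ ⊕ Bool)) :=
  {F | (∃ k s, k + 1 < n ∧ (F : Set (ℕ ⊕ Bool)) = {Sum.inl k, Sum.inl (k + 1), Sum.inr s}) ∨
    ∃ s, (F : Set (ℕ ⊕ Bool)) = {Sum.inl (n - 1), Sum.inl 0, Sum.inr s}}

theorem natBipyramid_succ (n : ℕ) (hn : 4 ≤ n) :
    Nonempty (Realization (natBipyramid n) ≃ₜ Realization (natBipyramid (n + 1))) := by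
  refine realization_subdivide (R := {F | ∃ k s, k + 1 < n ∧
    (F : Set (ℕ ⊕ Bool)) = {Sum.inl k, Sum.inl (k + 1), Sum.inr s}}) (b := Sum.inl (n - 1))
    (c := Sum.inl 0) (m := Sum.inl n) (p := Sum.inr true) (q := Sum.inr false)
    ?_ ?_ ?_ ?_ ?_ ?_ ?_ ?_ ?_ ?_ ?_ ?_ ?_
  any_goals simp
  any_goals omega
  · rintro F k hk hF h1 h2
    rcases hF with hF | hF <;> rw [← Finset.mem_coe, hF] at h1 h2 <;> simp at h1 h2 <;> omega
  · rintro F k hk hF h1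
    rcases hF with hF | hF <;> rw [← Finset.mem_coe, hF] at h1 <;> simp at h1 <;> omega
  · intro F
    simp [natBipyramid, or_comm]
  · intro F
    obtain ⟨j, rfl⟩ : ∃ j, n = j + 1 := ⟨n - 1, by omega⟩
    simp only [natBipyramid, Set.mem_ofPred_eq, Bool.exists_bool, add_tsub_cancel_right,
      ← and_or_left, Set.insert_comm (Sum.inl (j + 1)) (Sum.inl j)]
    constructor
    · rintro (⟨k, hk, h⟩ | h)
      · rcases Nat.lt_succ_iff_lt_or_eq.1 (Nat.lt_of_add_lt_add_right hk) with hk | rfl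
        · exact .inl ⟨k, by omega, h⟩
        · tauto
      · tauto
    · have hj : j + 1 < j + 1 + 1 := by omega
      rintro (⟨k, hk, h⟩ | h | h | h | h)
      · exact .inl ⟨k, by omega, h⟩
      · exact .inl ⟨j, hj, .inr h⟩
      · exact .inr (.inr h)
      · exact .inl ⟨j, hj, .inl h⟩
      · exact .inr (.inl h)

theorem bipyramid_realization (m : ℕ) :
    Nonempty (Realization (bipyramid m) ≃ₜ Realization (natBipyramid (m + 4))) := by
  refine realization_map (Sum.map Fin.val id) (Fin.val_injective.sumMap Function.injective_id) ?_
  intro F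
  have himage : ∀ (k : Fin (m + 4)) (s : Bool) (G : Finset (Fin (m + 4) ⊕ Bool)),
      (G : Set (Fin (m + 4) ⊕ Bool)) = {Sum.inl k, Sum.inl (k + 1), Sum.inr s} →
      Sum.map Fin.val id '' (G : Set (Fin (m + 4) ⊕ Bool)) =
        ({Sum.inl k.val, Sum.inl (k + 1).val, Sum.inr s} : Set (ℕ ⊕ Bool)) := by
    intro k s G hG
    rw [hG]; simp [Set.image_insert_eq]
  constructor
  · rintro (⟨k, s, hk, hF⟩ | ⟨s, hF⟩)
    · obtain ⟨G, hG⟩ := exists_finset_coe (Sum.inl ⟨k, by omega⟩ : Fin (m + 4) ⊕ Bool)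
        (Sum.inl (⟨k, by omega⟩ + 1)) (Sum.inr s)
      refine ⟨G, ⟨(_, s), hG⟩, ?_⟩
      rw [himage _ s G hG, hF, val_add_one, if_neg (by simp; omega)]
    · obtain ⟨G, hG⟩ := exists_finset_coe (Sum.inl ⟨m + 3, by omega⟩ : Fin (m + 4) ⊕ Bool)
        (Sum.inl (⟨m + 3, by omega⟩ + 1)) (Sum.inr s)
      refine ⟨G, ⟨(_, s), hG⟩, ?_⟩
      rw [himage _ s G hG, hF, val_add_one, if_pos rfl]
      rfl
  · rintro ⟨G, ⟨⟨k, s⟩, hG⟩, hF⟩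
    rw [himage k s G hG, val_add_one] at hF
    by_cases hk : (k : ℕ) = m + 3
    · refine .inr ⟨s, ?_⟩
      rw [hF, if_pos hk, hk]; rfl
    · refine .inl ⟨k, s, by omega, ?_⟩
      rw [hF, if_neg hk]

theorem bipyramid_triangulates (m : ℕ) :
    Triangulates (bipyramid m) (Metric.sphere (0 : EuclideanSpace ℝ (Fin 3)) 1) := by
  have h : Nonempty (Realization (natBipyramid 4) ≃ₜ Realization (natBipyramid (m + 4))) := by
    induction m with
    | zero => exact ⟨Homeomorph.refl _⟩
    | succ m ih =>
      obtain ⟨e⟩ := ih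
      obtain ⟨e'⟩ := natBipyramid_succ (m + 4) (by omega)
      exact ⟨e.trans (by rw [show m + 1 + 4 = m + 4 + 1 by omega]; exact e')⟩
  obtain ⟨e⟩ := h
  obtain ⟨a⟩ := bipyramid_realization 0
  obtain ⟨b⟩ := bipyramid_realization m
  obtain ⟨c⟩ := octahedron_triangulates
  exact ⟨b.trans (e.symm.trans (a.symm.trans c))⟩

theorem bipyramid_isSpherical (m : ℕ) :
    IsSphericalZHomogeneous (bipyramid m) (bipyramidFlags m).zigzags :=
  ⟨FlagSystem.isZHomogeneous (bipyramidFlags_isConnected m), bipyramid_triangulates m⟩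

end Sphere

/-! ### The connected sum with a bipyramid -/

/-- The special homeomorphism which preserves the names of the vertices of the 4-gonal faces. -/
def SpecialHomeo.id : SpecialHomeo := ⟨Equiv.refl _, fun _ _ h => h⟩

open Classical in
/-- The neighbours across the directed edges after the connected sum with a bipyramid along the
directed edges of the flags `f₀` and `rot f₀`. -/
noncomputable def gluedOpp {X : Type w} (rot : Equiv.Perm X) (opp : X → X) (f₀ : X) (m : ℕ) :
    X ⊕ (Fin (m + 4) × Bool) → X ⊕ (Fin (m + 4) × Bool)
  | .inl f =>
    if f = f₀ then .inr (0, true) else if f = rot f₀ then .inr (1, true)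
    else if f = opp f₀ then .inr (0, false) else if f = opp (rot f₀) then .inr (1, false)
    else .inl (opp f)
  | .inr (k, s) =>
    if k = 0 then .inl (if s then f₀ else opp f₀)
    else if k = 1 then .inl (if s then rot f₀ else opp (rot f₀))
    else .inr (k, !s)

/-- Turning around centres in the connected sum with a bipyramid. -/
def gluedRot {X : Type w} (rot : Equiv.Perm X) (m : ℕ) :
    Equiv.Perm (X ⊕ (Fin (m + 4) × Bool)) :=
  rot.sumCongr (bipyramidFlags m).rot

theorem two_ne_zero' (m : ℕ) : (2 : Fin (m + 4)) ≠ 0 := fun h => by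
  have h := congrArg Fin.val h
  rw [val_two', Fin.val_zero] at h
  omega

theorem two_ne_one' (m : ℕ) : (2 : Fin (m + 4)) ≠ 1 := fun h => by
  have h := congrArg Fin.val h
  rw [val_two', val_one'] at h
  omega

namespace FlagSystem

section Marks

variable {V : Type u} {K : Set (Finset V)} {X : Type w} (p : FlagSystem K X) (f : X)

theorem rot_ne_opp : p.rot f ≠ p.opp f := fun h =>
  p.src_ne_tgt f (by rw [← p.src_opp, ← p.src_rot, h])

theorem opp_rot_ne : p.opp (p.rot f) ≠ f := fun h =>
  p.rot_ne_opp f (by rw [← p.opp_opp (p.rot f), h])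

theorem opp_rot_ne_opp : p.opp (p.rot f) ≠ p.opp f := fun h =>
  p.rot_ne f (by rw [← p.opp_opp (p.rot f), h, p.opp_opp])

/-- The special pair formed by the directed edges of two consecutive flags around a centre. One of
its sides consists of the faces of these two flags only. -/
noncomputable def pairAt {τ : Set (ℤ → V)} (hτ : ∀ x y, TypeII K τ x y ↔ p.Directed x y) :
    SpecialPair K τ where
  v₁ := p.src f
  v₂ := p.tgt f
  v₃ := p.tgt (p.rot f)
  typeII₁ := (hτ _ _).2 ⟨f, rfl, rfl⟩
  typeII₂ := (hτ _ _).2 ⟨p.rot f, p.src_rot f, rfl⟩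
  side F := open Classical in decide (F = p.face f ∨ F = p.face (p.rot f))
  side_eq := by
    have key : ∀ F ∈ K, ∀ G ∈ K, ∀ x, x ≠ p.src f → x ≠ p.tgt f → x ≠ p.tgt (p.rot f) →
        x ∈ F → p.tgt f ∈ G → x ∈ G → F = p.face f ∨ F = p.face (p.rot f) →
        G = p.face f ∨ G = p.face (p.rot f) := by
      intro F _ G hG x h1 h2 h3 hFx hG2 hGx hF
      have hx : x = p.ctr f := by
        rcases hF with rfl | rfl
        · rcases p.mem_face.1 hFx with h | h | h
          exacts [absurd h h1, absurd h h2, h]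
        · rw [mem_face, p.src_rot, p.ctr_rot] at hFx
          rcases hFx with h | h | h
          exacts [absurd h h2, absurd h h3, h]
      exact p.eq_of_tgt_ctr_mem hG hG2 (hx ▸ hGx)
    intro F hF G hG x h1 h2 h3 hF2 hFx hG2 hGx
    rw [decide_eq_decide]
    exact ⟨key F hF G hG x h1 h2 h3 hFx hG2 hGx, key G hG F hF x h1 h2 h3 hGx hF2 hFx⟩
  side_ne₁ := by
    have hne1 : p.face f ≠ p.face (p.rot f) := fun h => p.rot_ne f (p.face_injective h).symm
    have hne2 : p.face (p.opp f) ≠ p.face (p.rot f) := fun h =>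
      p.rot_ne_opp f (p.face_injective h).symm
    have hne3 : p.face (p.opp f) ≠ p.face f := fun h => p.opp_ne f (p.face_injective h)
    intro F hF G hG hne hF1 hF2 hG1 hG2
    rcases p.eq_of_src_tgt_mem hF hF1 hF2 with rfl | rfl <;>
      rcases p.eq_of_src_tgt_mem hG hG1 hG2 with rfl | rfl <;> simp_all
  side_ne₂ := by
    have hne1 : p.face f ≠ p.face (p.opp (p.rot f)) := fun h =>
      p.opp_rot_ne f (p.face_injective h).symm
    have hne2 : p.face (p.opp (p.rot f)) ≠ p.face (p.rot f) := fun h =>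
      p.opp_ne _ (p.face_injective h)
    intro F hF G hG hne hF1 hF2 hG1 hG2
    rw [← p.src_rot] at hF1 hG1
    rcases p.eq_of_src_tgt_mem hF hF1 hF2 with rfl | rfl <;>
      rcases p.eq_of_src_tgt_mem hG hG1 hG2 with rfl | rfl <;> simp_all [eq_comm]

end Marks

section Glue

variable {V : Type u} {K : Set (Finset V)} {X : Type w} (p : FlagSystem K X) (f₀ : X)
  {τ : Set (ℤ → V)} (hτ : ∀ x y, TypeII K τ x y ↔ p.Directed x y) (m : ℕ)

/-- The vertices of the connected sum with a bipyramid. -/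
abbrev GlueVertex : Type u :=
  SumVertex (p.pairAt f₀ hτ) (bipyramidPair m) SpecialHomeo.id

/-- The faces of the connected sum with a bipyramid. -/
abbrev glueFaces : Set (Finset (p.GlueVertex f₀ hτ m)) :=
  sumFaces (p.pairAt f₀ hτ) (bipyramidPair m) SpecialHomeo.id

/-- The code of a vertex of the polygon of the bipyramid, as a vertex of a face with apex `s`. -/
def rimCode {m : ℕ} (k : Fin (m + 4)) (s : Bool) : V ⊕ ℕ :=
  if k = 0 then .inl (p.src f₀)
  else if k = 1 then (if s then .inr 1 else .inl (p.tgt f₀))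
  else if k = 2 then .inl (p.tgt (p.rot f₀)) else .inr k

/-- The code of an apex of the bipyramid. -/
def apexCode (s : Bool) : V ⊕ ℕ := .inr (if s then 0 else 2)

/-- A code for the vertices of the connected sum with a bipyramid: a vertex of the bipyramid
which is not in the special pair is given by a number. The copy of the middle of the special pair
which is contained in precisely two of the old faces has code `1`, the other copy keeps its name. -/
noncomputable def code : p.GlueVertex f₀ hτ m → V ⊕ ℕ :=
  Quot.lift
    (Sum.elim
      (Sum.elim (fun x => .inl x.1) fun δ => if δ then .inr 1 else .inl (p.tgt f₀))
      (Sum.elim (fun x => Sum.elim (fun k => p.rimCode f₀ k true) apexCode x.1)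
        fun δ => if δ then .inr 1 else .inl (p.tgt f₀)))
    (by
      rintro a b ⟨q, rfl, rfl⟩
      cases q
      · simp [quad, SpecialHomeo.id, pairAt, bipyramidPair, rimCode]
      · simp [quad, SpecialHomeo.id]
      · simp [quad, SpecialHomeo.id, pairAt, bipyramidPair, rimCode, two_ne_zero', two_ne_one'])

/-- The inverse of `code`. -/
noncomputable def decode : V ⊕ ℕ → p.GlueVertex f₀ hτ m
  | .inl x => open Classical in
    if h : x = p.tgt f₀ then Quot.mk _ (.inl (.inr false)) else Quot.mk _ (.inl (.inl ⟨x, h⟩))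
  | .inr k =>
    if k = 0 then Quot.mk _ (.inr (.inl ⟨.inr true, Sum.inr_ne_inl⟩))
    else if k = 2 then Quot.mk _ (.inr (.inl ⟨.inr false, Sum.inr_ne_inl⟩))
    else if h : 3 ≤ k ∧ k < m + 4 then
      Quot.mk _ (.inr (.inl ⟨.inl ⟨k, h.2⟩, by
        simp only [bipyramidPair, ne_eq, Sum.inl.injEq, Fin.ext_iff, val_one']; omega⟩))
    else Quot.mk _ (.inl (.inr true))

theorem glue_sound (q : QuadVertex) : (Quot.mk _ (.inr (quad (bipyramidPair m) q)) :
    p.GlueVertex f₀ hτ m) = Quot.mk _ (.inl (quad (p.pairAt f₀ hτ) q)) :=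
  (Quot.sound ⟨q, rfl, rfl⟩).symm

theorem decode_code (x : p.GlueVertex f₀ hτ m) :
    p.decode f₀ hτ m (p.code f₀ hτ m x) = x := by
  induction x using Quot.ind with
  | mk x =>
  rcases x with (⟨x, hx⟩ | δ) | (⟨k | s, hk⟩ | δ)
  · have hx' : x ≠ p.tgt f₀ := hx
    simp [code, decode, hx']
  · cases δ <;> simp [code, decode]
  · have hk1 : k ≠ 1 := fun h => hk (by rw [h]; rfl)
    by_cases h0 : k = 0
    · subst h0
      refine Eq.trans ?_ (p.glue_sound f₀ hτ m .first).symm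
      simp [code, decode, rimCode, pairAt, p.src_ne_tgt]
      rfl
    · by_cases h2 : k = 2
      · subst h2
        refine Eq.trans ?_ (p.glue_sound f₀ hτ m .last).symm
        have : p.tgt (p.rot f₀) ≠ p.tgt f₀ := fun h =>
          p.src_ne_tgt (p.rot f₀) (by rw [p.src_rot, h])
        simp [code, decode, rimCode, h0, hk1, this]
        rfl
      · have h3 : 3 ≤ (k : ℕ) := by
          have h0' : (k : ℕ) ≠ 0 := fun h => h0 (Fin.ext h)
          have h1' : (k : ℕ) ≠ 1 := fun h => hk1 (Fin.ext (by rw [h, val_one']))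
          have h2' : (k : ℕ) ≠ 2 := fun h => h2 (Fin.ext (by rw [h, val_two']))
          omega
        have h3' : (k : ℕ) ≠ 0 ∧ (k : ℕ) ≠ 2 := by omega
        simp [code, decode, rimCode, h0, h2, hk1, h3, h3']
  · cases s <;> simp [code, decode, apexCode]
  · refine Eq.trans ?_ (p.glue_sound f₀ hτ m (.mid δ)).symm
    cases δ <;> simp [code, decode] <;> rfl

theorem code_injective : Function.Injective (p.code f₀ hτ m) :=
  Function.LeftInverse.injective (p.decode_code f₀ hτ m)

/-- The beginning of the directed edge of a flag of the connected sum. -/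
noncomputable def glueSrc : X ⊕ (Fin (m + 4) × Bool) → p.GlueVertex f₀ hτ m
  | .inl f => inLeft _ _ _ (p.face f) (p.src f)
  | .inr h => inRight _ _ _ ((bipyramidFlags m).face h) ((bipyramidFlags m).src h)

/-- The end of the directed edge of a flag of the connected sum. -/
noncomputable def glueTgt : X ⊕ (Fin (m + 4) × Bool) → p.GlueVertex f₀ hτ m
  | .inl f => inLeft _ _ _ (p.face f) (p.tgt f)
  | .inr h => inRight _ _ _ ((bipyramidFlags m).face h) ((bipyramidFlags m).tgt h)

/-- The centre of a flag of the connected sum. -/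
noncomputable def glueCtr : X ⊕ (Fin (m + 4) × Bool) → p.GlueVertex f₀ hτ m
  | .inl f => inLeft _ _ _ (p.face f) (p.ctr f)
  | .inr h => inRight _ _ _ ((bipyramidFlags m).face h) ((bipyramidFlags m).ctr h)

open Classical in
theorem code_inLeft (f : X) (x : V) : p.code f₀ hτ m (inLeft _ _ _ (p.face f) x) =
    if x = p.tgt f₀ ∧ (f = f₀ ∨ f = p.rot f₀) then .inr 1 else .inl x := by
  by_cases hx : x = p.tgt f₀
  · simp only [inLeft, cut, pairAt, hx, code, dif_pos, p.face_injective.eq_iff, Sum.elim_inl,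
      Sum.elim_inr, decide_eq_true_eq, true_and]
  · simp [inLeft, cut, pairAt, hx, code]

theorem code_inRight_inl (k j : Fin (m + 4)) (s : Bool) :
    p.code f₀ hτ m (inRight _ _ _ ((bipyramidFlags m).face (k, s)) (.inl j)) =
      p.rimCode f₀ j s := by
  by_cases hj : j = 1
  · subst hj
    have h1 : (1 : Fin (m + 4)) ≠ 0 := by simp
    cases s <;> simp [inRight, cut, bipyramidPair, code, rimCode, inr_mem_bipyramid_face]
  · have : (Sum.inl j : Fin (m + 4) ⊕ Bool) ≠ (bipyramidPair m).v₂ := by simpa [bipyramidPair]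
    simp [inRight, cut, this, code, rimCode, hj]

theorem code_inRight_inr (k : Fin (m + 4)) (s t : Bool) :
    p.code f₀ hτ m (inRight _ _ _ ((bipyramidFlags m).face (k, s)) (.inr t)) = apexCode t := by
  have : (Sum.inr t : Fin (m + 4) ⊕ Bool) ≠ (bipyramidPair m).v₂ := by simp [bipyramidPair]
  simp [inRight, cut, this, code]

open Classical in
theorem code_glueSrc_inl (f : X) : p.code f₀ hτ m (p.glueSrc f₀ hτ m (.inl f)) =
    if f = p.rot f₀ then .inr 1 else .inl (p.src f) := by
  rw [glueSrc, code_inLeft]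
  refine if_congr ⟨?_, ?_⟩ rfl rfl
  · rintro ⟨h, rfl | rfl⟩
    · exact absurd h (p.src_ne_tgt _)
    · rfl
  · rintro rfl
    exact ⟨p.src_rot _, .inr rfl⟩

open Classical in
theorem code_glueTgt_inl (f : X) : p.code f₀ hτ m (p.glueTgt f₀ hτ m (.inl f)) =
    if f = f₀ then .inr 1 else .inl (p.tgt f) := by
  rw [glueTgt, code_inLeft]
  refine if_congr ⟨?_, ?_⟩ rfl rfl
  · rintro ⟨h, rfl | rfl⟩
    · rfl
    · exact absurd (by rw [p.src_rot, h]) (p.src_ne_tgt (p.rot f₀))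
  · rintro rfl
    exact ⟨rfl, .inl rfl⟩

theorem code_glueCtr_inl (f : X) :
    p.code f₀ hτ m (p.glueCtr f₀ hτ m (.inl f)) = .inl (p.ctr f) := by
  rw [glueCtr, code_inLeft, if_neg]
  exact fun h => p.ctr_ne_tgt _ _ h.1

theorem code_glueSrc_inr (k : Fin (m + 4)) (s : Bool) :
    p.code f₀ hτ m (p.glueSrc f₀ hτ m (.inr (k, s))) = p.rimCode f₀ k s :=
  p.code_inRight_inl _ _ _ _ _ _

theorem code_glueTgt_inr (k : Fin (m + 4)) (s : Bool) :
    p.code f₀ hτ m (p.glueTgt f₀ hτ m (.inr (k, s))) = p.rimCode f₀ (k + 1) s :=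
  p.code_inRight_inl _ _ _ _ _ _

theorem code_glueCtr_inr (k : Fin (m + 4)) (s : Bool) :
    p.code f₀ hτ m (p.glueCtr f₀ hτ m (.inr (k, s))) = apexCode s :=
  p.code_inRight_inr _ _ _ _ _ _

end Glue

end FlagSystem

namespace FlagSystem

/-! ### The flag system of the connected sum with a bipyramid -/

section RimCode

variable {V : Type u} {K : Set (Finset V)} {X : Type w} (p : FlagSystem K X) (f₀ : X) {m : ℕ}

theorem src_ne_tgt_rot (f : X) : p.src f ≠ p.tgt (p.rot f) := fun h =>
  p.asymm _ _ h (p.src_rot f).symm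

theorem tgt_ne_tgt_rot (f : X) : p.tgt f ≠ p.tgt (p.rot f) := by
  rw [← p.src_rot]; exact p.src_ne_tgt _

theorem rimCode_zero (s : Bool) : p.rimCode f₀ (0 : Fin (m + 4)) s = .inl (p.src f₀) := by
  simp [rimCode]

theorem rimCode_one (s : Bool) :
    p.rimCode f₀ (1 : Fin (m + 4)) s = if s then .inr 1 else .inl (p.tgt f₀) := by
  simp [rimCode]

theorem rimCode_two (s : Bool) :
    p.rimCode f₀ (2 : Fin (m + 4)) s = .inl (p.tgt (p.rot f₀)) := by
  simp [rimCode, two_ne_zero', two_ne_one']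

theorem rimCode_of_three_le {k : Fin (m + 4)} (hk : 3 ≤ (k : ℕ)) (s : Bool) :
    p.rimCode f₀ k s = .inr (k : ℕ) := by
  have h0 : k ≠ 0 := by rintro rfl; simp at hk
  have h1 : k ≠ 1 := by rintro rfl; simp at hk
  have h2 : k ≠ 2 := by rintro rfl; rw [val_two'] at hk; omega
  simp [rimCode, h0, h1, h2]

theorem rim_cases (k : Fin (m + 4)) : k = 0 ∨ k = 1 ∨ k = 2 ∨ 3 ≤ (k : ℕ) := by
  by_contra! h
  have h0 : (k : ℕ) ≠ 0 := fun h' => h.1 (Fin.ext h')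
  have h1 : (k : ℕ) ≠ 1 := fun h' => h.2.1 (Fin.ext (by rw [h', val_one']))
  have h2 : (k : ℕ) ≠ 2 := fun h' => h.2.2.1 (Fin.ext (by rw [h', val_two']))
  omega

theorem one_add_one' : (1 : Fin (m + 4)) + 1 = 2 := by
  ext; rw [val_add_one, val_one', val_two', if_neg (by omega)]

theorem two_add_one_val : 3 ≤ (((2 : Fin (m + 4)) + 1 : Fin (m + 4)) : ℕ) := by
  rw [val_add_one, val_two', if_neg (by omega)]

theorem rimCode_inj {k l : Fin (m + 4)} {s t : Bool}
    (h : p.rimCode f₀ k s = p.rimCode f₀ l t) : k = l := by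
  have h1 := p.src_ne_tgt f₀
  have h2 := p.src_ne_tgt_rot f₀
  have h3 := p.tgt_ne_tgt_rot f₀
  have key : ∀ (k : Fin (m + 4)) s,
      (k = 0 ∧ p.rimCode f₀ k s = .inl (p.src f₀)) ∨
      (k = 1 ∧ (p.rimCode f₀ k s = .inr 1 ∨ p.rimCode f₀ k s = .inl (p.tgt f₀))) ∨
      (k = 2 ∧ p.rimCode f₀ k s = .inl (p.tgt (p.rot f₀))) ∨
      (3 ≤ (k : ℕ) ∧ p.rimCode f₀ k s = .inr (k : ℕ)) := by
    intro k s
    rcases rim_cases k with rfl | rfl | rfl | hk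
    · exact .inl ⟨rfl, p.rimCode_zero f₀ s⟩
    · refine .inr (.inl ⟨rfl, ?_⟩)
      rw [rimCode_one]
      cases s <;> simp
    · exact .inr (.inr (.inl ⟨rfl, p.rimCode_two f₀ s⟩))
    · exact .inr (.inr (.inr ⟨hk, p.rimCode_of_three_le f₀ hk s⟩))
  have hk := key k s
  have hl := key l t
  rw [h] at hk
  rw [Fin.ext_iff]
  grind

theorem rimCode_one_inj {s t : Bool}
    (h : p.rimCode f₀ (1 : Fin (m + 4)) s = p.rimCode f₀ (1 : Fin (m + 4)) t) : s = t := by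
  cases s <;> cases t <;> simp_all [rimCode_one]

theorem rimCode_of_ne_one {k : Fin (m + 4)} (hk : k ≠ 1) (s t : Bool) :
    p.rimCode f₀ k s = p.rimCode f₀ k t := by
  simp [rimCode, hk]

theorem rimCode_ne_ctr (k : Fin (m + 4)) (s : Bool) (f : X) :
    p.rimCode f₀ k s ≠ .inl (p.ctr f) := by
  rcases rim_cases k with rfl | rfl | rfl | hk
  · rw [rimCode_zero]; exact fun h => p.ctr_ne_src f f₀ (Sum.inl.inj h).symm
  · rw [rimCode_one]
    cases s
    · exact fun h => p.ctr_ne_tgt f f₀ (Sum.inl.inj h).symm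
    · exact Sum.inr_ne_inl
  · rw [rimCode_two]; exact fun h => p.ctr_ne_tgt f _ (Sum.inl.inj h).symm
  · rw [rimCode_of_three_le _ _ hk]; exact Sum.inr_ne_inl

theorem rimCode_ne_apexCode (k : Fin (m + 4)) (s t : Bool) :
    p.rimCode f₀ k s ≠ apexCode t := by
  rcases rim_cases k with rfl | rfl | rfl | hk
  · rw [rimCode_zero]; exact Sum.inl_ne_inr
  · rw [rimCode_one]
    cases s <;> cases t <;> simp [apexCode]
  · rw [rimCode_two]; exact Sum.inl_ne_inr
  · rw [rimCode_of_three_le _ _ hk]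
    cases t
    · exact fun h => by have h : (k : ℕ) = 2 := Sum.inr.inj h; omega
    · exact fun h => by have h : (k : ℕ) = 0 := Sum.inr.inj h; omega

theorem apexCode_inj {s t : Bool} (h : (apexCode s : V ⊕ ℕ) = apexCode t) : s = t := by
  cases s <;> cases t <;> simp_all [apexCode]

end RimCode

section GluedOpp

variable {V : Type u} {K : Set (Finset V)} {X : Type w} (p : FlagSystem K X) (f₀ : X) (m : ℕ)

theorem gluedOpp_first : gluedOpp p.rot p.opp f₀ m (.inl f₀) = .inr (0, true) := by
  simp [gluedOpp]

theorem gluedOpp_second : gluedOpp p.rot p.opp f₀ m (.inl (p.rot f₀)) = .inr (1, true) := by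
  simp [gluedOpp, p.rot_ne]

theorem gluedOpp_opp_first :
    gluedOpp p.rot p.opp f₀ m (.inl (p.opp f₀)) = .inr (0, false) := by
  simp [gluedOpp, p.opp_ne, (p.rot_ne_opp f₀).symm]

theorem gluedOpp_opp_second :
    gluedOpp p.rot p.opp f₀ m (.inl (p.opp (p.rot f₀))) = .inr (1, false) := by
  simp [gluedOpp, p.opp_ne, p.opp_rot_ne, p.opp_rot_ne_opp]

theorem gluedOpp_of_ne {f : X} (h0 : f ≠ f₀) (h1 : f ≠ p.rot f₀) (h2 : f ≠ p.opp f₀)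
    (h3 : f ≠ p.opp (p.rot f₀)) : gluedOpp p.rot p.opp f₀ m (.inl f) = .inl (p.opp f) := by
  simp [gluedOpp, h0, h1, h2, h3]

theorem gluedOpp_zero (s : Bool) : gluedOpp p.rot p.opp f₀ m (.inr (0, s)) =
    .inl (if s then f₀ else p.opp f₀) := by
  simp [gluedOpp]

theorem gluedOpp_one (s : Bool) : gluedOpp p.rot p.opp f₀ m (.inr (1, s)) =
    .inl (if s then p.rot f₀ else p.opp (p.rot f₀)) := by
  simp [gluedOpp]

theorem gluedOpp_inr {k : Fin (m + 4)} (h0 : k ≠ 0) (h1 : k ≠ 1) (s : Bool) :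
    gluedOpp p.rot p.opp f₀ m (.inr (k, s)) = .inr (k, !s) := by
  simp [gluedOpp, h0, h1]

/-- A flag on which `gluedOpp` differs from `opp` is one of the four flags at the special pair. -/
theorem mark_cases (f : X) : f = f₀ ∨ f = p.rot f₀ ∨ f = p.opp f₀ ∨ f = p.opp (p.rot f₀) ∨
    (f ≠ f₀ ∧ f ≠ p.rot f₀ ∧ f ≠ p.opp f₀ ∧ f ≠ p.opp (p.rot f₀)) := by
  tauto

theorem gluedOpp_gluedOpp (x : X ⊕ (Fin (m + 4) × Bool)) :
    gluedOpp p.rot p.opp f₀ m (gluedOpp p.rot p.opp f₀ m x) = x := by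
  rcases x with f | ⟨k, s⟩
  · rcases p.mark_cases f₀ f with rfl | rfl | rfl | rfl | ⟨h0, h1, h2, h3⟩
    · rw [gluedOpp_first, gluedOpp_zero, if_pos rfl]
    · rw [gluedOpp_second, gluedOpp_one, if_pos rfl]
    · rw [gluedOpp_opp_first, gluedOpp_zero]; rfl
    · rw [gluedOpp_opp_second, gluedOpp_one]; rfl
    · rw [gluedOpp_of_ne _ _ _ h0 h1 h2 h3, gluedOpp_of_ne, p.opp_opp]
      · exact fun h => h2 (by rw [← h, p.opp_opp])
      · exact fun h => h3 (by rw [← h, p.opp_opp])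
      · exact fun h => h0 (by rw [← p.opp_opp f, h, p.opp_opp])
      · exact fun h => h1 (by rw [← p.opp_opp f, h, p.opp_opp])
  · by_cases h0 : k = 0
    · subst h0
      cases s
      · exact (congrArg _ (gluedOpp_zero _ _ _ _)).trans (gluedOpp_opp_first _ _ _)
      · exact (congrArg _ (gluedOpp_zero _ _ _ _)).trans (gluedOpp_first _ _ _)
    · by_cases h1 : k = 1
      · subst h1
        cases s
        · exact (congrArg _ (gluedOpp_one _ _ _ _)).trans (gluedOpp_opp_second _ _ _)
        · exact (congrArg _ (gluedOpp_one _ _ _ _)).trans (gluedOpp_second _ _ _)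
      · rw [gluedOpp_inr _ _ _ h0 h1, gluedOpp_inr _ _ _ h0 h1, Bool.not_not]

end GluedOpp

section GlueFlags

variable {V : Type u} {K : Set (Finset V)} {X : Type w} (p : FlagSystem K X) (f₀ : X)
  {τ : Set (ℤ → V)} (hτ : ∀ x y, TypeII K τ x y ↔ p.Directed x y) (m : ℕ)

theorem mem_glueFaces_iff (F : Finset (p.GlueVertex f₀ hτ m)) : F ∈ p.glueFaces f₀ hτ m ↔
    ∃ x, (F : Set (p.GlueVertex f₀ hτ m)) =
      {p.glueSrc f₀ hτ m x, p.glueTgt f₀ hτ m x, p.glueCtr f₀ hτ m x} := by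
  constructor
  · rintro (⟨A, hA, h⟩ | ⟨A, hA, h⟩)
    · obtain ⟨f, rfl⟩ := p.exists_face_eq hA
      refine ⟨.inl f, ?_⟩
      rw [h, coe_face, Set.image_insert_eq, Set.image_pair]
      rfl
    · obtain ⟨f, rfl⟩ := (bipyramidFlags m).exists_face_eq hA
      refine ⟨.inr f, ?_⟩
      rw [h, coe_face, Set.image_insert_eq, Set.image_pair]
      rfl
  · rintro ⟨f | f, h⟩
    · refine .inl ⟨p.face f, p.face_mem f, ?_⟩
      rw [h, coe_face, Set.image_insert_eq, Set.image_pair]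
      rfl
    · refine .inr ⟨(bipyramidFlags m).face f, (bipyramidFlags m).face_mem f, ?_⟩
      rw [h, coe_face, Set.image_insert_eq, Set.image_pair]
      rfl

theorem not_glue_antiparallel {f : X} {k : Fin (m + 4)} {s : Bool}
    (h : p.glueSrc f₀ hτ m (.inl f) = p.glueTgt f₀ hτ m (.inr (k, s)))
    (h' : p.glueTgt f₀ hτ m (.inl f) = p.glueSrc f₀ hτ m (.inr (k, s))) : False := by
  replace h := congrArg (p.code f₀ hτ m) h
  replace h' := congrArg (p.code f₀ hτ m) h'
  rw [code_glueSrc_inl, code_glueTgt_inr] at h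
  rw [code_glueTgt_inl, code_glueSrc_inr] at h'
  have a1 := p.src_ne_tgt_rot f₀
  have a2 := p.asymm f f₀
  have a3 := p.asymm f (p.rot f₀)
  rw [p.src_rot] at a3
  rcases rim_cases k with rfl | rfl | rfl | hk
  · rw [zero_add, rimCode_one] at h
    rw [rimCode_zero] at h'
    grind
  · rw [one_add_one', rimCode_two] at h
    rw [rimCode_one] at h'
    grind
  · rw [rimCode_of_three_le _ _ two_add_one_val] at h
    have := two_add_one_val (m := m)
    grind
  · rw [rimCode_of_three_le _ _ hk] at h'
    grind

theorem gluedOpp_of_parallel {f : X} {k : Fin (m + 4)} {s : Bool}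
    (h : p.glueSrc f₀ hτ m (.inl f) = p.glueSrc f₀ hτ m (.inr (k, s)))
    (h' : p.glueTgt f₀ hτ m (.inl f) = p.glueTgt f₀ hτ m (.inr (k, s))) :
    gluedOpp p.rot p.opp f₀ m (.inl f) = .inr (k, s) := by
  replace h := congrArg (p.code f₀ hτ m) h
  replace h' := congrArg (p.code f₀ hτ m) h'
  rw [code_glueSrc_inl, code_glueSrc_inr] at h
  rw [code_glueTgt_inl, code_glueTgt_inr] at h'
  rcases rim_cases k with rfl | rfl | rfl | hk
  · rw [zero_add, rimCode_one] at h'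
    rw [rimCode_zero] at h
    have a1 := p.eq_or_eq_opp f₀ f
    cases s
    · have : f = p.opp f₀ := by grind
      rw [this, gluedOpp_opp_first]
    · have : f = f₀ := by grind
      rw [this, gluedOpp_first]
  · rw [one_add_one', rimCode_two] at h'
    rw [rimCode_one] at h
    have a1 := p.eq_or_eq_opp (p.rot f₀) f
    rw [p.src_rot] at a1
    cases s
    · have : f = p.opp (p.rot f₀) := by grind
      rw [this, gluedOpp_opp_second]
    · have : f = p.rot f₀ := by grind
      rw [this, gluedOpp_second]
  · rw [rimCode_of_three_le _ _ two_add_one_val] at h'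
    have := two_add_one_val (m := m)
    grind
  · rw [rimCode_of_three_le _ _ hk] at h
    grind

theorem glue_src_opp (x : X ⊕ (Fin (m + 4) × Bool)) :
    p.glueSrc f₀ hτ m (gluedOpp p.rot p.opp f₀ m x) = p.glueSrc f₀ hτ m x := by
  apply p.code_injective f₀ hτ m
  rcases x with f | ⟨k, s⟩
  · rcases p.mark_cases f₀ f with rfl | rfl | rfl | rfl | ⟨h0, h1, h2, h3⟩
    · rw [gluedOpp_first, code_glueSrc_inr, code_glueSrc_inl, rimCode_zero,
        if_neg (p.rot_ne _).symm]
    · rw [gluedOpp_second, code_glueSrc_inr, code_glueSrc_inl, rimCode_one, if_pos rfl, if_pos rfl]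
    · rw [gluedOpp_opp_first, code_glueSrc_inr, code_glueSrc_inl, rimCode_zero,
        if_neg (p.rot_ne_opp _).symm, p.src_opp]
    · rw [gluedOpp_opp_second, code_glueSrc_inr, code_glueSrc_inl, rimCode_one,
        if_neg (p.opp_ne _), p.src_opp, p.src_rot]
      rfl
    · rw [gluedOpp_of_ne _ _ _ h0 h1 h2 h3, code_glueSrc_inl, code_glueSrc_inl, if_neg h1, if_neg,
        p.src_opp]
      exact fun h => h3 (by rw [← h, p.opp_opp])
  · rcases rim_cases k with rfl | rfl | hk
    · rw [gluedOpp_zero, code_glueSrc_inr, code_glueSrc_inl, rimCode_zero, if_neg]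
      · cases s <;> simp [p.src_opp]
      · cases s <;> simp [(p.rot_ne_opp _).symm, (p.rot_ne _).symm]
    · rw [gluedOpp_one, code_glueSrc_inr, code_glueSrc_inl, rimCode_one]
      cases s <;> simp [p.src_opp, p.src_rot, p.opp_ne]
    · have h0 : k ≠ 0 := by
        rcases hk with rfl | hk
        exacts [two_ne_zero' m, by rintro rfl; simp at hk]
      have h1 : k ≠ 1 := by
        rcases hk with rfl | hk; exacts [two_ne_one' m, by rintro rfl; simp at hk]
      rw [gluedOpp_inr _ _ _ h0 h1, code_glueSrc_inr, code_glueSrc_inr]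
      exact p.rimCode_of_ne_one _ h1 _ _

theorem glue_tgt_opp (x : X ⊕ (Fin (m + 4) × Bool)) :
    p.glueTgt f₀ hτ m (gluedOpp p.rot p.opp f₀ m x) = p.glueTgt f₀ hτ m x := by
  apply p.code_injective f₀ hτ m
  rcases x with f | ⟨k, s⟩
  · rcases p.mark_cases f₀ f with rfl | rfl | rfl | rfl | ⟨h0, h1, h2, h3⟩
    · rw [gluedOpp_first, code_glueTgt_inr, code_glueTgt_inl, zero_add, rimCode_one, if_pos rfl,
        if_pos rfl]
    · rw [gluedOpp_second, code_glueTgt_inr, code_glueTgt_inl, one_add_one', rimCode_two,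
        if_neg (p.rot_ne _)]
    · rw [gluedOpp_opp_first, code_glueTgt_inr, code_glueTgt_inl, zero_add, rimCode_one,
        if_neg (p.opp_ne _), p.tgt_opp]
      rfl
    · rw [gluedOpp_opp_second, code_glueTgt_inr, code_glueTgt_inl, one_add_one', rimCode_two,
        if_neg (p.opp_rot_ne _), p.tgt_opp]
    · rw [gluedOpp_of_ne _ _ _ h0 h1 h2 h3, code_glueTgt_inl, code_glueTgt_inl, if_neg h0, if_neg,
        p.tgt_opp]
      exact fun h => h2 (by rw [← h, p.opp_opp])
  · by_cases h0 : k = 0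
    · subst h0
      rw [gluedOpp_zero, code_glueTgt_inr, code_glueTgt_inl, zero_add, rimCode_one]
      cases s <;> simp [p.tgt_opp, p.opp_ne]
    · by_cases h1 : k = 1
      · subst h1
        rw [gluedOpp_one, code_glueTgt_inr, code_glueTgt_inl, one_add_one', rimCode_two, if_neg]
        · cases s <;> simp [p.tgt_opp]
        · cases s <;> simp [p.opp_rot_ne, p.rot_ne]
      · rw [gluedOpp_inr _ _ _ h0 h1, code_glueTgt_inr, code_glueTgt_inr]
        exact p.rimCode_of_ne_one _ (fun h => h0 (by simpa using h)) _ _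

theorem glue_ctr_opp_ne (x : X ⊕ (Fin (m + 4) × Bool)) :
    p.glueCtr f₀ hτ m (gluedOpp p.rot p.opp f₀ m x) ≠ p.glueCtr f₀ hτ m x := by
  intro h
  replace h := congrArg (p.code f₀ hτ m) h
  rcases x with f | ⟨k, s⟩
  · rcases p.mark_cases f₀ f with rfl | rfl | rfl | rfl | ⟨h0, h1, h2, h3⟩
    · rw [gluedOpp_first, code_glueCtr_inr, code_glueCtr_inl] at h
      exact Sum.inr_ne_inl h
    · rw [gluedOpp_second, code_glueCtr_inr, code_glueCtr_inl] at h
      exact Sum.inr_ne_inl h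
    · rw [gluedOpp_opp_first, code_glueCtr_inr, code_glueCtr_inl] at h
      exact Sum.inr_ne_inl h
    · rw [gluedOpp_opp_second, code_glueCtr_inr, code_glueCtr_inl] at h
      exact Sum.inr_ne_inl h
    · rw [gluedOpp_of_ne _ _ _ h0 h1 h2 h3, code_glueCtr_inl, code_glueCtr_inl] at h
      exact p.ctr_opp_ne f (Sum.inl.inj h)
  · by_cases h0 : k = 0
    · subst h0
      rw [gluedOpp_zero, code_glueCtr_inr, code_glueCtr_inl] at h
      exact Sum.inl_ne_inr h
    · by_cases h1 : k = 1
      · subst h1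
        rw [gluedOpp_one, code_glueCtr_inr, code_glueCtr_inl] at h
        exact Sum.inl_ne_inr h
      · rw [gluedOpp_inr _ _ _ h0 h1, code_glueCtr_inr, code_glueCtr_inr] at h
        have := apexCode_inj h
        simp at this

theorem glue_src_inj {f g : X}
    (h : p.glueSrc f₀ hτ m (.inl g) = p.glueSrc f₀ hτ m (.inl f)) :
    p.src g = p.src f ∧ (g = p.rot f₀ ↔ f = p.rot f₀) := by
  replace h := congrArg (p.code f₀ hτ m) h
  rw [code_glueSrc_inl, code_glueSrc_inl] at h
  grind

theorem glue_tgt_inj {f g : X}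
    (h : p.glueTgt f₀ hτ m (.inl g) = p.glueTgt f₀ hτ m (.inl f)) :
    p.tgt g = p.tgt f ∧ (g = f₀ ↔ f = f₀) := by
  replace h := congrArg (p.code f₀ hτ m) h
  rw [code_glueTgt_inl, code_glueTgt_inl] at h
  grind

theorem glue_src_rim_inj {k l : Fin (m + 4)} {s t : Bool}
    (h : p.glueSrc f₀ hτ m (.inr (l, t)) = p.glueSrc f₀ hτ m (.inr (k, s))) : l = k := by
  replace h := congrArg (p.code f₀ hτ m) h
  rw [code_glueSrc_inr, code_glueSrc_inr] at h
  exact p.rimCode_inj f₀ h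

/-- The flag system of the connected sum with a bipyramid. -/
noncomputable def glueFlags :
    FlagSystem (p.glueFaces f₀ hτ m) (X ⊕ (Fin (m + 4) × Bool)) where
  src := p.glueSrc f₀ hτ m
  tgt := p.glueTgt f₀ hτ m
  ctr := p.glueCtr f₀ hτ m
  rot := gluedRot p.rot m
  opp := gluedOpp p.rot p.opp f₀ m
  mem_iff := p.mem_glueFaces_iff f₀ hτ m
  src_rot x := by
    apply p.code_injective f₀ hτ m
    rcases x with f | ⟨k, s⟩
    · change p.code f₀ hτ m (p.glueSrc f₀ hτ m (.inl (p.rot f))) = _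
      rw [code_glueSrc_inl, code_glueTgt_inl, p.src_rot]
      by_cases h : f = f₀
      · rw [if_pos h, if_pos (by rw [h])]
      · rw [if_neg h, if_neg fun h' => h (p.rot.injective h')]
    · change p.code f₀ hτ m (p.glueSrc f₀ hτ m (.inr (k + 1, s))) = _
      rw [code_glueSrc_inr, code_glueTgt_inr]
  ctr_rot x := by
    apply p.code_injective f₀ hτ m
    rcases x with f | ⟨k, s⟩
    · change p.code f₀ hτ m (p.glueCtr f₀ hτ m (.inl (p.rot f))) = _
      rw [code_glueCtr_inl, code_glueCtr_inl, p.ctr_rot]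
    · change p.code f₀ hτ m (p.glueCtr f₀ hτ m (.inr (k + 1, s))) = _
      rw [code_glueCtr_inr, code_glueCtr_inr]
  src_opp := p.glue_src_opp f₀ hτ m
  tgt_opp := p.glue_tgt_opp f₀ hτ m
  opp_opp := p.gluedOpp_gluedOpp f₀ m
  ctr_opp_ne := p.glue_ctr_opp_ne f₀ hτ m
  ctr_ne_src x y h := by
    replace h := congrArg (p.code f₀ hτ m) h
    rcases x with f | ⟨k, s⟩ <;> rcases y with g | ⟨l, t⟩
    · rw [code_glueCtr_inl, code_glueSrc_inl] at h
      have := p.ctr_ne_src f g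
      grind
    · rw [code_glueCtr_inl, code_glueSrc_inr] at h
      exact p.rimCode_ne_ctr _ _ _ _ h.symm
    · rw [code_glueCtr_inr, code_glueSrc_inl] at h
      cases s <;> simp [apexCode] at h <;> grind
    · rw [code_glueCtr_inr, code_glueSrc_inr] at h
      exact p.rimCode_ne_apexCode _ _ _ _ h.symm
  asymm x y h h' := by
    rcases x with f | ⟨k, s⟩ <;> rcases y with g | ⟨l, t⟩
    · replace h := congrArg (p.code f₀ hτ m) h
      replace h' := congrArg (p.code f₀ hτ m) h'
      rw [code_glueSrc_inl, code_glueTgt_inl] at h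
      rw [code_glueSrc_inl, code_glueTgt_inl] at h'
      have := p.asymm f g
      have := p.rot_ne f₀
      have := p.src_ne_tgt_rot f₀
      grind
    · exact p.not_glue_antiparallel f₀ hτ m h h'
    · exact p.not_glue_antiparallel f₀ hτ m h'.symm h.symm
    · replace h := congrArg (p.code f₀ hτ m) h
      replace h' := congrArg (p.code f₀ hτ m) h'
      rw [code_glueSrc_inr, code_glueTgt_inr] at h
      rw [code_glueSrc_inr, code_glueTgt_inr] at h'
      have h1 := p.rimCode_inj f₀ h
      have h2 := p.rimCode_inj f₀ h'
      simp only [Fin.ext_iff, val_add_one] at h1 h2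
      grind
  eq_or_eq_opp x y h h' := by
    rcases x with f | ⟨k, s⟩ <;> rcases y with g | ⟨l, t⟩
    · have h1 := p.glue_src_inj f₀ hτ m h
      have h2 := p.glue_tgt_inj f₀ hτ m h'
      rcases p.eq_or_eq_opp f g h1.1 h2.1 with rfl | rfl
      · exact .inl rfl
      · refine .inr (p.gluedOpp_of_ne f₀ m ?_ ?_ ?_ ?_).symm
        · intro h; exact p.opp_ne f ((h2.2.2 h).trans h.symm)
        · intro h; exact p.opp_ne f ((h1.2.2 h).trans h.symm)
        · rintro rfl; exact p.opp_ne f₀ (h2.2.1 (p.opp_opp _))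
        · rintro rfl; exact p.opp_ne _ (h1.2.1 (p.opp_opp _))
    · exact .inr (p.gluedOpp_of_parallel f₀ hτ m h.symm h'.symm).symm
    · refine .inr ?_
      rw [← p.gluedOpp_of_parallel f₀ hτ m h h', p.gluedOpp_gluedOpp]
    · obtain rfl := p.glue_src_rim_inj f₀ hτ m h
      replace h := congrArg (p.code f₀ hτ m) h
      replace h' := congrArg (p.code f₀ hτ m) h'
      rw [code_glueSrc_inr, code_glueSrc_inr] at h
      rw [code_glueTgt_inr, code_glueTgt_inr] at h'
      by_cases h0 : l = 0
      · subst h0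
        rw [zero_add] at h'
        exact .inl (by rw [p.rimCode_one_inj f₀ h'])
      by_cases h1 : l = 1
      · subst h1
        exact .inl (by rw [p.rimCode_one_inj f₀ h])
      rw [gluedOpp_inr _ _ _ h0 h1]
      cases s <;> cases t <;> simp
  eq_of_src_ctr x y h h' := by
    rcases x with f | ⟨k, s⟩ <;> rcases y with g | ⟨l, t⟩
    · have h1 := p.glue_src_inj f₀ hτ m h
      replace h' := congrArg (p.code f₀ hτ m) h'
      rw [code_glueCtr_inl, code_glueCtr_inl] at h'
      rw [p.eq_of_src_ctr f g h1.1 (Sum.inl.inj h')]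
    · replace h' := congrArg (p.code f₀ hτ m) h'
      rw [code_glueCtr_inl, code_glueCtr_inr] at h'
      exact absurd h' Sum.inr_ne_inl
    · replace h' := congrArg (p.code f₀ hτ m) h'
      rw [code_glueCtr_inl, code_glueCtr_inr] at h'
      exact absurd h' Sum.inl_ne_inr
    · replace h' := congrArg (p.code f₀ hτ m) h'
      rw [code_glueCtr_inr, code_glueCtr_inr] at h'
      rw [p.glue_src_rim_inj f₀ hτ m h, apexCode_inj h']
  exists_flag x := by
    have hmid : ∀ δ : Bool, p.code f₀ hτ m (p.glueSrc f₀ hτ m (.inr (1, δ))) =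
        if δ then .inr 1 else .inl (p.tgt f₀) := fun δ => by
      rw [code_glueSrc_inr, rimCode_one]
    induction x using Quot.ind with
    | mk x =>
    rcases x with (⟨x, hx⟩ | δ) | (⟨k | s, hk⟩ | δ)
    · obtain ⟨f, rfl | rfl⟩ := p.exists_flag x
      · refine ⟨.inl f, .inl (p.code_injective f₀ hτ m ?_)⟩
        rw [code_glueSrc_inl, if_neg]
        · rfl
        · rintro rfl
          exact hx (p.src_rot _)
      · refine ⟨.inl f, .inr (p.code_injective f₀ hτ m ?_)⟩
        rw [code_glueCtr_inl]
        rfl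
    · exact ⟨.inr (1, δ), .inl (p.code_injective f₀ hτ m (hmid δ).symm)⟩
    · refine ⟨.inr (k, true), .inl (p.code_injective f₀ hτ m ?_)⟩
      rw [code_glueSrc_inr]
      rfl
    · refine ⟨.inr (0, s), .inr (p.code_injective f₀ hτ m ?_)⟩
      rw [code_glueCtr_inr]
      rfl
    · exact ⟨.inr (1, δ), .inl (p.code_injective f₀ hτ m (hmid δ).symm)⟩

end GlueFlags

end FlagSystem

/-! ### Connectedness and orientation of the connected sum with a bipyramid -/

namespace FlagSystem

section GlueConnected

variable {V : Type u} {K : Set (Finset V)} {X : Type w} (p : FlagSystem K X) (f₀ : X)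
  {τ : Set (ℤ → V)} (hτ : ∀ x y, TypeII K τ x y ↔ p.Directed x y) (m : ℕ)

/-- The flags around the vertex of the connected sum with code `Sum.inl x`, apart from those of the
bipyramid, correspond to the flags around `x`; the flag `rot f₀` moves to the other copy of the
middle of the special pair and is replaced by a flag of the bipyramid. -/
theorem glue_src_conn_inl (hp : p.IsConnected) :
    ∃ j : X → X ⊕ (Fin (m + 4) × Bool), (∀ f, f ≠ p.rot f₀ → j f = .inl f) ∧
      j (p.rot f₀) = .inr (1, false) ∧ ∀ f g, p.src f = p.src g → Relation.EqvGen
        (fun a b => b = (p.glueFlags f₀ hτ m).opp a ∨ b = (p.glueFlags f₀ hτ m).rot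
          ((p.glueFlags f₀ hτ m).opp ((p.glueFlags f₀ hτ m).rot.symm a))) (j f) (j g) := by
  classical
  set q := p.glueFlags f₀ hτ m with hq
  set E := Relation.EqvGen (fun a b => b = q.opp a ∨ b = q.rot (q.opp (q.rot.symm a))) with hE
  have hO : ∀ x, E x (q.opp x) := fun x => .rel _ _ (.inl rfl)
  have hN : ∀ x, E (q.rot x) (q.rot (q.opp x)) := fun x =>
    .rel _ _ (.inr (by rw [Equiv.symm_apply_apply]))
  have hO' : ∀ {x y}, q.opp x = y → E x y := fun h => h ▸ hO _
  have hN' : ∀ {x y x' y'}, q.opp x = y → q.rot x = x' → q.rot y = y' → E x' y' :=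
    fun h h1 h2 => h1 ▸ h2 ▸ h ▸ hN _
  have hri : ∀ f, q.rot (.inl f) = .inl (p.rot f) := fun f => rfl
  have hrr : ∀ k s, q.rot (.inr (k, s)) = .inr (k + 1, s) := fun k s => rfl
  have o0 : q.opp (.inl f₀) = .inr (0, true) := p.gluedOpp_first f₀ m
  have o1 : q.opp (.inl (p.rot f₀)) = .inr (1, true) := p.gluedOpp_second f₀ m
  have o2 : q.opp (.inl (p.opp f₀)) = .inr (0, false) := p.gluedOpp_opp_first f₀ m
  have o3 : q.opp (.inl (p.opp (p.rot f₀))) = .inr (1, false) := p.gluedOpp_opp_second f₀ m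
  have o4 : ∀ {a}, a ≠ f₀ → a ≠ p.rot f₀ → a ≠ p.opp f₀ → a ≠ p.opp (p.rot f₀) →
      q.opp (.inl a) = .inl (p.opp a) := fun h0 h1 h2 h3 => p.gluedOpp_of_ne f₀ m h0 h1 h2 h3
  have n0 : p.opp f₀ ≠ f₀ := p.opp_ne _
  have n1 := p.rot_ne f₀
  have n2 := p.rot_ne_opp f₀
  refine ⟨fun f => if f = p.rot f₀ then .inr (1, false) else .inl f, fun f hf => if_neg hf,
    if_pos rfl, fun f g hfg => ?_⟩
  have e0 : E (.inl f₀) (.inl (p.opp f₀)) := by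
    refine .trans _ _ _ (hO' o0) (.trans _ _ _ ?_ (.symm _ _ (hO' o2)))
    have hl : (Fin.last (m + 3) : Fin (m + 4)) + 1 = 0 := Fin.last_add_one _
    refine hN' (x := .inr (Fin.last (m + 3), true)) (y := .inr (Fin.last (m + 3), false)) ?_
      (by rw [hrr, hl]) (by rw [hrr, hl])
    have h0 : (Fin.last (m + 3) : Fin (m + 4)) ≠ 0 := fun h => by
      have := congrArg Fin.val h; simp at this
    have h1 : (Fin.last (m + 3) : Fin (m + 4)) ≠ 1 := fun h => by
      have := congrArg Fin.val h; rw [val_one'] at this; simp at this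
    exact p.gluedOpp_inr f₀ m h0 h1 true
  have e1 : E (.inl (p.rot (p.rot f₀))) (.inl (p.rot (p.opp (p.rot f₀)))) := by
    refine .trans _ (.inr (2, true)) _ (hN' o1 rfl (by rw [hrr, one_add_one'])) ?_
    refine .trans _ (.inr (2, false)) _ (hO' ?_)
      (.symm _ _ (hN' o3 rfl (by rw [hrr, one_add_one'])))
    exact p.gluedOpp_inr f₀ m (two_ne_zero' m) (two_ne_one' m) true
  rw [hE]
  refine eqvGen_map (fun f => if f = p.rot f₀ then Sum.inr (1, false) else Sum.inl f) ?_
    (hp.src_conn f g hfg)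
  intro a b hab
  rcases hab with rfl | rfl
  · rcases p.mark_cases f₀ a with rfl | rfl | rfl | rfl | ⟨h0, h1, h2, h3⟩
    · simpa only [if_neg n1.symm, if_neg n2.symm] using e0
    · simpa only [if_pos, if_neg (p.opp_ne _)] using .symm _ _ (hO' o3)
    · simpa only [p.opp_opp, if_neg n1.symm, if_neg n2.symm] using .symm _ _ e0
    · simpa only [p.opp_opp, if_pos, if_neg (p.opp_ne _)] using hO' o3
    · have h4 : p.opp a ≠ p.rot f₀ := fun h => h3 (by rw [← h, p.opp_opp])
      simpa only [if_neg h1, if_neg h4] using hO' (o4 h0 h1 h2 h3)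
  · obtain ⟨a, rfl⟩ := p.rot.surjective a
    simp only [Equiv.symm_apply_apply]
    have hr : ∀ {x}, x ≠ f₀ → p.rot x ≠ p.rot f₀ := fun h h' => h (p.rot.injective h')
    have e2 : E (.inr (1, false)) (.inl (p.rot (p.opp f₀))) :=
      .symm _ _ (hN' o2 rfl (by rw [hrr, zero_add]))
    rcases p.mark_cases f₀ a with rfl | rfl | rfl | rfl | ⟨h0, h1, h2, h3⟩
    · simpa only [if_pos, if_neg (hr n0)] using e2
    · simpa only [if_neg (hr n1), if_neg (hr (p.opp_rot_ne _))] using e1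
    · simpa only [p.opp_opp, if_pos, if_neg (hr n0)] using .symm _ _ e2
    · simpa only [p.opp_opp, if_neg (hr n1), if_neg (hr (p.opp_rot_ne _))] using .symm _ _ e1
    · have h4 : p.opp a ≠ f₀ := fun h => h2 (by rw [← h, p.opp_opp])
      simpa only [if_neg (hr h0), if_neg (hr h4)] using
        hN' (o4 h0 h1 h2 h3) (hri _) (hri _)

theorem glueFlags_isConnected (hp : p.IsConnected) : (p.glueFlags f₀ hτ m).IsConnected := by
  set q := p.glueFlags f₀ hτ m with hq
  have o0 : q.opp (.inl f₀) = .inr (0, true) := p.gluedOpp_first f₀ m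
  have o1 : q.opp (.inl (p.rot f₀)) = .inr (1, true) := p.gluedOpp_second f₀ m
  have o2 : q.opp (.inl (p.opp f₀)) = .inr (0, false) := p.gluedOpp_opp_first f₀ m
  have o3 : q.opp (.inl (p.opp (p.rot f₀))) = .inr (1, false) := p.gluedOpp_opp_second f₀ m
  have o4 : ∀ {a}, a ≠ f₀ → a ≠ p.rot f₀ → a ≠ p.opp f₀ → a ≠ p.opp (p.rot f₀) →
      q.opp (.inl a) = .inl (p.opp a) := fun h0 h1 h2 h3 => p.gluedOpp_of_ne f₀ m h0 h1 h2 h3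
  have hrr : ∀ k s, q.rot (.inr (k, s)) = .inr (k + 1, s) := fun k s => rfl
  have hctr : ∀ s (k l : Fin (m + 4)),
      Relation.EqvGen (fun a b => b = q.rot a) (.inr (k, s)) (.inr (l, s)) := fun s k l =>
    eqvGen_map (r := fun a b => b = (bipyramidFlags m).rot a) Sum.inr
      (fun a b h => .rel _ _ (by rw [h]; rfl))
      ((bipyramidFlags_isConnected m).ctr_conn (k, s) (l, s) rfl)
  refine ⟨?_, ?_, ?_⟩
  · rintro (f | ⟨k, s⟩) (g | ⟨l, t⟩) h <;> replace h := congrArg (p.code f₀ hτ m) h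
    · replace h := (p.code_glueCtr_inl f₀ hτ m f).symm.trans
        (h.trans (p.code_glueCtr_inl f₀ hτ m g))
      refine eqvGen_map (r := fun a b => b = p.rot a) Sum.inl
        (fun a b h => .rel _ _ (by rw [h]; rfl)) (hp.ctr_conn f g (Sum.inl.inj h))
    · exact absurd ((p.code_glueCtr_inl f₀ hτ m f).symm.trans
        (h.trans (p.code_glueCtr_inr f₀ hτ m l t))) Sum.inl_ne_inr
    · exact absurd ((p.code_glueCtr_inl f₀ hτ m g).symm.trans
        (h.symm.trans (p.code_glueCtr_inr f₀ hτ m k s))) Sum.inl_ne_inr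
    · rw [apexCode_inj ((p.code_glueCtr_inr f₀ hτ m k s).symm.trans
        (h.trans (p.code_glueCtr_inr f₀ hτ m l t)))]
      exact hctr t k l
  · obtain ⟨j, hj, hj1, hconn⟩ := p.glue_src_conn_inl f₀ hτ m hp
    rw [← hq] at hconn
    set E := Relation.EqvGen (fun a b => b = q.opp a ∨ b = q.rot (q.opp (q.rot.symm a))) with hE
    have hO : ∀ {x y}, q.opp x = y → E x y := fun h => .rel _ _ (.inl h.symm)
    have hN : ∀ {x y x' y'}, q.opp x = y → q.rot x = x' → q.rot y = y' → E x' y' := by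
      rintro x y x' y' rfl rfl rfl
      exact .rel _ _ (.inr (by rw [Equiv.symm_apply_apply]))
    -- Every flag is connected to one which is determined by the code of its first vertex.
    have key : ∀ x, (∃ f, E x (j f) ∧ p.code f₀ hτ m (q.src x) = .inl (p.src f)) ∨
        (E x (.inl (p.rot f₀)) ∧ p.code f₀ hτ m (q.src x) = .inr 1) ∨
        (∃ k : Fin (m + 4), 3 ≤ (k : ℕ) ∧ E x (.inr (k, true)) ∧
          p.code f₀ hτ m (q.src x) = .inr (k : ℕ)) := by
      rintro (f | ⟨k, s⟩)
      · have hc := p.code_glueSrc_inl f₀ hτ m f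
        by_cases hf : f = p.rot f₀
        · rw [if_pos hf] at hc
          exact .inr (.inl ⟨by rw [hf]; exact .refl _, hc⟩)
        · rw [if_neg hf] at hc
          exact .inl ⟨f, by rw [hj f hf]; exact .refl _, hc⟩
      · have hc := p.code_glueSrc_inr f₀ hτ m k s
        rcases rim_cases k with rfl | rfl | rfl | hk
        · rw [rimCode_zero] at hc
          cases s
          · refine .inl ⟨p.opp f₀, ?_, by rw [p.src_opp]; exact hc⟩
            rw [hj _ (p.rot_ne_opp f₀).symm]
            exact .symm _ _ (hO o2)
          · refine .inl ⟨f₀, ?_, hc⟩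
            rw [hj _ (p.rot_ne f₀).symm]
            exact .symm _ _ (hO o0)
        · rw [rimCode_one] at hc
          cases s
          · exact .inl ⟨p.rot f₀, by rw [hj1]; exact .refl _, by rw [p.src_rot]; exact hc⟩
          · exact .inr (.inl ⟨.symm _ _ (hO o1), hc⟩)
        · rw [rimCode_two] at hc
          have hr : ∀ {x}, x ≠ f₀ → p.rot x ≠ p.rot f₀ := fun h h' => h (p.rot.injective h')
          cases s
          · refine .inl ⟨p.rot (p.opp (p.rot f₀)), ?_, ?_⟩
            · rw [hj _ (hr (p.opp_rot_ne f₀))]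
              exact .symm _ _ (hN o3 rfl (by rw [hrr, one_add_one']))
            · rw [p.src_rot, p.tgt_opp]; exact hc
          · refine .inl ⟨p.rot (p.rot f₀), ?_, ?_⟩
            · rw [hj _ (hr (p.rot_ne f₀))]
              exact .symm _ _ (hN o1 rfl (by rw [hrr, one_add_one']))
            · rw [p.src_rot]; exact hc
        · rw [rimCode_of_three_le _ _ hk] at hc
          refine .inr (.inr ⟨k, hk, ?_, hc⟩)
          cases s
          · refine hO (p.gluedOpp_inr f₀ m ?_ ?_ false)
            · rintro rfl; simp at hk
            · rintro rfl; simp at hk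
          · exact .refl _
    intro x y hxy
    have hc := congrArg (p.code f₀ hτ m) hxy
    rcases key x with ⟨f, h1, h2⟩ | ⟨h1, h2⟩ | ⟨k, hk, h1, h2⟩ <;>
      rcases key y with ⟨g, h3, h4⟩ | ⟨h3, h4⟩ | ⟨l, hl, h3, h4⟩ <;> rw [h2, h4] at hc
    · exact .trans _ _ _ h1 (.trans _ _ _ (hconn f g (Sum.inl.inj hc)) (.symm _ _ h3))
    · exact absurd hc Sum.inl_ne_inr
    · exact absurd hc Sum.inl_ne_inr
    · exact absurd hc Sum.inr_ne_inl
    · exact .trans _ _ _ h1 (.symm _ _ h3)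
    · have := Sum.inr.inj hc; omega
    · exact absurd hc Sum.inr_ne_inl
    · have := Sum.inr.inj hc; omega
    · obtain rfl : k = l := Fin.ext (Sum.inr.inj hc)
      exact .trans _ _ _ h1 (.symm _ _ h3)
  · set E := Relation.EqvGen (fun a b => b = q.rot a ∨ b = q.opp a) with hE
    have hO : ∀ {x y}, q.opp x = y → E x y := fun h => .rel _ _ (.inr h.symm)
    have hrim : ∀ s (k l : Fin (m + 4)), E (.inr (k, s)) (.inr (l, s)) := fun s k l =>
      eqvGen_map id (fun a b h => .rel _ _ (.inl h)) (hctr s k l)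
    have h2 : ∀ k s, E (.inr (k, s)) (.inr (2, true)) := by
      intro k s
      cases s
      · exact .trans _ _ _ (hrim false k 2)
          (hO (p.gluedOpp_inr f₀ m (two_ne_zero' m) (two_ne_one' m) false))
      · exact hrim true k 2
    have hmark : ∀ a b k l s t, q.opp (.inl a) = .inr (k, s) → q.opp (.inl b) = .inr (l, t) →
        E (.inl a) (.inl b) := fun a b k l s t ha hb =>
      .trans _ _ _ (.trans _ _ _ (hO ha) (h2 _ _)) (.symm _ _ (.trans _ _ _ (hO hb) (h2 _ _)))
    have hl : ∀ f g, E (.inl f) (.inl g) := fun f g => by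
      refine eqvGen_map _ ?_ (hp.conn f g)
      rintro a b (rfl | rfl)
      · exact .rel _ _ (.inl rfl)
      · rcases p.mark_cases f₀ a with rfl | rfl | rfl | rfl | ⟨h0, h1, h2, h3⟩
        · exact hmark _ _ _ _ _ _ o0 o2
        · exact hmark _ _ _ _ _ _ o1 o3
        · rw [p.opp_opp]; exact hmark _ _ _ _ _ _ o2 o0
        · rw [p.opp_opp]; exact hmark _ _ _ _ _ _ o3 o1
        · exact hO (o4 h0 h1 h2 h3)
    have hall : ∀ x, E x (.inl f₀) := by
      rintro (f | ⟨k, s⟩)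
      · exact hl f f₀
      · exact .trans _ _ _ (h2 k s) (.symm _ _ (.trans _ _ _ (hO o0) (h2 _ _)))
    exact fun x y => .trans _ _ _ (hall x) (.symm _ _ (hall y))

end GlueConnected

section SumOrientation

variable {V : Type u} {K : Set (Finset V)} {X : Type w} (p : FlagSystem K X)
  {τ : Set (ℤ → V)} (hτ : ∀ x y, TypeII K τ x y ↔ p.Directed x y)

include hτ in
theorem eq_of_typeII_of_mem_face {f : X} {x y : V} (h : TypeII K τ x y) (hx : x ∈ p.face f)
    (hy : y ∈ p.face f) : x = p.src f ∧ y = p.tgt f := by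
  obtain ⟨g, rfl, rfl⟩ := (hτ x y).1 h
  have h1 := p.src_ne_tgt g
  have h2 := p.asymm g f
  rw [mem_face] at hx hy
  have h3 := p.ctr_ne_src f g
  have h4 := p.ctr_ne_tgt f g
  grind

include hτ in
theorem cases_of_typeI_of_mem_face {f : X} {x y : V} (h : TypeI K τ x y) (hx : x ∈ p.face f)
    (hy : y ∈ p.face f) : (x = p.tgt f ∧ y = p.ctr f) ∨ (x = p.ctr f ∧ y = p.tgt f) ∨
      (x = p.src f ∧ y = p.ctr f) ∨ (x = p.ctr f ∧ y = p.src f) := by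
  have h1 := h.1.1
  have h2 := ((hτ _ _).2 ⟨f, rfl, rfl⟩ : TypeII K τ (p.src f) (p.tgt f)).2.2
  have h3 := h.2.1
  have h4 := h.2.2
  rw [mem_face] at hx hy
  grind

theorem isSumOrientation (f₀ : X) (m : ℕ) :
    IsSumOrientation (p.pairAt f₀ hτ) (bipyramidPair m) SpecialHomeo.id
      (p.glueFlags f₀ hτ m).zigzags where
  orientation := (p.glueFlags f₀ hτ m).isZOrientation
  left_I A hA x hx y hy h := by
    obtain ⟨f, rfl⟩ := p.exists_face_eq hA
    rcases p.cases_of_typeI_of_mem_face hτ h hx hy with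
      ⟨rfl, rfl⟩ | ⟨rfl, rfl⟩ | ⟨rfl, rfl⟩ | ⟨rfl, rfl⟩
    · exact (p.glueFlags f₀ hτ m).typeI_tgt_ctr (.inl f)
    · exact ((p.glueFlags f₀ hτ m).typeI_tgt_ctr (.inl f)).symm
    · exact ((p.glueFlags f₀ hτ m).typeI_ctr_src (.inl f)).symm
    · exact (p.glueFlags f₀ hτ m).typeI_ctr_src (.inl f)
  left_II A hA x hx y hy h := by
    obtain ⟨f, rfl⟩ := p.exists_face_eq hA
    obtain ⟨rfl, rfl⟩ := p.eq_of_typeII_of_mem_face hτ h hx hy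
    exact (p.glueFlags f₀ hτ m).typeII (.inl f)
  right_I A hA x hx y hy h := by
    obtain ⟨f, rfl⟩ := (bipyramidFlags m).exists_face_eq hA
    rcases (bipyramidFlags m).cases_of_typeI_of_mem_face (bipyramidFlags m).typeII_iff h hx hy with
      ⟨rfl, rfl⟩ | ⟨rfl, rfl⟩ | ⟨rfl, rfl⟩ | ⟨rfl, rfl⟩
    · exact (p.glueFlags f₀ hτ m).typeI_tgt_ctr (.inr f)
    · exact ((p.glueFlags f₀ hτ m).typeI_tgt_ctr (.inr f)).symm
    · exact ((p.glueFlags f₀ hτ m).typeI_ctr_src (.inr f)).symm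
    · exact (p.glueFlags f₀ hτ m).typeI_ctr_src (.inr f)
  right_II A hA x hx y hy h := by
    obtain ⟨f, rfl⟩ := (bipyramidFlags m).exists_face_eq hA
    obtain ⟨rfl, rfl⟩ :=
      (bipyramidFlags m).eq_of_typeII_of_mem_face (bipyramidFlags m).typeII_iff h hx hy
    exact (p.glueFlags f₀ hτ m).typeII (.inr f)

theorem liftEdges_inl (f₀ : X) (m : ℕ) {D : V → V → Prop} {f : X} (h : D (p.src f) (p.tgt f)) :
    liftEdges (p.pairAt f₀ hτ) (bipyramidPair m) SpecialHomeo.id D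
      ((p.glueFlags f₀ hτ m).src (.inl f)) ((p.glueFlags f₀ hτ m).tgt (.inl f)) :=
  ⟨p.face f, p.face_mem f, _, p.src_mem_face f, _, p.tgt_mem_face f, h, rfl, rfl⟩

end SumOrientation

end FlagSystem

/-! ### The surface does not change under the connected sum with a bipyramid -/

section Subdivisions

variable {W : Type u}

/-- The triangles with vertices `a`, `b`, `c`. -/
def triangle (a b c : W) : Set (Finset W) := {F | (F : Set W) = {a, b, c}}

theorem triangle_swap (a b c : W) : triangle a b c = triangle b a c := by
  simp only [triangle, Set.insert_comm a b]

theorem triangle_rotate (a b c : W) : triangle a b c = triangle b c a := by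
  simp only [triangle, Set.insert_comm a b, Set.pair_comm a c]

theorem triangle_swap' (a b c : W) : triangle a b c = triangle a c b := by
  simp only [triangle, Set.pair_comm b c]

/-- Equal complexes have homeomorphic realizations. -/
def realizationCongr {K L : Set (Finset W)} (h : K = L) :
    Realization K ≃ₜ Realization L := h ▸ Homeomorph.refl _

theorem mem_of_mem_triangle {a b c x : W} {F : Finset W} (hF : F ∈ triangle a b c) :
    x ∈ F ↔ x = a ∨ x = b ∨ x = c := by
  have hF : (F : Set W) = {a, b, c} := hF
  rw [← Finset.mem_coe, hF]; rfl

theorem realization_subdivide_triangle {R : Set (Finset W)} {b c m p q : W} (hbc : b ≠ c)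
    (hbm : b ≠ m) (hcm : c ≠ m) (hbp : b ≠ p) (hcp : c ≠ p) (hpm : p ≠ m) (hbq : b ≠ q)
    (hcq : c ≠ q) (hqm : q ≠ m) (hR : ∀ F ∈ R, b ∈ F → c ∉ F) (hRm : ∀ F ∈ R, m ∉ F) :
    Nonempty (Realization (R ∪ (triangle b c p ∪ triangle b c q)) ≃ₜ
      Realization (R ∪ (triangle m b p ∪ (triangle m c p ∪ (triangle m b q ∪ triangle m c q))))) :=
  realization_subdivide hbc hbm hcm hbp hcp hpm hbq hcq hqm hR hRm (fun _ => Iff.rfl)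
    fun _ => Iff.rfl

/-- The triangles `z k`, `z (k + 1)` with the apices `z 0` and `z 2`, for `3 ≤ k < n - 1`. -/
def fan (z : ℕ → W) (n : ℕ) : Set (Finset W) :=
  {F | ∃ k, 3 ≤ k ∧ k + 1 < n ∧
    F ∈ triangle (z k) (z (k + 1)) (z 0) ∪ triangle (z k) (z (k + 1)) (z 2)}

/-- The complex obtained from the union of `R` with the triangles `v₁v₂c` and `v₂v₃c` by the
connected sum with the bipyramid over a polygon with `n` vertices: `z 0` and `z 2` are the apices,
`z 1` is the second copy of `v₂`. -/
def bipyramidSum (R : Set (Finset W)) (v₁ v₂ v₃ c : W) (z : ℕ → W) (n : ℕ) : Set (Finset W) :=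
  R ∪ triangle v₁ (z 1) c ∪ triangle (z 1) v₃ c ∪ triangle v₁ (z 1) (z 0) ∪
    triangle (z 1) v₃ (z 0) ∪ triangle v₁ v₂ (z 2) ∪ triangle v₂ v₃ (z 2) ∪
    triangle v₃ (z 3) (z 0) ∪ triangle v₃ (z 3) (z 2) ∪ fan z n ∪
    triangle (z (n - 1)) v₁ (z 0) ∪ triangle (z (n - 1)) v₁ (z 2)

/-- The connected sum with a bipyramid is a repeated subdivision of edges: after the edge `v₂c`,
each of the vertices `z 2`, `z 0`, `z 3` subdivides the edge between `z 1` and the last vertex on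
this side, and each further vertex subdivides the edge between `v₁` and its predecessor. -/
theorem realization_bipyramidSum {R : Set (Finset W)} {v₁ v₂ v₃ c : W} {z : ℕ → W}
    (h12 : v₁ ≠ v₂) (h23 : v₂ ≠ v₃) (h13 : v₁ ≠ v₃) (h1c : v₁ ≠ c) (h2c : v₂ ≠ c) (h3c : v₃ ≠ c)
    (hz : Function.Injective z) (hz1 : ∀ k, z k ≠ v₁) (hz2 : ∀ k, z k ≠ v₂) (hz3 : ∀ k, z k ≠ v₃)
    (hzc : ∀ k, z k ≠ c) (hR : ∀ F ∈ R, v₂ ∈ F → c ∉ F) (hRz : ∀ F ∈ R, ∀ k, z k ∉ F)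
    {n : ℕ} (hn : 4 ≤ n) :
    Nonempty (Realization (R ∪ (triangle v₁ v₂ c ∪ triangle v₂ v₃ c)) ≃ₜ
      Realization (bipyramidSum R v₁ v₂ v₃ c z n)) := by
  have hzz : ∀ k l, z k = z l ↔ k = l := fun k l => hz.eq_iff
  induction n, hn using Nat.le_induction with
  | base =>
    obtain ⟨e1⟩ := realization_subdivide_triangle (R := R) (b := v₂) (c := c) (m := z 1) (p := v₁)
      (q := v₃) h2c (hz2 1).symm (hzc 1).symm h12.symm h1c.symm (hz1 1).symm h23 h3c.symm
      (hz3 1).symm hR (fun F hF => hRz F hF 1)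
    obtain ⟨e2⟩ := realization_subdivide_triangle
      (R := R ∪ (triangle v₁ (z 1) c ∪ triangle (z 1) v₃ c)) (b := v₂) (c := z 1) (m := z 2)
      (p := v₁) (q := v₃) (hz2 1).symm (hz2 2).symm (by simp [hzz]) h12.symm (hz1 1) (hz1 2).symm
      h23 (hz3 1) (hz3 2).symm
      (by
        rintro F (hF | hF | hF) h h'
        · exact hRz F hF 1 h'
        · simp [mem_of_mem_triangle hF, h2c, h12.symm, (hz2 _).symm] at h
        · simp [mem_of_mem_triangle hF, h2c, h23, (hz2 _).symm] at h)
      (by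
        rintro F (hF | hF | hF) h
        · exact hRz F hF 2 h
        · simp [mem_of_mem_triangle hF, hz1, hzc, hzz] at h
        · simp [mem_of_mem_triangle hF, hz3, hzc, hzz] at h)
    obtain ⟨e3⟩ := realization_subdivide_triangle
      (R := R ∪ (triangle v₁ (z 1) c ∪ triangle (z 1) v₃ c) ∪
        (triangle v₁ v₂ (z 2) ∪ triangle v₂ v₃ (z 2))) (b := z 2) (c := z 1) (m := z 0)
      (p := v₁) (q := v₃) (by simp [hzz]) (by simp [hzz]) (by simp [hzz]) (hz1 2) (hz1 1)
      (hz1 0).symm (hz3 2) (hz3 1) (hz3 0).symm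
      (by
        rintro F ((hF | hF | hF) | hF | hF) h h'
        · exact hRz F hF 1 h'
        · simp [mem_of_mem_triangle hF, hz1, hzc, hzz] at h
        · simp [mem_of_mem_triangle hF, hz3, hzc, hzz] at h
        · simp [mem_of_mem_triangle hF, hz1, hz2, hzz] at h'
        · simp [mem_of_mem_triangle hF, hz3, hz2, hzz] at h')
      (by
        rintro F ((hF | hF | hF) | hF | hF) h
        · exact hRz F hF 0 h
        · simp [mem_of_mem_triangle hF, hz1, hzc, hzz] at h
        · simp [mem_of_mem_triangle hF, hz3, hzc, hzz] at h
        · simp [mem_of_mem_triangle hF, hz1, hz2, hzz] at h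
        · simp [mem_of_mem_triangle hF, hz3, hz2, hzz] at h)
    obtain ⟨e4⟩ := realization_subdivide_triangle
      (R := R ∪ (triangle v₁ (z 1) c ∪ triangle (z 1) v₃ c) ∪
        (triangle v₁ v₂ (z 2) ∪ triangle v₂ v₃ (z 2)) ∪
        (triangle v₁ (z 1) (z 0) ∪ triangle (z 1) v₃ (z 0))) (b := z 0) (c := z 2) (m := z 3)
      (p := v₁) (q := v₃) (by simp [hzz]) (by simp [hzz]) (by simp [hzz]) (hz1 0) (hz1 2)
      (hz1 3).symm (hz3 0) (hz3 2) (hz3 3).symm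
      (by
        rintro F (((hF | hF | hF) | hF | hF) | hF | hF) h h'
        · exact hRz F hF 0 h
        · simp [mem_of_mem_triangle hF, hz1, hzc, hzz] at h
        · simp [mem_of_mem_triangle hF, hz3, hzc, hzz] at h
        · simp [mem_of_mem_triangle hF, hz1, hz2, hzz] at h
        · simp [mem_of_mem_triangle hF, hz3, hz2, hzz] at h
        · simp [mem_of_mem_triangle hF, hz1, hzz] at h'
        · simp [mem_of_mem_triangle hF, hz3, hzz] at h')
      (by
        rintro F (((hF | hF | hF) | hF | hF) | hF | hF) h
        · exact hRz F hF 3 h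
        · simp [mem_of_mem_triangle hF, hz1, hzc, hzz] at h
        · simp [mem_of_mem_triangle hF, hz3, hzc, hzz] at h
        · simp [mem_of_mem_triangle hF, hz1, hz2, hzz] at h
        · simp [mem_of_mem_triangle hF, hz3, hz2, hzz] at h
        · simp [mem_of_mem_triangle hF, hz1, hzz] at h
        · simp [mem_of_mem_triangle hF, hz3, hzz] at h)
    have s1 : R ∪ (triangle v₁ v₂ c ∪ triangle v₂ v₃ c) =
        R ∪ (triangle v₂ c v₁ ∪ triangle v₂ c v₃) := by
      rw [triangle_rotate v₁ v₂ c, triangle_swap' v₂ c v₃]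
    have s2 : R ∪ (triangle (z 1) v₂ v₁ ∪ (triangle (z 1) c v₁ ∪ (triangle (z 1) v₂ v₃ ∪
        triangle (z 1) c v₃))) = R ∪ (triangle v₁ (z 1) c ∪ triangle (z 1) v₃ c) ∪
          (triangle v₂ (z 1) v₁ ∪ triangle v₂ (z 1) v₃) := by
      rw [triangle_swap (z 1) v₂ v₁, triangle_swap (z 1) v₂ v₃, triangle_swap' (z 1) c v₃,
        ← triangle_rotate v₁ (z 1) c]
      ac_rfl
    have s3 : R ∪ (triangle v₁ (z 1) c ∪ triangle (z 1) v₃ c) ∪ (triangle (z 2) v₂ v₁ ∪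
        (triangle (z 2) (z 1) v₁ ∪ (triangle (z 2) v₂ v₃ ∪ triangle (z 2) (z 1) v₃))) =
        R ∪ (triangle v₁ (z 1) c ∪ triangle (z 1) v₃ c) ∪
          (triangle v₁ v₂ (z 2) ∪ triangle v₂ v₃ (z 2)) ∪
          (triangle (z 2) (z 1) v₁ ∪ triangle (z 2) (z 1) v₃) := by
      rw [triangle_rotate (z 2) v₂ v₁, triangle_swap v₂ v₁, triangle_rotate (z 2) v₂ v₃]
      ac_rfl
    have s4 : R ∪ (triangle v₁ (z 1) c ∪ triangle (z 1) v₃ c) ∪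
        (triangle v₁ v₂ (z 2) ∪ triangle v₂ v₃ (z 2)) ∪ (triangle (z 0) (z 2) v₁ ∪
        (triangle (z 0) (z 1) v₁ ∪ (triangle (z 0) (z 2) v₃ ∪ triangle (z 0) (z 1) v₃))) =
        R ∪ (triangle v₁ (z 1) c ∪ triangle (z 1) v₃ c) ∪
          (triangle v₁ v₂ (z 2) ∪ triangle v₂ v₃ (z 2)) ∪
          (triangle v₁ (z 1) (z 0) ∪ triangle (z 1) v₃ (z 0)) ∪
          (triangle (z 0) (z 2) v₁ ∪ triangle (z 0) (z 2) v₃) := by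
      rw [triangle_rotate (z 0) (z 1) v₁, triangle_swap (z 1) v₁, triangle_rotate (z 0) (z 1) v₃]
      ac_rfl
    have s5 : R ∪ (triangle v₁ (z 1) c ∪ triangle (z 1) v₃ c) ∪
        (triangle v₁ v₂ (z 2) ∪ triangle v₂ v₃ (z 2)) ∪
        (triangle v₁ (z 1) (z 0) ∪ triangle (z 1) v₃ (z 0)) ∪ (triangle (z 3) (z 0) v₁ ∪
        (triangle (z 3) (z 2) v₁ ∪ (triangle (z 3) (z 0) v₃ ∪ triangle (z 3) (z 2) v₃))) =
        bipyramidSum R v₁ v₂ v₃ c z 4 := by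
      have hfan : fan z 4 = ∅ := by
        ext F
        simp only [fan, Set.mem_ofPred_eq, Set.mem_empty_iff_false, iff_false]
        rintro ⟨k, h3, h4, -⟩
        omega
      rw [bipyramidSum, hfan, Set.union_empty, triangle_swap' (z 3) (z 0) v₁,
        triangle_swap' (z 3) (z 2) v₁, ← triangle_rotate v₃ (z 3) (z 0),
        ← triangle_rotate v₃ (z 3) (z 2)]
      ac_rfl
    rw [← s5]
    rw [s4] at e3
    rw [s3] at e2
    rw [s2] at e1
    rw [s1]
    exact ⟨e1.trans (e2.trans (e3.trans e4))⟩
  | succ n hn ih =>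
    obtain ⟨e⟩ := ih
    obtain ⟨l, rfl⟩ : ∃ l, n = l + 1 := ⟨n - 1, by omega⟩
    have hl3 : 3 ≤ l := by omega
    have hne : 0 ≠ l ∧ 1 ≠ l ∧ 2 ≠ l := by omega
    obtain ⟨e'⟩ := realization_subdivide_triangle
      (R := R ∪ triangle v₁ (z 1) c ∪ triangle (z 1) v₃ c ∪ triangle v₁ (z 1) (z 0) ∪
        triangle (z 1) v₃ (z 0) ∪ triangle v₁ v₂ (z 2) ∪ triangle v₂ v₃ (z 2) ∪
        triangle v₃ (z 3) (z 0) ∪ triangle v₃ (z 3) (z 2) ∪ fan z (l + 1)) (b := v₁) (c := z l)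
      (m := z (l + 1)) (p := z 0) (q := z 2) (hz1 _).symm (hz1 _).symm (by simp [hzz])
      (hz1 _).symm (by simp [hzz, hne.1.symm]) (by simp [hzz]) (hz1 _).symm
      (by simp [hzz, hne.2.2.symm]) (by simp [hzz]; omega)
      (by
        rintro F (((((((((hF | hF) | hF) | hF) | hF) | hF) | hF) | hF) | hF) | ⟨k, h3, h4, hF | hF⟩)
          h h'
        · exact hRz F hF _ h'
        · simp [mem_of_mem_triangle hF, hz1, hzc, hzz, hne.2.1.symm] at h'
        · simp [mem_of_mem_triangle hF, h13, h1c, (hz1 _).symm] at h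
        · simp [mem_of_mem_triangle hF, hz1, hzz, hne.1.symm, hne.2.1.symm] at h'
        · simp [mem_of_mem_triangle hF, h13, (hz1 _).symm] at h
        · simp [mem_of_mem_triangle hF, hz1, hz2, hzz, hne.2.2.symm] at h'
        · simp [mem_of_mem_triangle hF, h12, h13, (hz1 _).symm] at h
        · simp [mem_of_mem_triangle hF, h13, (hz1 _).symm] at h
        · simp [mem_of_mem_triangle hF, h13, (hz1 _).symm] at h
        · simp [mem_of_mem_triangle hF, (hz1 _).symm] at h
        · simp [mem_of_mem_triangle hF, (hz1 _).symm] at h)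
      (by
        rintro F (((((((((hF | hF) | hF) | hF) | hF) | hF) | hF) | hF) | hF) | ⟨k, h3, h4, hF | hF⟩)
          h
        · exact hRz F hF _ h
        · rw [mem_of_mem_triangle hF] at h
          simp [hz1, hzc, hzz] at h
          omega
        · rw [mem_of_mem_triangle hF] at h
          simp [hz3, hzc, hzz] at h
          omega
        · rw [mem_of_mem_triangle hF] at h
          simp [hz1, hzz] at h
          omega
        · rw [mem_of_mem_triangle hF] at h
          simp [hz3, hzz] at h
          omega
        · rw [mem_of_mem_triangle hF] at h
          simp [hz1, hz2, hzz] at h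
          omega
        · rw [mem_of_mem_triangle hF] at h
          simp [hz2, hz3, hzz] at h
          omega
        · rw [mem_of_mem_triangle hF] at h
          simp [hz3, hzz] at h
          omega
        · rw [mem_of_mem_triangle hF] at h
          simp [hz3, hzz] at h
          omega
        · rw [mem_of_mem_triangle hF] at h
          simp [hzz] at h
          omega
        · rw [mem_of_mem_triangle hF] at h
          simp [hzz] at h
          omega)
    have hfan : fan z (l + 1 + 1) = fan z (l + 1) ∪
        (triangle (z l) (z (l + 1)) (z 0) ∪ triangle (z l) (z (l + 1)) (z 2)) := by
      ext F
      constructor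
      · rintro ⟨k, h3, h4, hF⟩
        obtain h | rfl : k + 1 < l + 1 ∨ k = l := by omega
        · exact .inl ⟨k, h3, h, hF⟩
        · exact .inr hF
      · rintro (⟨k, h3, h4, hF⟩ | hF)
        · exact ⟨k, h3, by omega, hF⟩
        · exact ⟨l, hl3, by omega, hF⟩
    rw [triangle_swap v₁ (z l), triangle_swap v₁ (z l), triangle_swap (z (l + 1)) (z l),
      triangle_swap (z (l + 1)) (z l)] at e'
    refine ⟨e.trans ((realizationCongr ?_).trans (e'.trans (realizationCongr ?_)))⟩
    · rw [bipyramidSum, Nat.add_sub_cancel]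
      ac_rfl
    · rw [bipyramidSum, hfan, Nat.add_sub_cancel]
      ac_rfl

end Subdivisions

namespace FlagSystem

variable {V : Type u} {K : Set (Finset V)} {X : Type w} (p : FlagSystem K X) (f₀ : X)
  {τ : Set (ℤ → V)} (hτ : ∀ x y, TypeII K τ x y ↔ p.Directed x y) (m : ℕ)

/-- The faces other than those of the flags `f₀` and `rot f₀`. -/
def otherFaces : Set (Finset (V ⊕ ℕ)) :=
  {F | ∃ f, f ≠ f₀ ∧ f ≠ p.rot f₀ ∧
    F ∈ triangle (Sum.inl (p.src f)) (Sum.inl (p.tgt f)) (Sum.inl (p.ctr f))}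

theorem mem_otherFaces_union_iff (F : Finset (V ⊕ ℕ)) :
    F ∈ p.otherFaces f₀ ∪ (triangle (.inl (p.src f₀)) (.inl (p.tgt f₀)) (.inl (p.ctr f₀)) ∪
      triangle (.inl (p.tgt f₀)) (.inl (p.tgt (p.rot f₀))) (.inl (p.ctr f₀))) ↔
    ∃ A ∈ K, (F : Set (V ⊕ ℕ)) = Sum.inl '' (A : Set V) := by
  have himg : ∀ f, (Sum.inl '' (p.face f : Set V) : Set (V ⊕ ℕ)) =
      {.inl (p.src f), .inl (p.tgt f), .inl (p.ctr f)} := fun f => by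
    rw [coe_face, Set.image_insert_eq, Set.image_pair]
  constructor
  · rintro (⟨f, -, -, hF⟩ | hF | hF)
    · exact ⟨p.face f, p.face_mem f, by rw [himg]; exact hF⟩
    · exact ⟨p.face f₀, p.face_mem f₀, by rw [himg]; exact hF⟩
    · exact ⟨p.face (p.rot f₀), p.face_mem _, by rw [himg, p.src_rot, p.ctr_rot]; exact hF⟩
  · rintro ⟨A, hA, hF⟩
    obtain ⟨f, rfl⟩ := p.exists_face_eq hA
    rw [himg] at hF
    by_cases h0 : f = f₀
    · subst h0
      exact .inr (.inl hF)
    by_cases h1 : f = p.rot f₀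
    · rw [h1, p.src_rot, p.ctr_rot] at hF
      exact .inr (.inr hF)
    · exact .inl ⟨f, h0, h1, hF⟩

theorem mem_bipyramidSum_iff (F : Finset (V ⊕ ℕ)) :
    F ∈ bipyramidSum (p.otherFaces f₀) (.inl (p.src f₀)) (.inl (p.tgt f₀))
      (.inl (p.tgt (p.rot f₀))) (.inl (p.ctr f₀)) Sum.inr (m + 4) ↔
    ∃ A ∈ p.glueFaces f₀ hτ m, (F : Set (V ⊕ ℕ)) = p.code f₀ hτ m '' (A : Set _) := by
  have himg : (∃ A ∈ p.glueFaces f₀ hτ m, (F : Set (V ⊕ ℕ)) = p.code f₀ hτ m '' (A : Set _)) ↔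
      ∃ x, F ∈ triangle (p.code f₀ hτ m (p.glueSrc f₀ hτ m x))
        (p.code f₀ hτ m (p.glueTgt f₀ hτ m x)) (p.code f₀ hτ m (p.glueCtr f₀ hτ m x)) := by
    constructor
    · rintro ⟨A, hA, hF⟩
      obtain ⟨x, hx⟩ := (p.mem_glueFaces_iff f₀ hτ m A).1 hA
      refine ⟨x, ?_⟩
      rw [hx, Set.image_insert_eq, Set.image_pair] at hF
      exact hF
    · rintro ⟨x, hF⟩
      obtain ⟨A, hA⟩ := exists_finset_coe (p.glueSrc f₀ hτ m x) (p.glueTgt f₀ hτ m x)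
        (p.glueCtr f₀ hτ m x)
      refine ⟨A, (p.mem_glueFaces_iff f₀ hτ m A).2 ⟨x, hA⟩, ?_⟩
      rw [hA, Set.image_insert_eq, Set.image_pair]
      exact hF
  rw [himg]
  have hrim : ∀ (k : Fin (m + 4)) (s : Bool) (a b c : V ⊕ ℕ), p.rimCode f₀ k s = a →
      p.rimCode f₀ (k + 1) s = b → apexCode s = c → F ∈ triangle a b c →
      ∃ x, F ∈ triangle (p.code f₀ hτ m (p.glueSrc f₀ hτ m x))
        (p.code f₀ hτ m (p.glueTgt f₀ hτ m x)) (p.code f₀ hτ m (p.glueCtr f₀ hτ m x)) := by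
    rintro k s a b c rfl rfl rfl hF
    refine ⟨.inr (k, s), ?_⟩
    rw [code_glueSrc_inr, code_glueTgt_inr, code_glueCtr_inr]
    exact hF
  have h01 : ∀ s, p.rimCode f₀ (0 + 1 : Fin (m + 4)) s =
      if s then .inr 1 else .inl (p.tgt f₀) := fun s => by rw [zero_add, rimCode_one]
  have h12 : ∀ s, p.rimCode f₀ (1 + 1 : Fin (m + 4)) s = .inl (p.tgt (p.rot f₀)) := fun s => by
    rw [one_add_one', rimCode_two]
  have h23 : ∀ s, p.rimCode f₀ (2 + 1 : Fin (m + 4)) s = .inr 3 := fun s => by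
    rw [rimCode_of_three_le _ _ two_add_one_val, val_add_one, val_two', if_neg (by omega)]
  have hsucc : ∀ (k : Fin (m + 4)) s, 3 ≤ (k : ℕ) → (k : ℕ) + 1 < m + 4 →
      p.rimCode f₀ (k + 1) s = .inr ((k : ℕ) + 1) := fun k s h3 h4 => by
    have h : ((k + 1 : Fin (m + 4)) : ℕ) = (k : ℕ) + 1 := by rw [val_add_one, if_neg (by omega)]
    rw [rimCode_of_three_le _ _ (by omega), h]
  have hlast : ∀ (k : Fin (m + 4)) s, (k : ℕ) = m + 3 →
      p.rimCode f₀ (k + 1) s = .inl (p.src f₀) := fun k s h => by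
    have h : k + 1 = 0 := Fin.ext (by rw [val_add_one, if_pos h]; rfl)
    rw [h, rimCode_zero]
  have hval : ∀ (k : ℕ) (hk : k < m + 4) s, 3 ≤ k →
      p.rimCode f₀ (⟨k, hk⟩ : Fin (m + 4)) s = .inr k := fun k hk s h3 =>
    p.rimCode_of_three_le f₀ h3 s
  constructor
  · rintro (((((((((((hF | hF) | hF) | hF) | hF) | hF) | hF) | hF) | hF) | hF) | hF) | hF)
    · obtain ⟨f, h0, h1, hF⟩ := hF
      refine ⟨.inl f, ?_⟩
      rw [code_glueSrc_inl, code_glueTgt_inl, code_glueCtr_inl, if_neg h0, if_neg h1]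
      exact hF
    · refine ⟨.inl f₀, ?_⟩
      rw [code_glueSrc_inl, code_glueTgt_inl, code_glueCtr_inl, if_neg (p.rot_ne f₀).symm,
        if_pos rfl]
      exact hF
    · refine ⟨.inl (p.rot f₀), ?_⟩
      rw [code_glueSrc_inl, code_glueTgt_inl, code_glueCtr_inl, if_neg (p.rot_ne f₀),
        if_pos rfl, p.ctr_rot]
      exact hF
    · exact hrim 0 true _ _ _ (p.rimCode_zero f₀ _) (h01 _) rfl hF
    · exact hrim 1 true _ _ _ (p.rimCode_one f₀ _) (h12 _) rfl hF
    · exact hrim 0 false _ _ _ (p.rimCode_zero f₀ _) (h01 _) rfl hF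
    · exact hrim 1 false _ _ _ (p.rimCode_one f₀ _) (h12 _) rfl hF
    · exact hrim 2 true _ _ _ (p.rimCode_two f₀ _) (h23 _) rfl hF
    · exact hrim 2 false _ _ _ (p.rimCode_two f₀ _) (h23 _) rfl hF
    · obtain ⟨k, h3, h4, hF | hF⟩ := hF
      · exact hrim ⟨k, by omega⟩ true _ _ _ (hval k _ _ h3) (hsucc _ _ h3 h4) rfl hF
      · exact hrim ⟨k, by omega⟩ false _ _ _ (hval k _ _ h3) (hsucc _ _ h3 h4) rfl hF
    · exact hrim ⟨m + 3, by omega⟩ true _ _ _ (hval _ _ _ (by omega)) (hlast _ _ rfl) rfl hF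
    · exact hrim ⟨m + 3, by omega⟩ false _ _ _ (hval _ _ _ (by omega)) (hlast _ _ rfl) rfl hF
  · rintro ⟨f | ⟨k, s⟩, hF⟩
    · rw [code_glueSrc_inl, code_glueTgt_inl, code_glueCtr_inl] at hF
      by_cases h0 : f = f₀
      · rw [if_neg (by rw [h0]; exact (p.rot_ne f₀).symm), if_pos h0, h0] at hF
        simp only [bipyramidSum, Set.mem_union, hF, true_or, or_true]
      by_cases h1 : f = p.rot f₀
      · rw [if_pos h1, if_neg h0, h1, p.ctr_rot] at hF
        simp only [bipyramidSum, Set.mem_union, hF, true_or, or_true]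
      · rw [if_neg h1, if_neg h0] at hF
        have hF' : F ∈ p.otherFaces f₀ := ⟨f, h0, h1, hF⟩
        simp only [bipyramidSum, Set.mem_union, hF', true_or]
    · rw [code_glueSrc_inr, code_glueTgt_inr, code_glueCtr_inr] at hF
      rcases rim_cases k with rfl | rfl | rfl | hk
      · rw [rimCode_zero, h01] at hF
        cases s <;> simp only [apexCode, if_true, Bool.false_eq_true, if_false] at hF <;>
          simp only [bipyramidSum, Set.mem_union, hF, true_or, or_true]
      · rw [rimCode_one, h12] at hF
        cases s <;> simp only [apexCode, if_true, Bool.false_eq_true, if_false] at hF <;>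
          simp only [bipyramidSum, Set.mem_union, hF, true_or, or_true]
      · rw [rimCode_two, h23] at hF
        cases s <;> simp only [apexCode, if_true, Bool.false_eq_true, if_false] at hF <;>
          simp only [bipyramidSum, Set.mem_union, hF, true_or, or_true]
      · rw [rimCode_of_three_le _ _ hk] at hF
        by_cases h : (k : ℕ) = m + 3
        · rw [hlast k s h, h] at hF
          have h' : m + 4 - 1 = m + 3 := rfl
          cases s <;> simp only [apexCode, if_true, Bool.false_eq_true, if_false] at hF <;>
            simp only [bipyramidSum, Set.mem_union, h', hF, true_or, or_true]
        · have h4 : (k : ℕ) + 1 < m + 4 := by have := k.isLt; omega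
          rw [hsucc k s hk h4] at hF
          have hF' : F ∈ fan (Sum.inr : ℕ → V ⊕ ℕ) (m + 4) := by
            refine ⟨k, hk, h4, ?_⟩
            cases s
            · exact .inr hF
            · exact .inl hF
          simp only [bipyramidSum, Set.mem_union, hF', true_or, or_true]

/-- The connected sum with a bipyramid triangulates the same space. -/
theorem triangulates_glueFaces {M : Type v} [TopologicalSpace M] (hM : Triangulates K M) :
    Triangulates (p.glueFaces f₀ hτ m) M := by
  obtain ⟨e⟩ := hM
  obtain ⟨e₁⟩ := realization_map (Sum.inl : V → V ⊕ ℕ) Sum.inl_injective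
    (p.mem_otherFaces_union_iff f₀)
  obtain ⟨e₂⟩ := realization_map (p.code f₀ hτ m) (p.code_injective f₀ hτ m)
    (p.mem_bipyramidSum_iff f₀ hτ m)
  have hne : ∀ {a b : V}, a ≠ b → (Sum.inl a : V ⊕ ℕ) ≠ .inl b := fun h h' => h (Sum.inl.inj h')
  obtain ⟨e₃⟩ := realization_bipyramidSum (R := p.otherFaces f₀) (z := (Sum.inr : ℕ → V ⊕ ℕ))
    (hne (p.src_ne_tgt f₀)) (hne (p.tgt_ne_tgt_rot f₀)) (hne (p.src_ne_tgt_rot f₀))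
    (hne (p.ctr_ne_src f₀ f₀).symm) (hne (p.ctr_ne_tgt f₀ f₀).symm)
    (hne (p.ctr_ne_tgt f₀ _).symm) Sum.inr_injective (fun _ => Sum.inr_ne_inl)
    (fun _ => Sum.inr_ne_inl) (fun _ => Sum.inr_ne_inl) (fun _ => Sum.inr_ne_inl)
    (by
      rintro F ⟨f, h0, h1, hF⟩ h h'
      rw [mem_of_mem_triangle hF] at h h'
      simp only [Sum.inl.injEq] at h h'
      have hc : p.ctr f = p.ctr f₀ := by
        rcases h' with h' | h' | h'
        exacts [absurd h' (p.ctr_ne_src _ _), absurd h' (p.ctr_ne_tgt _ _), h'.symm]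
      rcases h with h | h | h
      · exact h1 (p.eq_of_src_ctr (p.rot f₀) f (by rw [p.src_rot, h]) (by rw [p.ctr_rot, hc]))
      · exact h0 (p.eq_of_tgt_ctr f₀ f h.symm hc)
      · exact p.ctr_ne_tgt _ _ h.symm)
    (by
      rintro F ⟨f, h0, h1, hF⟩ k h
      simp [mem_of_mem_triangle hF] at h)
    (Nat.le_add_left 4 m)
  exact ⟨e₂.trans (e₃.symm.trans (e₁.symm.trans e))⟩

end FlagSystem

/-! ### Merging the cycles of a permutation -/

section Detour

variable {X : Type u} {Y : Type v} {T : Equiv.Perm X} {S : Equiv.Perm Y} {mk : Fin 4 → X}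
  {j : X → Y} {β : Fin 4 → Fin 4}

/-- Up to cycles, the permutation `S` follows the permutation `T`, but whenever `T` goes to the
mark `mk i`, the permutation `S` makes a detour and goes to the mark `mk (β i)`. -/
structure IsDetour (T : Equiv.Perm X) (S : Equiv.Perm Y) (mk : Fin 4 → X) (j : X → Y)
    (β : Fin 4 → Fin 4) : Prop where
  of_ne : ∀ x, (∀ i, T x ≠ mk i) → S.SameCycle (j x) (j (T x))
  of_eq : ∀ x i, T x = mk i → S.SameCycle (j x) (j (mk (β i)))

/-- The permutation `τ` of the marks describes which mark is the next one on a cycle of `T`. -/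
def IsReturn (T : Equiv.Perm X) (mk : Fin 4 → X) (τ : Fin 4 → Fin 4) : Prop :=
  ∀ i, ∃ n, T^[n + 1] (mk i) = mk (τ i) ∧ ∀ k < n, ∀ l, T^[k + 1] (mk i) ≠ mk l

theorem exists_isReturn [Finite X] (T : Equiv.Perm X) {mk : Fin 4 → X}
    (hmk : Function.Injective mk) : ∃ τ : Equiv.Perm (Fin 4), IsReturn T mk τ := by
  classical
  have hex : ∀ i, ∃ n l, T^[n + 1] (mk i) = mk l := fun i => by
    refine ⟨orderOf T - 1, i, ?_⟩
    rw [Nat.sub_add_cancel (orderOf_pos T), ← Equiv.Perm.coe_pow, pow_orderOf_eq_one]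
    rfl
  choose τ hτ using fun i => Nat.find_spec (hex i)
  have hmin : ∀ i, ∀ k < Nat.find (hex i), ∀ l, T^[k + 1] (mk i) ≠ mk l := fun i k hk l h =>
    Nat.find_min (hex i) hk ⟨l, h⟩
  have key : ∀ i k, τ i = τ k → Nat.find (hex i) ≤ Nat.find (hex k) → i = k := by
    intro i k hik hle
    obtain ⟨d, hd⟩ := Nat.exists_eq_add_of_le hle
    have h : T^[Nat.find (hex i) + 1] (mk i) = T^[Nat.find (hex i) + 1] (T^[d] (mk k)) := by
      rw [← Function.iterate_add_apply,
        show Nat.find (hex i) + 1 + d = Nat.find (hex k) + 1 by omega, hτ i, hik, hτ k]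
    have h' := T.injective.iterate _ h
    rcases Nat.eq_zero_or_pos d with rfl | hpos
    · exact hmk h'
    · refine absurd h'.symm ?_
      obtain ⟨e, rfl⟩ : ∃ e, d = e + 1 := ⟨d - 1, by omega⟩
      exact hmin k e (by omega) i
  have hinj : Function.Injective τ := fun i k h => by
    rcases le_total (Nat.find (hex i)) (Nat.find (hex k)) with hle | hle
    · exact key i k h hle
    · exact (key k i h.symm hle).symm
  exact ⟨Equiv.ofBijective τ (Finite.injective_iff_bijective.1 hinj),
    fun i => ⟨Nat.find (hex i), hτ i, hmin i⟩⟩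

theorem IsReturn.sameCycle {τ : Fin 4 → Fin 4} (h : IsReturn T mk τ) (i : Fin 4) :
    T.SameCycle (mk i) (mk (τ i)) := by
  obtain ⟨n, hn, -⟩ := h i
  exact ⟨n + 1, by rw [← hn, ← Equiv.Perm.coe_pow]; norm_cast⟩

theorem IsReturn.sameCycle_iterate {τ : Fin 4 → Fin 4} (h : IsReturn T mk τ) (i : Fin 4) (a : ℕ) :
    T.SameCycle (mk i) (mk (τ^[a] i)) := by
  induction a with
  | zero => exact .refl _ _
  | succ a ih => rw [Function.iterate_succ_apply']; exact ih.trans (h.sameCycle _)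

theorem IsDetour.sameCycle_return (hd : IsDetour T S mk j β) {τ : Fin 4 → Fin 4}
    (h : IsReturn T mk τ) (i : Fin 4) : S.SameCycle (j (mk i)) (j (mk (β (τ i)))) := by
  obtain ⟨n, hn, hk⟩ := h i
  have key : ∀ l ≤ n, S.SameCycle (j (mk i)) (j (T^[l] (mk i))) := by
    intro l
    induction l with
    | zero => exact fun _ => .refl _ _
    | succ l ih =>
      intro hl
      refine (ih (by omega)).trans ?_
      rw [Function.iterate_succ_apply']
      refine hd.of_ne _ fun r => ?_
      rw [← Function.iterate_succ_apply' (f := T)]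
      exact hk l (by omega) r
  refine (key n le_rfl).trans (hd.of_eq _ _ ?_)
  rw [← hn, Function.iterate_succ_apply']

theorem IsDetour.sameCycle_iterate (hd : IsDetour T S mk j β) {τ : Fin 4 → Fin 4}
    (h : IsReturn T mk τ) (i : Fin 4) (a : ℕ) :
    S.SameCycle (j (mk i)) (j (mk ((β ∘ τ)^[a] i))) := by
  induction a with
  | zero => exact .refl _ _
  | succ a ih => rw [Function.iterate_succ_apply']; exact ih.trans (hd.sameCycle_return h _)

/-- If all marks are on one cycle of `S`, then no cycle of `T` is split by the detour. -/
theorem IsDetour.sameCycle (hd : IsDetour T S mk j β)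
    (hm : ∀ i k, S.SameCycle (j (mk i)) (j (mk k))) {x y : X} (h : T.SameCycle x y) :
    S.SameCycle (j x) (j y) := by
  have h1 : ∀ x, S.SameCycle (j x) (j (T x)) := by
    intro x
    by_cases hx : ∃ i, T x = mk i
    · obtain ⟨i, hi⟩ := hx
      rw [hi]
      exact (hd.of_eq x i hi).trans (hm _ _)
    · push Not at hx
      exact hd.of_ne x hx
  obtain ⟨n, rfl⟩ := h
  induction n using Int.induction_on with
  | zero => exact .refl _ _
  | succ n ih =>
    rw [add_comm, zpow_add, zpow_one, Equiv.Perm.mul_apply]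
    exact ih.trans (h1 _)
  | pred n ih =>
    have h2 := h1 ((T ^ (-(n : ℤ) - 1)) x)
    rw [← Equiv.Perm.mul_apply, ← zpow_one_add, add_sub_cancel] at h2
    exact ih.trans h2.symm

/-- Unless the marks `0`, `3` and the marks `1`, `2` are on common cycles, one of five detours puts
all the marks on one cycle. -/
theorem exists_detour (τ : Equiv.Perm (Fin 4)) :
    ((∃ a : Fin 4, τ^[a] 0 = 3) ∧ ∃ a : Fin 4, τ^[a] 1 = 2) ∨
      ∃ β ∈ [(· + 3), (· + 2), (· + 1), ![3, 2, 1, 0], ![2, 3, 1, 0]],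
        ∀ i, ∃ a : Fin 4, (β ∘ τ)^[a] 0 = i := by
  revert τ
  decide

end Detour

namespace FlagSystem

/-! ### Zigzags in the connected sum with a bipyramid -/

section Marks

variable {V : Type u} {K : Set (Finset V)} {X : Type w} (p : FlagSystem K X) (f₀ : X)

/-- The four flags at the special pair given by `f₀` and `rot f₀`. -/
def mark : Fin 4 → X := ![f₀, p.rot f₀, p.opp f₀, p.opp (p.rot f₀)]

theorem mark_injective : Function.Injective (p.mark f₀) := by
  have h1 := p.rot_ne f₀
  have h2 := p.opp_ne f₀
  have h3 := p.opp_rot_ne f₀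
  have h4 := p.rot_ne_opp f₀
  have h5 := p.opp_ne (p.rot f₀)
  have h6 := p.opp_rot_ne_opp f₀
  intro i k h
  fin_cases i <;> fin_cases k <;> simp_all [mark, eq_comm]

theorem opp_mark (i : Fin 4) : p.opp (p.mark f₀ i) = p.mark f₀ (i + 2) := by
  fin_cases i
  · rfl
  · rfl
  · exact p.opp_opp _
  · exact p.opp_opp _

end Marks

/-- The flags of the bipyramid which are glued to the four flags at the special pair. -/
def gate (m : ℕ) : Fin 4 → Fin (m + 4) × Bool := ![(0, true), (1, true), (0, false), (1, false)]

section Flow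

variable {V : Type u} {K : Set (Finset V)} {X : Type w} (p : FlagSystem K X) (f₀ : X)
  {τ : Set (ℤ → V)} (hτ : ∀ x y, TypeII K τ x y ↔ p.Directed x y) (m : ℕ)

theorem glue_opp_mark (i : Fin 4) :
    (p.glueFlags f₀ hτ m).opp (.inl (p.mark f₀ i)) = .inr (gate m i) := by
  fin_cases i
  · exact p.gluedOpp_first f₀ m
  · exact p.gluedOpp_second f₀ m
  · exact p.gluedOpp_opp_first f₀ m
  · exact p.gluedOpp_opp_second f₀ m

theorem glue_opp_inl {f : X} (h : ∀ i, f ≠ p.mark f₀ i) :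
    (p.glueFlags f₀ hτ m).opp (.inl f) = .inl (p.opp f) :=
  p.gluedOpp_of_ne f₀ m (h 0) (h 1) (h 2) (h 3)

theorem glue_zig_inl {x : X} (h : ∀ i, p.zig x ≠ p.mark f₀ i) :
    (p.glueFlags f₀ hτ m).zig (.inl x) = .inl (p.zig x) := by
  refine p.glue_opp_inl f₀ hτ m fun i hi => h (i + 2) ?_
  rw [zig_apply, ← opp_mark]
  exact congrArg p.opp hi

/-- Instead of going to a mark, a zigzag enters the bipyramid through a gate: `zig` ends with `opp`,
which pairs the marks with the gates, and the mark with index `i` is `opp` of the one with index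
`i + 2`. -/
theorem glue_zig_inl_mark {x : X} {i : Fin 4} (h : p.zig x = p.mark f₀ i) :
    (p.glueFlags f₀ hτ m).zig (.inl x) = .inr (gate m (i + 2)) := by
  have h' : p.rot (p.rot x) = p.mark f₀ (i + 2) := by
    rw [← opp_mark, ← h, zig_apply, p.opp_opp]
  rw [← p.glue_opp_mark f₀ hτ m, ← h']
  rfl

theorem glue_zig_inr {k l : Fin (m + 4)} (hl : k + 1 + 1 = l) (h0 : l ≠ 0) (h1 : l ≠ 1)
    (s : Bool) : (p.glueFlags f₀ hτ m).zig (.inr (k, s)) = .inr (l, !s) := by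
  rw [← p.gluedOpp_inr f₀ m h0 h1, ← hl]
  rfl

theorem glue_zig_inr_exit {k : Fin (m + 4)} {s : Bool} {i : Fin 4}
    (h : (k + 1 + 1, s) = gate m i) :
    (p.glueFlags f₀ hτ m).zig (.inr (k, s)) = .inl (p.mark f₀ i) := by
  have h1 : (p.glueFlags f₀ hτ m).rot ((p.glueFlags f₀ hτ m).rot (.inr (k, s))) =
      .inr (gate m i) := by
    rw [← h]; rfl
  rw [zig_apply, h1, ← p.glue_opp_mark f₀ hτ m, (p.glueFlags f₀ hτ m).opp_opp]

theorem sameCycle_zig (x : X) : p.zig.SameCycle x (p.zig x) :=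
  Equiv.Perm.sameCycle_apply_right.2 (.refl _ _)

theorem sameCycle_of_zig_eq {x y : X} (h : p.zig x = y) : p.zig.SameCycle x y :=
  h ▸ p.sameCycle_zig x

/-- A zigzag which enters the bipyramid leaves it again. -/
theorem exists_sameCycle_mark (h : Fin (m + 4) × Bool) :
    ∃ i, (p.glueFlags f₀ hτ m).zig.SameCycle (.inr h) (.inl (p.mark f₀ i)) := by
  obtain ⟨k, s⟩ := h
  generalize hd : m + 4 - (k : ℕ) = d
  induction d using Nat.strong_induction_on generalizing k s with
  | _ d ih =>
  have hk := k.isLt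
  by_cases h0 : k + 1 + 1 = 0
  · cases s
    · exact ⟨2, sameCycle_of_zig_eq _ (p.glue_zig_inr_exit f₀ hτ m (by rw [h0]; rfl))⟩
    · exact ⟨0, sameCycle_of_zig_eq _ (p.glue_zig_inr_exit f₀ hτ m (by rw [h0]; rfl))⟩
  by_cases h1 : k + 1 + 1 = 1
  · cases s
    · exact ⟨3, sameCycle_of_zig_eq _ (p.glue_zig_inr_exit f₀ hτ m (by rw [h1]; rfl))⟩
    · exact ⟨1, sameCycle_of_zig_eq _ (p.glue_zig_inr_exit f₀ hτ m (by rw [h1]; rfl))⟩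
  have hv : ((k + 1 + 1 : Fin (m + 4)) : ℕ) = k + 2 := by
    have h0' : ((k + 1 + 1 : Fin (m + 4)) : ℕ) ≠ 0 := fun h => h0 (Fin.ext h)
    have h1' : ((k + 1 + 1 : Fin (m + 4)) : ℕ) ≠ 1 := fun h => h1 (Fin.ext h)
    rw [val_add_one, val_add_one] at *
    grind
  obtain ⟨i, hi⟩ := ih (m + 4 - ((k + 1 + 1 : Fin (m + 4)) : ℕ)) (by omega) (k + 1 + 1) (!s) rfl
  exact ⟨i, (sameCycle_of_zig_eq _ (p.glue_zig_inr f₀ hτ m rfl h0 h1 s)).trans hi⟩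

/-- Inside the bipyramid, each step of a zigzag advances by two edges of the polygon and changes the
apex. Hence the mark at which it leaves depends on the gate and on the number of vertices of the
polygon modulo `4`; this is the polygon with five vertices. -/
theorem sameCycle_gate_one (i : Fin 4) : (p.glueFlags f₀ hτ 1).zig.SameCycle
    (.inr (gate 1 i)) (.inl (p.mark f₀ (i + 1))) := by
  have hs := fun k l hl h0 h1 s => sameCycle_of_zig_eq _ (p.glue_zig_inr f₀ hτ 1 (k := k) (l := l)
    hl h0 h1 s)
  have he := fun k s i h => sameCycle_of_zig_eq _ (p.glue_zig_inr_exit f₀ hτ 1 (k := k) (s := s)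
    (i := i) h)
  fin_cases i
  · exact ((hs 0 2 rfl (by decide) (by decide) true).trans
      (hs 2 4 rfl (by decide) (by decide) false)).trans (he 4 true 1 rfl)
  · exact (hs 1 3 rfl (by decide) (by decide) true).trans (he 3 false 2 rfl)
  · exact ((hs 0 2 rfl (by decide) (by decide) false).trans
      (hs 2 4 rfl (by decide) (by decide) true)).trans (he 4 false 3 rfl)
  · exact (hs 1 3 rfl (by decide) (by decide) false).trans (he 3 true 0 rfl)

theorem sameCycle_gate_two (i : Fin 4) : (p.glueFlags f₀ hτ 2).zig.SameCycle
    (.inr (gate 2 i)) (.inl (p.mark f₀ i)) := by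
  have hs := fun k l hl h0 h1 s => sameCycle_of_zig_eq _ (p.glue_zig_inr f₀ hτ 2 (k := k) (l := l)
    hl h0 h1 s)
  have he := fun k s i h => sameCycle_of_zig_eq _ (p.glue_zig_inr_exit f₀ hτ 2 (k := k) (s := s)
    (i := i) h)
  fin_cases i
  · exact ((hs 0 2 rfl (by decide) (by decide) true).trans
      (hs 2 4 rfl (by decide) (by decide) false)).trans (he 4 true 0 rfl)
  · exact ((hs 1 3 rfl (by decide) (by decide) true).trans
      (hs 3 5 rfl (by decide) (by decide) false)).trans (he 5 true 1 rfl)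
  · exact ((hs 0 2 rfl (by decide) (by decide) false).trans
      (hs 2 4 rfl (by decide) (by decide) true)).trans (he 4 false 2 rfl)
  · exact ((hs 1 3 rfl (by decide) (by decide) false).trans
      (hs 3 5 rfl (by decide) (by decide) true)).trans (he 5 false 3 rfl)

theorem sameCycle_gate_three (i : Fin 4) : (p.glueFlags f₀ hτ 3).zig.SameCycle
    (.inr (gate 3 i)) (.inl (p.mark f₀ (i + 3))) := by
  have hs := fun k l hl h0 h1 s => sameCycle_of_zig_eq _ (p.glue_zig_inr f₀ hτ 3 (k := k) (l := l)
    hl h0 h1 s)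
  have he := fun k s i h => sameCycle_of_zig_eq _ (p.glue_zig_inr_exit f₀ hτ 3 (k := k) (s := s)
    (i := i) h)
  fin_cases i
  · exact (((hs 0 2 rfl (by decide) (by decide) true).trans
      (hs 2 4 rfl (by decide) (by decide) false)).trans
      (hs 4 6 rfl (by decide) (by decide) true)).trans (he 6 false 3 rfl)
  · exact ((hs 1 3 rfl (by decide) (by decide) true).trans
      (hs 3 5 rfl (by decide) (by decide) false)).trans (he 5 true 0 rfl)
  · exact (((hs 0 2 rfl (by decide) (by decide) false).trans
      (hs 2 4 rfl (by decide) (by decide) true)).trans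
      (hs 4 6 rfl (by decide) (by decide) false)).trans (he 6 true 1 rfl)
  · exact ((hs 1 3 rfl (by decide) (by decide) false).trans
      (hs 3 5 rfl (by decide) (by decide) true)).trans (he 5 false 2 rfl)

/-- If the gates lead to the marks with a shift by `e`, then the connected sum is a detour. -/
theorem isDetour_of_gate (e : Fin 4) (h : ∀ i, (p.glueFlags f₀ hτ m).zig.SameCycle
    (.inr (gate m i)) (.inl (p.mark f₀ (i + e)))) :
    IsDetour p.zig (p.glueFlags f₀ hτ m).zig (p.mark f₀) Sum.inl (· + 2 + e) where
  of_ne _ hx := sameCycle_of_zig_eq _ (p.glue_zig_inl f₀ hτ m hx)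
  of_eq _ i hx := (sameCycle_of_zig_eq _ (p.glue_zig_inl_mark f₀ hτ m hx)).trans (h (i + 2))

theorem isDetour_one : IsDetour p.zig (p.glueFlags f₀ hτ 1).zig (p.mark f₀) Sum.inl (· + 3) := by
  have h := p.isDetour_of_gate f₀ hτ 1 1 (p.sameCycle_gate_one f₀ hτ)
  rwa [show (fun i : Fin 4 => i + 2 + 1) = (· + 3) by decide] at h

theorem isDetour_two : IsDetour p.zig (p.glueFlags f₀ hτ 2).zig (p.mark f₀) Sum.inl (· + 2) := by
  have h := p.isDetour_of_gate f₀ hτ 2 0 fun i => by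
    rw [add_zero]; exact p.sameCycle_gate_two f₀ hτ i
  rwa [show (fun i : Fin 4 => i + 2 + 0) = (· + 2) by decide] at h

theorem isDetour_three :
    IsDetour p.zig (p.glueFlags f₀ hτ 3).zig (p.mark f₀) Sum.inl (· + 1) := by
  have h := p.isDetour_of_gate f₀ hτ 3 3 (p.sameCycle_gate_three f₀ hτ)
  rwa [show (fun i : Fin 4 => i + 2 + 3) = (· + 1) by decide] at h

end Flow

section Twice

variable {V : Type u} {K : Set (Finset V)} {X : Type w} (p : FlagSystem K X) (f₀ : X)
  {τ : Set (ℤ → V)} (hτ : ∀ x y, TypeII K τ x y ↔ p.Directed x y) (m : ℕ)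

/-- The flag system after two connected sums; the special pair of the second one consists of the
copies of the edges of the first one which are in the faces of the flags `f₀` and `rot f₀`. -/
noncomputable def glueTwice := (p.glueFlags f₀ hτ m).glueFlags (.inl f₀)
  (p.glueFlags f₀ hτ m).typeII_iff 1

theorem isDetour_glueTwice_right : IsDetour (p.glueFlags f₀ hτ m).zig
    (p.glueTwice f₀ hτ m).zig ((p.glueFlags f₀ hτ m).mark (.inl f₀)) Sum.inl (· + 3) :=
  isDetour_one _ _ _

theorem glueTwice_mark_two : (p.glueFlags f₀ hτ m).mark (.inl f₀) 2 = .inr (gate m 0) :=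
  p.gluedOpp_first f₀ m

theorem glueTwice_mark_three : (p.glueFlags f₀ hτ m).mark (.inl f₀) 3 = .inr (gate m 1) :=
  p.gluedOpp_second f₀ m

theorem glueTwice_inl {y : X ⊕ (Fin (m + 4) × Bool)} {x : X}
    (h : (p.glueFlags f₀ hτ m).zig y = .inl x) (h0 : x ≠ p.mark f₀ 0) (h1 : x ≠ p.mark f₀ 1) :
    (p.glueTwice f₀ hτ m).zig.SameCycle (.inl y) (.inl (.inl x)) := by
  rw [← h]
  refine (p.isDetour_glueTwice_right f₀ hτ m).of_ne y fun i => ?_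
  rw [h]
  fin_cases i
  · exact fun h => h0 (Sum.inl.inj h)
  · exact fun h => h1 (Sum.inl.inj h)
  · exact fun h => Sum.inl_ne_inr (h.trans (p.glueTwice_mark_two f₀ hτ m))
  · exact fun h => Sum.inl_ne_inr (h.trans (p.glueTwice_mark_three f₀ hτ m))

theorem glueTwice_inr {y : X ⊕ (Fin (m + 4) × Bool)} {g : Fin (m + 4) × Bool}
    (h : (p.glueFlags f₀ hτ m).zig y = .inr g) (h0 : g ≠ gate m 0) (h1 : g ≠ gate m 1) :
    (p.glueTwice f₀ hτ m).zig.SameCycle (.inl y) (.inl (.inr g)) := by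
  rw [← h]
  refine (p.isDetour_glueTwice_right f₀ hτ m).of_ne y fun i => ?_
  rw [h]
  fin_cases i
  · exact Sum.inr_ne_inl
  · exact Sum.inr_ne_inl
  · exact fun h => h0 (Sum.inr.inj (h.trans (p.glueTwice_mark_two f₀ hτ m)))
  · exact fun h => h1 (Sum.inr.inj (h.trans (p.glueTwice_mark_three f₀ hτ m)))

theorem glueTwice_mark_of_zig {y : X ⊕ (Fin (m + 4) × Bool)} (i : Fin 4)
    (h : (p.glueFlags f₀ hτ m).zig y = (p.glueFlags f₀ hτ m).mark (.inl f₀) i) :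
    (p.glueTwice f₀ hτ m).zig.SameCycle (.inl y)
      (.inl ((p.glueFlags f₀ hτ m).mark (.inl f₀) (i + 3))) :=
  (p.isDetour_glueTwice_right f₀ hτ m).of_eq y i h

/-- The detour of two successive connected sums, when the flags at the gates are known to lead to
the marks `γ i`. -/
theorem isDetour_glueTwice (γ : Fin 4 → Fin 4)
    (h0 : (p.glueTwice f₀ hτ m).zig.SameCycle (.inl (.inr (gate m 0)))
      (.inl (.inl (p.mark f₀ (γ 3)))))
    (h2 : (p.glueTwice f₀ hτ m).zig.SameCycle (.inl (.inr (gate m 2)))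
      (.inl (.inl (p.mark f₀ (γ 0)))))
    (h3 : (p.glueTwice f₀ hτ m).zig.SameCycle (.inl (.inr (gate m 3)))
      (.inl (.inl (p.mark f₀ (γ 1)))))
    (hγ : γ 2 = 1) :
    IsDetour p.zig (p.glueTwice f₀ hτ m).zig (p.mark f₀) (Sum.inl ∘ Sum.inl) γ where
  of_ne x hx := p.glueTwice_inl f₀ hτ m (p.glue_zig_inl f₀ hτ m hx) (hx 0) (hx 1)
  of_eq x i hx := by
    have hz := p.glue_zig_inl_mark f₀ hτ m hx
    fin_cases i
    · exact (p.glueTwice_inr f₀ hτ m hz (by simp [gate]) (by simp [gate])).trans h2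
    · exact (p.glueTwice_inr f₀ hτ m hz (by simp [gate]) (by simp [gate])).trans h3
    · have h := p.glueTwice_mark_of_zig f₀ hτ m 2
        (hz.trans (p.glueTwice_mark_two f₀ hτ m).symm)
      rw [show γ ⟨2, by decide⟩ = 1 from hγ]
      exact h
    · have h := p.glueTwice_mark_of_zig f₀ hτ m 3
        (hz.trans (p.glueTwice_mark_three f₀ hτ m).symm)
      rw [show (3 : Fin 4) + 3 = 2 from rfl, glueTwice_mark_two] at h
      exact h.trans h0

theorem glueTwice_one_gates :
    (p.glueTwice f₀ hτ 1).zig.SameCycle (.inl (.inr (gate 1 0))) (.inl (.inl (p.mark f₀ 0))) ∧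
    (p.glueTwice f₀ hτ 1).zig.SameCycle (.inl (.inr (gate 1 1))) (.inl (.inl (p.mark f₀ 2))) ∧
    (p.glueTwice f₀ hτ 1).zig.SameCycle (.inl (.inr (gate 1 2))) (.inl (.inl (p.mark f₀ 3))) ∧
    (p.glueTwice f₀ hτ 1).zig.SameCycle (.inl (.inr (gate 1 3))) (.inl (.inl (p.mark f₀ 2))) := by
  have hs := fun k l hl h0 h1 s => p.glueTwice_inr f₀ hτ 1
    (p.glue_zig_inr f₀ hτ 1 (k := k) (l := l) hl h0 h1 s)
  have he := fun k s i h => p.glue_zig_inr_exit f₀ hτ 1 (k := k) (s := s) (i := i) h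
  have hinj : ∀ {i k}, p.mark f₀ i ≠ p.mark f₀ k ↔ i ≠ k := (p.mark_injective f₀).ne_iff
  have e1 : (p.glueTwice f₀ hτ 1).zig.SameCycle (.inl (.inr (gate 1 1)))
      (.inl (.inl (p.mark f₀ 2))) :=
    (hs 1 3 rfl (by decide) (by decide) true (by decide) (by decide)).trans
      (p.glueTwice_inl f₀ hτ 1 (he 3 false 2 rfl) (hinj.2 (by decide)) (hinj.2 (by decide)))
  refine ⟨?_, e1, ?_, ?_⟩
  · exact ((hs 0 2 rfl (by decide) (by decide) true (by decide) (by decide)).trans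
      (hs 2 4 rfl (by decide) (by decide) false (by decide) (by decide))).trans
      (p.glueTwice_mark_of_zig f₀ hτ 1 1 (he 4 true 1 rfl))
  · exact ((hs 0 2 rfl (by decide) (by decide) false (by decide) (by decide)).trans
      (hs 2 4 rfl (by decide) (by decide) true (by decide) (by decide))).trans
      (p.glueTwice_inl f₀ hτ 1 (he 4 false 3 rfl) (hinj.2 (by decide)) (hinj.2 (by decide)))
  · have h := p.glueTwice_mark_of_zig f₀ hτ 1 0 (he 3 true 0 rfl)
    rw [show (0 : Fin 4) + 3 = 3 from rfl, glueTwice_mark_three] at h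
    exact ((hs 1 3 rfl (by decide) (by decide) false (by decide) (by decide)).trans h).trans e1

theorem glueTwice_two_gates :
    (p.glueTwice f₀ hτ 2).zig.SameCycle (.inl (.inr (gate 2 0))) (.inl (.inl (p.mark f₀ 0))) ∧
    (p.glueTwice f₀ hτ 2).zig.SameCycle (.inl (.inr (gate 2 1))) (.inl (.inl (p.mark f₀ 0))) ∧
    (p.glueTwice f₀ hτ 2).zig.SameCycle (.inl (.inr (gate 2 2))) (.inl (.inl (p.mark f₀ 2))) ∧
    (p.glueTwice f₀ hτ 2).zig.SameCycle (.inl (.inr (gate 2 3))) (.inl (.inl (p.mark f₀ 3))) := by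
  have hs := fun k l hl h0 h1 s => p.glueTwice_inr f₀ hτ 2
    (p.glue_zig_inr f₀ hτ 2 (k := k) (l := l) hl h0 h1 s)
  have he := fun k s i h => p.glue_zig_inr_exit f₀ hτ 2 (k := k) (s := s) (i := i) h
  have hinj : ∀ {i k}, p.mark f₀ i ≠ p.mark f₀ k ↔ i ≠ k := (p.mark_injective f₀).ne_iff
  have e1 : (p.glueTwice f₀ hτ 2).zig.SameCycle (.inl (.inr (gate 2 1)))
      (.inl (.inl (p.mark f₀ 0))) :=
    ((hs 1 3 rfl (by decide) (by decide) true (by decide) (by decide)).trans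
      (hs 3 5 rfl (by decide) (by decide) false (by decide) (by decide))).trans
      (p.glueTwice_mark_of_zig f₀ hτ 2 1 (he 5 true 1 rfl))
  refine ⟨?_, e1, ?_, ?_⟩
  · have h := p.glueTwice_mark_of_zig f₀ hτ 2 0 (he 4 true 0 rfl)
    rw [show (0 : Fin 4) + 3 = 3 from rfl, glueTwice_mark_three] at h
    exact (((hs 0 2 rfl (by decide) (by decide) true (by decide) (by decide)).trans
      (hs 2 4 rfl (by decide) (by decide) false (by decide) (by decide))).trans h).trans e1
  · exact ((hs 0 2 rfl (by decide) (by decide) false (by decide) (by decide)).trans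
      (hs 2 4 rfl (by decide) (by decide) true (by decide) (by decide))).trans
      (p.glueTwice_inl f₀ hτ 2 (he 4 false 2 rfl) (hinj.2 (by decide)) (hinj.2 (by decide)))
  · exact ((hs 1 3 rfl (by decide) (by decide) false (by decide) (by decide)).trans
      (hs 3 5 rfl (by decide) (by decide) true (by decide) (by decide))).trans
      (p.glueTwice_inl f₀ hτ 2 (he 5 false 3 rfl) (hinj.2 (by decide)) (hinj.2 (by decide)))

theorem isDetour_glueTwice_one :
    IsDetour p.zig (p.glueTwice f₀ hτ 1).zig (p.mark f₀) (Sum.inl ∘ Sum.inl) ![3, 2, 1, 0] :=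
  let h := p.glueTwice_one_gates f₀ hτ
  p.isDetour_glueTwice f₀ hτ 1 _ h.1 h.2.2.1 h.2.2.2 rfl

theorem isDetour_glueTwice_two :
    IsDetour p.zig (p.glueTwice f₀ hτ 2).zig (p.mark f₀) (Sum.inl ∘ Sum.inl) ![2, 3, 1, 0] :=
  let h := p.glueTwice_two_gates f₀ hτ
  p.isDetour_glueTwice f₀ hτ 2 _ h.1 h.2.2.1 h.2.2.2 rfl

end Twice

end FlagSystem

/-! ### Connected sums which merge zigzags -/

namespace FlagSystem

/-- The flag system `q` contains the flags of `p`, no zigzag of `p` is split in `q`, every zigzag of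
`q` comes from zigzags of `p`, and the zigzags of the four flags at the special pair given by `f`
are merged. -/
structure Merges {V : Type u} {K : Set (Finset V)} {X : Type w} (p : FlagSystem K X) (f : X)
    {W : Type u} {L : Set (Finset W)} {Y : Type w} (q : FlagSystem L Y) (j : X → Y) : Prop where
  sameCycle : ∀ x y, p.zig.SameCycle x y → q.zig.SameCycle (j x) (j y)
  cover : ∀ y, ∃ x, q.zig.SameCycle y (j x)
  opp : ∀ x, q.opp (j x) = j (p.opp x) ∨ q.zig.SameCycle (j x) (j (p.opp x))
  mark : ∀ i k, q.zig.SameCycle (j (p.mark f i)) (j (p.mark f k))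

variable {V : Type u} {K : Set (Finset V)} {X : Type w} (p : FlagSystem K X) (f₀ : X)
  {τ : Set (ℤ → V)} (hτ : ∀ x y, TypeII K τ x y ↔ p.Directed x y) {m : ℕ} {β : Fin 4 → Fin 4}

theorem merges_glueFlags
    (hd : IsDetour p.zig (p.glueFlags f₀ hτ m).zig (p.mark f₀) Sum.inl β)
    (hm : ∀ i k, (p.glueFlags f₀ hτ m).zig.SameCycle (.inl (p.mark f₀ i)) (.inl (p.mark f₀ k))) :
    p.Merges f₀ (p.glueFlags f₀ hτ m) Sum.inl where
  sameCycle _ _ h := hd.sameCycle hm h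
  cover y := by
    rcases y with x | h
    · exact ⟨x, .refl _ _⟩
    · obtain ⟨i, hi⟩ := p.exists_sameCycle_mark f₀ hτ m h
      exact ⟨_, hi⟩
  opp x := by
    by_cases hx : ∃ i, x = p.mark f₀ i
    · obtain ⟨i, rfl⟩ := hx
      rw [opp_mark]
      exact .inr (hm _ _)
    · push Not at hx
      exact .inl (p.glue_opp_inl f₀ hτ m hx)
  mark := hm

theorem merges_glueTwice
    (hd : IsDetour p.zig (p.glueTwice f₀ hτ m).zig (p.mark f₀) (Sum.inl ∘ Sum.inl) β)
    (h0 : ∃ i, (p.glueTwice f₀ hτ m).zig.SameCycle (.inl (.inr (gate m 0)))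
      (.inl (.inl (p.mark f₀ i))))
    (h1 : ∃ i, (p.glueTwice f₀ hτ m).zig.SameCycle (.inl (.inr (gate m 1)))
      (.inl (.inl (p.mark f₀ i))))
    (hm : ∀ i k, (p.glueTwice f₀ hτ m).zig.SameCycle (.inl (.inl (p.mark f₀ i)))
      (.inl (.inl (p.mark f₀ k)))) :
    p.Merges f₀ (p.glueTwice f₀ hτ m) (Sum.inl ∘ Sum.inl) := by
  have h2 : ∀ i, (p.glueTwice f₀ hτ m).zig.SameCycle
      (.inl ((p.glueFlags f₀ hτ m).mark (.inl f₀) i)) (.inl (.inl (p.mark f₀ 0))) := by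
    obtain ⟨a, ha⟩ := h0
    obtain ⟨b, hb⟩ := h1
    intro i
    fin_cases i
    · exact hm 0 0
    · exact hm 1 0
    · have h := ha.trans (hm a 0)
      rw [← glueTwice_mark_two] at h
      exact h
    · have h := hb.trans (hm b 0)
      rw [← glueTwice_mark_three] at h
      exact h
  have hr : ∀ {x y}, (p.glueFlags f₀ hτ m).zig.SameCycle x y →
      (p.glueTwice f₀ hτ m).zig.SameCycle (.inl x) (.inl y) :=
    (p.isDetour_glueTwice_right f₀ hτ m).sameCycle fun i k => (h2 i).trans (h2 k).symm
  refine ⟨fun _ _ h => hd.sameCycle hm h, ?_, ?_, hm⟩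
  · rintro ((x | h) | h)
    · exact ⟨x, .refl _ _⟩
    · obtain ⟨i, hi⟩ := p.exists_sameCycle_mark f₀ hτ m h
      exact ⟨_, hr hi⟩
    · obtain ⟨i, hi⟩ := (p.glueFlags f₀ hτ m).exists_sameCycle_mark (.inl f₀)
        (p.glueFlags f₀ hτ m).typeII_iff 1 h
      exact ⟨_, hi.trans (h2 i)⟩
  · intro x
    by_cases hx : ∃ i, x = p.mark f₀ i
    · obtain ⟨i, rfl⟩ := hx
      rw [opp_mark]
      exact .inr (hm _ _)
    · push Not at hx
      refine .inl (((p.glueFlags f₀ hτ m).glue_opp_inl (.inl f₀) _ 1 fun i => ?_).trans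
        (congrArg Sum.inl (p.glue_opp_inl f₀ hτ m hx)))
      fin_cases i
      · exact fun h => hx 0 (Sum.inl.inj h)
      · exact fun h => hx 1 (Sum.inl.inj h)
      · exact fun h => Sum.inl_ne_inr (h.trans (p.glueTwice_mark_two f₀ hτ m))
      · exact fun h => Sum.inl_ne_inr (h.trans (p.glueTwice_mark_three f₀ hτ m))

/-- One or two connected sums with bipyramids merge the zigzags at a special pair, unless each
of the two flags on one side of the path is on a common zigzag with the flag on the other side at
the other edge of the path. -/
theorem exists_merges [Finite X]
    (h : ¬ (p.zig.SameCycle (p.mark f₀ 0) (p.mark f₀ 3) ∧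
      p.zig.SameCycle (p.mark f₀ 1) (p.mark f₀ 2))) :
    (∃ m, p.Merges f₀ (p.glueFlags f₀ hτ m) Sum.inl) ∨
      ∃ m, p.Merges f₀ (p.glueTwice f₀ hτ m) (Sum.inl ∘ Sum.inl) := by
  obtain ⟨σ, hσ⟩ := exists_isReturn p.zig (p.mark_injective f₀)
  rcases exists_detour σ with ⟨⟨a, ha⟩, b, hb⟩ | ⟨β, hβ, htrans⟩
  · exact absurd ⟨ha ▸ hσ.sameCycle_iterate 0 a, hb ▸ hσ.sameCycle_iterate 1 b⟩ h
  have hall : ∀ {Y : Type w} {S : Equiv.Perm Y} {j : X → Y}, IsDetour p.zig S (p.mark f₀) j β →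
      ∀ i k, S.SameCycle (j (p.mark f₀ i)) (j (p.mark f₀ k)) := by
    intro Y S j hd i k
    obtain ⟨a, rfl⟩ := htrans i
    obtain ⟨b, rfl⟩ := htrans k
    exact (hd.sameCycle_iterate hσ 0 a).symm.trans (hd.sameCycle_iterate hσ 0 b)
  simp only [List.mem_cons, List.not_mem_nil, or_false] at hβ
  rcases hβ with rfl | rfl | rfl | rfl | rfl
  · have hd := p.isDetour_one f₀ hτ
    exact .inl ⟨1, p.merges_glueFlags f₀ hτ hd (hall hd)⟩
  · have hd := p.isDetour_two f₀ hτ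
    exact .inl ⟨2, p.merges_glueFlags f₀ hτ hd (hall hd)⟩
  · have hd := p.isDetour_three f₀ hτ
    exact .inl ⟨3, p.merges_glueFlags f₀ hτ hd (hall hd)⟩
  · have hd := p.isDetour_glueTwice_one f₀ hτ
    have hg := p.glueTwice_one_gates f₀ hτ
    exact .inr ⟨1, p.merges_glueTwice f₀ hτ hd ⟨_, hg.1⟩ ⟨_, hg.2.1⟩ (hall hd)⟩
  · have hd := p.isDetour_glueTwice_two f₀ hτ
    have hg := p.glueTwice_two_gates f₀ hτ
    exact .inr ⟨2, p.merges_glueTwice f₀ hτ hd ⟨_, hg.1⟩ ⟨_, hg.2.1⟩ (hall hd)⟩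

end FlagSystem

/-! ### Iterated connected sums with bipyramids -/

/-- An iterated connected sum of `(K, τ)` with bipyramids, together with its flag system and the
inclusion `incl` of the flags of `K`: the special pairs at which the sums are taken never separate a
flag of `K` from the next flag around its centre. -/
structure BipyramidSum {V : Type u} (K : Set (Finset V)) (τ : Set (ℤ → V)) {X₀ : Type u}
    (p₀ : FlagSystem K X₀) (M : Type v) [TopologicalSpace M] where
  n : ℕ
  W : Type u
  L : Set (Finset W)
  σ : Set (ℤ → W)
  D : W → W → Prop
  iteratedSum : IteratedSum K τ n L σ D
  X : Type u
  finite : Finite X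
  flags : FlagSystem L X
  typeII_iff : ∀ x y, TypeII L σ x y ↔ flags.Directed x y
  isConnected : flags.IsConnected
  isZHomogeneous : IsZHomogeneous L σ
  triangulates : Triangulates L M
  incl : X₀ → X
  rot_incl : ∀ f, flags.rot (incl f) = incl (p₀.rot f)
  directed_incl : ∀ f, D (flags.src (incl f)) (flags.tgt (incl f))

namespace BipyramidSum

variable {V : Type u} {K : Set (Finset V)} {τ : Set (ℤ → V)} {X₀ : Type u} {p₀ : FlagSystem K X₀}
  {M : Type v} [TopologicalSpace M]

/-- The connected sum with a further bipyramid. -/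
noncomputable def glue (S : BipyramidSum K τ p₀ M) (f : X₀) (m : ℕ) : BipyramidSum K τ p₀ M where
  n := S.n + 1
  W := S.flags.GlueVertex (S.incl f) S.typeII_iff m
  L := S.flags.glueFaces (S.incl f) S.typeII_iff m
  σ := (S.flags.glueFlags (S.incl f) S.typeII_iff m).zigzags
  D := liftEdges _ _ _ S.D
  iteratedSum := .succ S.iteratedSum (bipyramid_isSpherical m)
    (S.flags.pairAt (S.incl f) S.typeII_iff) (bipyramidPair m) (S.directed_incl f)
    (by
      have h := S.directed_incl (p₀.rot f)
      rw [← S.rot_incl, S.flags.src_rot] at h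
      exact h)
    SpecialHomeo.id (.inr (bipyramid_not_adj m)) (S.flags.isSumOrientation S.typeII_iff _ m)
  X := S.X ⊕ (Fin (m + 4) × Bool)
  finite := have := S.finite; inferInstance
  flags := S.flags.glueFlags (S.incl f) S.typeII_iff m
  typeII_iff := FlagSystem.typeII_iff _
  isConnected := S.flags.glueFlags_isConnected _ _ m S.isConnected
  isZHomogeneous :=
    have := S.finite
    have : Nonempty (S.X ⊕ (Fin (m + 4) × Bool)) := ⟨.inl (S.incl f)⟩
    FlagSystem.isZHomogeneous (S.flags.glueFlags_isConnected _ _ m S.isConnected)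
  triangulates := S.flags.triangulates_glueFaces _ _ m S.triangulates
  incl g := .inl (S.incl g)
  rot_incl g := congrArg Sum.inl (S.rot_incl g)
  directed_incl g := S.flags.liftEdges_inl S.typeII_iff _ m (S.directed_incl g)

/-- The flags of `K` are on all zigzags, and their neighbours across directed edges in the connected
sum are their neighbours in `K`, at least up to zigzags. -/
structure IsCovered (S : BipyramidSum K τ p₀ M) : Prop where
  cover : ∀ x, ∃ f, S.flags.zig.SameCycle x (S.incl f)
  opp : ∀ f, S.flags.opp (S.incl f) = S.incl (p₀.opp f) ∨
    S.flags.zig.SameCycle (S.incl f) (S.incl (p₀.opp f))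

/-- The pairs of flags of `K` which are on the same zigzag of the connected sum. -/
def linked (S : BipyramidSum K τ p₀ M) : Set (X₀ × X₀) :=
  {a | S.flags.zig.SameCycle (S.incl a.1) (S.incl a.2)}

variable {S S' : BipyramidSum K τ p₀ M} {f : X₀} {j : S.X → S'.X}

theorem IsCovered.of_merges (hS : S.IsCovered) (h : S.flags.Merges (S.incl f) S'.flags j)
    (hj : ∀ g, S'.incl g = j (S.incl g)) : S'.IsCovered where
  cover y := by
    obtain ⟨x, hx⟩ := h.cover y
    obtain ⟨g, hg⟩ := hS.cover x
    exact ⟨g, hj g ▸ hx.trans (h.sameCycle _ _ hg)⟩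
  opp g := by
    rw [hj, hj]
    rcases hS.opp g with hg | hg
    · rw [← hg]; exact h.opp _
    · exact .inr (h.sameCycle _ _ hg)

theorem IsCovered.linked_ssubset (hS : S.IsCovered) (h : S.flags.Merges (S.incl f) S'.flags j)
    (hj : ∀ g, S'.incl g = j (S.incl g))
    (hf : ¬ (S.flags.zig.SameCycle (S.flags.mark (S.incl f) 0) (S.flags.mark (S.incl f) 3) ∧
      S.flags.zig.SameCycle (S.flags.mark (S.incl f) 1) (S.flags.mark (S.incl f) 2))) :
    S.linked ⊂ S'.linked := by
  refine ⟨fun a ha => ?_, fun hsub => hf ?_⟩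
  · change S'.flags.zig.SameCycle _ _
    rw [hj, hj]
    exact h.sameCycle _ _ ha
  · have key : ∀ i k, S.flags.zig.SameCycle (S.flags.mark (S.incl f) i)
        (S.flags.mark (S.incl f) k) := by
      intro i k
      obtain ⟨a, ha⟩ := hS.cover (S.flags.mark (S.incl f) i)
      obtain ⟨b, hb⟩ := hS.cover (S.flags.mark (S.incl f) k)
      have hab : (a, b) ∈ S'.linked := by
        change S'.flags.zig.SameCycle _ _
        rw [hj, hj]
        exact (h.sameCycle _ _ ha).symm.trans ((h.mark i k).trans (h.sameCycle _ _ hb))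
      exact ha.trans (Equiv.Perm.SameCycle.trans (hsub hab) hb.symm)
    exact ⟨key 0 3, key 1 2⟩

/-- If the flags at each special pair of flags of `K` are linked crosswise, then there is only one
zigzag. -/
theorem IsCovered.sameCycle (hS : S.IsCovered) (hp₀ : p₀.IsConnected)
    (h : ∀ f, S.flags.zig.SameCycle (S.flags.mark (S.incl f) 0) (S.flags.mark (S.incl f) 3) ∧
      S.flags.zig.SameCycle (S.flags.mark (S.incl f) 1) (S.flags.mark (S.incl f) 2)) (x y : S.X) :
    S.flags.zig.SameCycle x y := by
  have hrot : ∀ f, S.flags.zig.SameCycle (S.incl f) (S.incl (p₀.rot f)) := by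
    intro f
    have h1 := (h (p₀.rot f)).1
    have h2 : S.flags.mark (S.incl (p₀.rot f)) 3 = S.flags.zig (S.incl f) := by
      rw [FlagSystem.zig_apply, S.rot_incl]; rfl
    rw [h2] at h1
    exact (S.flags.sameCycle_zig _).trans h1.symm
  have hopp : ∀ f, S.flags.zig.SameCycle (S.incl f) (S.incl (p₀.opp f)) := by
    intro f
    rcases hS.opp f with hf | hf
    · have h1 := (h f).2
      have h2 : S.flags.mark (S.incl f) 1 = S.incl (p₀.rot f) := S.rot_incl f
      have h3 : S.flags.mark (S.incl f) 2 = S.incl (p₀.opp f) := hf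
      rw [h2, h3] at h1
      exact (hrot f).trans h1
    · exact hf
  have hall : ∀ f g, S.flags.zig.SameCycle (S.incl f) (S.incl g) := fun f g =>
    FlagSystem.eqvGen_le (E := fun f g => S.flags.zig.SameCycle (S.incl f) (S.incl g))
      ⟨fun _ => .refl _ _, fun h => h.symm, fun h h' => h.trans h'⟩
      (by rintro a b (rfl | rfl); exacts [hrot a, hopp a]) (hp₀.conn f g)
  obtain ⟨f, hf⟩ := hS.cover x
  obtain ⟨g, hg⟩ := hS.cover y
  exact hf.trans ((hall f g).trans hg.symm)

/-- Induction on the number of pairs of flags of `K` which are not yet on a common zigzag. -/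
theorem IsCovered.exists_isZKnotted [Finite X₀] [Nonempty X₀] (hp₀ : p₀.IsConnected)
    (hS : S.IsCovered) : ∃ S' : BipyramidSum K τ p₀ M, IsZKnotted S'.L := by
  induction hR : S.linked using WellFoundedGT.induction generalizing S with
  | ind R ih =>
  subst hR
  have := S.finite
  by_cases h : ∀ f, S.flags.zig.SameCycle (S.flags.mark (S.incl f) 0) (S.flags.mark (S.incl f) 3) ∧
      S.flags.zig.SameCycle (S.flags.mark (S.incl f) 1) (S.flags.mark (S.incl f) 2)
  · have : Nonempty S.X := ‹Nonempty X₀›.map S.incl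
    exact ⟨S, S.flags.isZKnotted (hS.sameCycle hp₀ h)⟩
  · push Not at h
    obtain ⟨f, hf⟩ := h
    have hf' := fun h : _ ∧ _ => hf h.1 h.2
    rcases S.flags.exists_merges (S.incl f) S.typeII_iff hf' with ⟨m, hm⟩ | ⟨m, hm⟩
    · have hm' : S.flags.Merges (S.incl f) (S.glue f m).flags Sum.inl := hm
      exact ih _ (hS.linked_ssubset hm' (fun _ => rfl) hf') (hS.of_merges hm' fun _ => rfl) rfl
    · have hm' : S.flags.Merges (S.incl f) ((S.glue f m).glue f 1).flags (Sum.inl ∘ Sum.inl) := hm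
      exact ih _ (hS.linked_ssubset hm' (fun _ => rfl) hf') (hS.of_merges hm' fun _ => rfl) rfl

end BipyramidSum

end ZTri

theorem theorem1 {V : Type u} {M : Type v} [TopologicalSpace M]
    (K : Set (Finset V)) (τ : Set (ℤ → V))
    (hΓ : ZTri.IsZHomogeneous K τ) (hM : ZTri.Triangulates K M) :
    ∃ (n : ℕ) (W : Type u) (L : Set (Finset W)) (σ : Set (ℤ → W)) (D : W → W → Prop),
      ZTri.IteratedSum K τ n L σ D ∧
      ZTri.IsZHomogeneous L σ ∧ ZTri.Triangulates L M ∧ ZTri.IsZKnotted L := by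
  have hV := hΓ.surface.finite
  have hX : Finite (ZTri.IsZHomogeneous.Flag K τ) := Subtype.finite
  have hX' : Nonempty (ZTri.IsZHomogeneous.Flag K τ) := by
    obtain ⟨x⟩ := hΓ.surface.connected.nonempty
    exact (hΓ.flagSystem.exists_flag x).nonempty
  let S : ZTri.BipyramidSum K τ hΓ.flagSystem M := {
    n := 0, W := V, L := K, σ := τ, D := ZTri.TypeII K τ
    iteratedSum := .zero
    X := ZTri.IsZHomogeneous.Flag K τ
    finite := hX
    flags := hΓ.flagSystem
    typeII_iff := hΓ.typeII_iff_directed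
    isConnected := hΓ.flagSystem_isConnected
    isZHomogeneous := hΓ
    triangulates := hM
    incl := id
    rot_incl := fun _ => rfl
    directed_incl := fun f => (hΓ.typeII_iff_directed _ _).2 ⟨f, rfl, rfl⟩ }
  have hS : S.IsCovered := ⟨fun x => ⟨x, .refl _ _⟩, fun _ => .inl rfl⟩
  obtain ⟨S', hS'⟩ := hS.exists_isZKnotted hΓ.flagSystem_isConnected
  exact ⟨S'.n, S'.W, S'.L, S'.σ, S'.D, S'.iteratedSum, S'.isZHomogeneous, S'.triangulates, hS'⟩
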